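/- **Setting.** Let $n,l\ge 1$ and $m\ge 0$ be integers with $l<2^m$, let $g:\{0,1\}^n\to\{0,1\}$ be a function, and let $s_{(x_1,\dots,x_k)}\in\{0,1\}^n$ ($0\le k\le l$, $x_i\in\{0,1\}^n$; $s_{(\emptyset)}$ for $k=0$) be secrets with $$g\big(s_{(x_1,\dots,x_k)}\big)=s_{(x_1,\dots,x_{k-1})}\cdot x_k \bmod 2\qquad(1\le k\le l).$$ *Variables.* Quantum variables have type $\mathcal H_2$ (dimension $2$), $\mathcal H_c$ (dimension $2^m$, basis $|0\rangle,\dots,|2^m-1\rangle$) or $\mathcal H_d$ (dimension $2^n$), with infinitely many variables of each type. $p,q$ are variables of type $\mathcal H_c$; $Y,Y',Z$ of type $\mathcal H_2$; and $\mathbb X$ is an array with components $\mathbb X[0],\dots,\mathbb X[2^m-1]$ of type $\mathcal H_d$. $\mathbb X[q]$ is the component selected (coherently) by the basis states of $q$, so an operator applied to $\mathbb X[q]$ is controlled by $q$. *Programs.* Statements are $\bot$, $\mathbf{skip}$, $r:=|0\rangle$, $r \mathrel{*}= U$ (unitary $U$), $S_1;S_2$, $\mathbf{if}\,(\Box k\cdot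 M[r]=k\to S_k)$ for a measurement $M=\{M_k\}$, $\mathbf{Local}\ r;S;\mathbf{Release}\ r$, and calls $\mathbf{Call}\ f(r)$ of declared procedures $f$ with formal parameters $q_f$ and body $S_f$. The procedure $\mathrm{RQFS}(q,Y)$ has the body $\mathbf{if}\,(\Box k\cdot M[q]=k\to S_k)$ with $M_0=\sum_{i<l}|i\rangle\langle i|$, $M_1=|l\rangle\langle l|$, $M_2=\sum_{i>l}|i\rangle\langle i|$ and $$\begin{aligned}S_0={}&q\mathrel{*}=U_{+1};\ \mathbf{Local}\ \mathbb X[q],Y';\ (\mathbb X[q],Y')\mathrel{*}=H^{\otimes n}\otimes HX;\ \mathbf{Call}\ \mathrm{RQFS}(q,Y');\\&\mathbb X[q]\mathrel{*}=H^{\otimes n};\ (\mathbb X[q],Y)\mathrel{*}=\mathcal G;\ \mathbb X[q]\mathrel{*}=H^{\otimes n};\ \mathbf{Call}\ \mathrm{RQFS}(q,Y');\\&(\mathbb X[q],Y')\mathrel{*}=H^{\otimes n}\otimes XH;\ \mathbf{Release}\ \mathbb X[q],Y';\ q\mathrel{*}=U_{-1},\\ S_1={}&(\mathbb X[1],\dots,\mathbb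 X[l],Y)\mathrel{*}=\mathcal O,\qquad S_2=\bot.\end{aligned}$$ Here $U_{\pm1}|x\rangle=|x\pm1 \bmod 2^m\rangle$, $H$ is the Hadamard and $X$ the Pauli-$X$ matrix, $\mathcal G|u\rangle|y\rangle=|u\rangle|y\oplus g(u)\rangle$, and $\mathcal O|x_1\rangle\cdots|x_l\rangle|y\rangle=|x_1\rangle\cdots|x_l\rangle|y\oplus g(s_{(x_1,\dots,x_l)})\rangle$. The main program is $$\mathit{main}=\ (p,Z):=|0\rangle;\ \mathbf{Call}\ \mathrm{RQFS}(p,Z);\ \mathbf{if}\,(\Box k\cdot M'[Z]=k\to\mathbf{skip}),\qquad M'=\{|0\rangle\langle0|,|1\rangle\langle1|\}.$$ *Assertions.* A quantum predicate variable ranges over the operators $0\sqsubseteq K\sqsubseteq I$ on a fixed finite set of quantum variables ($\sqsubseteq$ is the Löwner order). An assertion is a parameterized quantum predicate term $\mathcal E^*(B)+\mathcal F^*(I)$ on a finite set of quantum variables, where $B$ is a tensor product of finitely many predicate variables (its parameters) on disjoint sets of quantum variables, and the identity elsewhere, $\mathcal E,\mathcal F$ are completely positive with $(\mathcal E+\mathcal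 F)^*(I)\sqsubseteq I$, and ${}^*$ is the Heisenberg dual. Assertions are taken up to equality of denotations for all values of the parameters, and $P$ is identified with $P\otimes I$. $\mathrm{trueOrder}$ is the set of all formulas $P\sqsubseteq Q$, with $P,Q$ having the same parameters, that hold for all values of the parameters. *Proof system.* All triples $\langle P\rangle S\langle Q\rangle$ have equal parameters in $P$ and $Q$. The system $\mathrm{qBE}$ has the following axioms and rules: (A Bot) $\langle 0\rangle\bot\langle Q\rangle$; (A Skip) $\langle P\rangle\mathbf{skip}\langle P\rangle$; (A Init) $\langle\sum_c|c\rangle_r\langle0|Q|0\rangle_r\langle c|\rangle\ r:=|0\rangle\ \langle Q\rangle$; (A Unit) $\langle U^\dagger QU\rangle\ r\mathrel{*}=U\ \langle Q\rangle$; (R Comp) from $\langle P\rangle S_1\langle Q\rangle$ and $\langle Q\rangle S_2\langle R\rangle$ infer $\langle P\rangle S_1;S_2\langle R\rangle$; (R Case) from $\langle P_k\rangle S_k\langle Q\rangle$ for all $k$ infer $\langle\sum_kM_k^\dagger P_kM_k\rangle\ \mathbf{if}\,(\Box k\cdot M[r]=k\to S_k)\ \langle Q\rangle$; (R Order) from $P\sqsubseteq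 P'$, $\langle P'\rangle S\langle Q'\rangle$, $Q'\sqsubseteq Q$ infer $\langle P\rangle S\langle Q\rangle$; (R Subst) from $\langle P\rangle S\langle Q\rangle$ infer $\langle P[R/K]\rangle S\langle Q[R/K]\rangle$, for a predicate variable $K$ and a term $R$ on the same quantum variables; (R Loc) from $\langle P\rangle\ r':=|0\rangle;S[r'/r]\ \langle Q\rangle$ infer $\langle P\rangle\ \mathbf{Local}\ r;S;\mathbf{Release}\ r\ \langle Q\rangle$, where $r'$ consists of fresh variables, on which $P,Q$ act as the identity (an array component $\mathbb X[q]$ in $r$ may stay itself in $r'$); (R Adap) from $\langle P\rangle S\langle Q\rangle$ infer the triple obtained by simultaneously renaming pairwise distinct quantum variables in $P,S,Q$ by pairwise distinct variables of the same types, not touching variables that procedure bodies use without being parameters. The system $\mathrm{qTP}$ is $\mathrm{qBE}$ plus the rule (Rt pRec): if for each procedure $f$ the assertions $P_{f,0}\sqsubseteq P_{f,1}\sqsubseteq\cdots$ have the form $P_{f,j}=\mathcal E_{f,j}^*(R_f)$ for a term $R_f$ and quantum operations $\mathcal E_{f,0}\sqsubseteq\mathcal E_{f,1}\sqsubseteq\cdots$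 (differences completely positive) with limit $\mathcal E_f$, $P_{f,0}=0$, and for every $j$ and $f$ the triple $\langle P_{f,j+1}\rangle S_f\langle Q_f\rangle$ is derivable in $\mathrm{qBE}$ from the hypotheses $\{\langle P_{f',j}\rangle\mathbf{Call}\ f'(q_{f'})\langle Q_{f'}\rangle\}_{f'}$, and $P'_f\sqsubseteq\mathcal E_f^*(R_f)$, then $\langle P'_f\rangle\mathbf{Call}\ f(q_f)\langle Q_f\rangle$ for each $f$. In both systems the ordering formulas that may be used are those of $\mathrm{trueOrder}$; we write $\mathrm{trueOrder}\vdash_{\mathrm{qTP}}$ for derivability in $\mathrm{qTP}$. **Proposition.** With the declaration of $\mathrm{RQFS}$ above, $$\mathrm{trueOrder}\ \vdash_{\mathrm{qTP}}\ \big\langle I_p\otimes I_Z\big\rangle\ \mathit{main}\ \big\langle\,|0\rangle\langle0|_p\otimes|g(s_{(\emptyset)})\rangle\langle g(s_{(\emptyset)})|_Z\,\big\rangle ,$$ which is the formal expression, in the proof system, of the claim that $\mathit{main}$ always terminates with output $|0\rangle_p\otimes|g(s_{(\emptyset)})\rangle_Z$. -/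

import Mathlib

open scoped Matrix ComplexOrder BigOperators

namespace RQFS

/-! ## Quantum variables and their state spaces -/

/-- Types of quantum variables: a qubit (`bit`, the space `H_2`), a counter (`cnt`, the
`2^m`-dimensional space `H_c`) and a register of `n` qubits (`vec`, the `2^n`-dimensional
space `H_d`). -/
inductive Ty where
  | bit
  | cnt
  | vec
  deriving DecidableEq

/-- The computational basis of the state space of a variable of the given type. -/
def Basis (n m : ℕ) : Ty → Type
  | .bit => ZMod 2
  | .cnt => Fin (2 ^ m)
  | .vec => Fin n → ZMod 2

instance (n m : ℕ) (τ : Ty) : Fintype (Basis n m τ) :=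
  match τ with
  | .bit => inferInstanceAs (Fintype (ZMod 2))
  | .cnt => inferInstanceAs (Fintype (Fin (2 ^ m)))
  | .vec => inferInstanceAs (Fintype (Fin n → ZMod 2))

instance (n m : ℕ) (τ : Ty) : DecidableEq (Basis n m τ) :=
  match τ with
  | .bit => inferInstanceAs (DecidableEq (ZMod 2))
  | .cnt => inferInstanceAs (DecidableEq (Fin (2 ^ m)))
  | .vec => inferInstanceAs (DecidableEq (Fin n → ZMod 2))

/-- The index of the default basis state `|0⟩`. -/
instance (n m : ℕ) (τ : Ty) : Zero (Basis n m τ) :=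
  match τ with
  | .bit => inferInstanceAs (Zero (ZMod 2))
  | .cnt => inferInstanceAs (Zero (Fin (2 ^ m)))
  | .vec => inferInstanceAs (Zero (Fin n → ZMod 2))

/-- Names of quantum variables: individual variables, and the components `𝕏_a[i]` of the
array-like variable number `a`, which are indexed by the basis states of a counter. -/
inductive QName (m : ℕ) where
  | var (k : ℕ)
  | cell (a : ℕ) (i : Fin (2 ^ m))
  deriving DecidableEq

/-- A quantum variable is a typed name; there are infinitely many of each type. -/
abbrev QVar (m : ℕ) := Ty × QName m

/-- Basis configurations of all quantum variables together. -/
abbrev Mem (n m : ℕ) := (x : QVar m) → Basis n m x.1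

/-- Operators on all variables, by matrix entries. Only operators `A ⊗ I`, with `A` on finitely
many variables, are ever used (see `ext`). -/
abbrev Op (n m : ℕ) := Matrix (Mem n m) (Mem n m) ℂ

/-- Basis configurations of a finite set `Γ` of quantum variables: the computational basis of
the space `H_Γ`. -/
abbrev Cfg (n : ℕ) {m : ℕ} (Γ : Finset (QVar m)) := (x : Γ) → Basis n m x.1.1

/-- The restriction of a configuration of `Γ` to a subset of `Γ`. -/
def Cfg.restrict {n m : ℕ} {Δ Γ : Finset (QVar m)} (h : Δ ⊆ Γ) (a : Cfg n Γ) : Cfg n Δ :=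
  fun x => a ⟨x.1, h x.2⟩

/-- The restriction of a global configuration to `Γ`. -/
def Mem.restrict {n m : ℕ} (Γ : Finset (QVar m)) (σ : Mem n m) : Cfg n Γ := fun x => σ x.1

open Classical in
/-- The operator `A ⊗ I`, where `A` acts on `H_Γ` and `I` on all other variables. This realizes
the convention that `A` and `A ⊗ I` are identified. -/
noncomputable def ext {n m : ℕ} (Γ : Finset (QVar m)) (A : Matrix (Cfg n Γ) (Cfg n Γ) ℂ) :
    Op n m :=
  Matrix.of fun σ σ' => if ∀ x, x ∉ Γ → σ x = σ' x then A (σ.restrict Γ) (σ'.restrict Γ) else 0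

/-! ## References to registers -/

/-- References occurring in programs: an individual variable `var k`, an array component
`𝕏_a[i]` with a fixed index, or an array component `𝕏_a[q]` (`elem a j`) whose index is given by
the counter variable `q = (cnt, var j)`. -/
inductive Ref (m : ℕ) where
  | var (k : ℕ)
  | cell (a : ℕ) (i : Fin (2 ^ m))
  | elem (a : ℕ) (j : ℕ)

/-- The variable denoted by a reference of type `τ` when the basis configuration is `σ`
(so `𝕏[|i⟩]` is `𝕏[i]`). -/
def Ref.loc {n m : ℕ} (σ : Mem n m) (τ : Ty) : Ref m → QVar m
  | .var k => (τ, .var k)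
  | .cell a i => (τ, .cell a i)
  | .elem a j => (τ, .cell a (σ (Ty.cnt, .var j)))

theorem Ref.loc_fst {n m : ℕ} (σ : Mem n m) (τ : Ty) (r : Ref m) : (r.loc σ τ).1 = τ := by
  cases r <;> rfl

/-- A finite tuple of typed references, such as `(𝕏[q], Y)`. -/
structure Regs (m : ℕ) : Type 1 where
  ι : Type
  [fin : Fintype ι]
  [dec : DecidableEq ι]
  τ : ι → Ty
  ref : ι → Ref m

attribute [instance] Regs.fin Regs.dec

/-- The computational basis of the space on which operators on the tuple act. -/
abbrev Regs.Cfg (n : ℕ) {m : ℕ} (r : Regs m) := (i : r.ι) → Basis n m (r.τ i)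

/-- The one-element tuple. -/
def Regs.one {m : ℕ} (τ : Ty) (v : Ref m) : Regs m where
  ι := Unit
  τ := fun _ => τ
  ref := fun _ => v

/-- Concatenation of tuples. -/
def Regs.app {m : ℕ} (r s : Regs m) : Regs m where
  ι := r.ι ⊕ s.ι
  τ := Sum.elim r.τ s.τ
  ref := Sum.elim r.ref s.ref

namespace Regs

variable {n m : ℕ}

/-- The variable to which the `i`-th reference points in configuration `σ`. -/
def loc (r : Regs m) (σ : Mem n m) (i : r.ι) : QVar m := (r.ref i).loc σ (r.τ i)

/-- The contents of the tuple in configuration `σ`. -/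
def get (r : Regs m) (σ : Mem n m) : r.Cfg n :=
  fun i => cast (congrArg (Basis n m) (Ref.loc_fst σ (r.τ i) (r.ref i))) (σ (r.loc σ i))

open Classical in
/-- The configuration obtained from `σ` by writing `a` into the tuple. -/
noncomputable def set (r : Regs m) (σ : Mem n m) (a : r.Cfg n) : Mem n m := fun x =>
  if h : ∃ i, r.loc σ i = x then
    cast (congrArg (Basis n m) ((Ref.loc_fst σ _ _).symm.trans (congrArg Prod.fst h.choose_spec)))
      (a h.choose)
  else σ x

/-- The tuple is well formed: in every basis configuration its references point to pairwise
distinct variables, and writing to them does not move them (no entry is the index of an array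
reference of the tuple). -/
def WF (n : ℕ) {m : ℕ} (r : Regs m) : Prop :=
  ∀ σ : Mem n m, Function.Injective (r.loc σ) ∧ ∀ a, r.loc (r.set σ a) = r.loc σ

/-- The operator `A† P A`, where `A` acts on the tuple `r` (for a reference `𝕏[q]`, this is `A`
controlled by `q`). With `Â` the extension of `A` to all variables, `Â` has at row `ρ`, column `σ`
the entry `A a (get σ)` if `ρ = set σ a`, and `0` if `ρ` is not of this form. -/
noncomputable def conj (r : Regs m) (A : Matrix (r.Cfg n) (r.Cfg n) ℂ) (P : Op n m) : Op n m :=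
  Matrix.of fun σ σ' => ∑ a : r.Cfg n, ∑ b : r.Cfg n,
    star (A a (r.get σ)) * P (r.set σ a) (r.set σ' b) * A b (r.get σ')

/-- `A` has the form `A' ⊗ I_r`: it does not involve the registers of the tuple `r`. -/
def Indep (r : Regs m) (A : Op n m) : Prop :=
  ∀ σ σ', (r.get σ ≠ r.get σ' → A σ σ' = 0) ∧
    (r.get σ = r.get σ' → ∀ a, A (r.set σ a) (r.set σ' a) = A σ σ')

end Regs

/-! ## Renaming of individual variables -/

/-- A type-preserving permutation of the individual variables. Arrays are never renamed, but the
index `q` of `𝕏[q]` is. -/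
abbrev Ren := Ty → Equiv.Perm ℕ

/-- The action of a permutation on names. -/
def QName.ren {m : ℕ} (e : Equiv.Perm ℕ) : QName m → QName m
  | .var k => .var (e k)
  | .cell a i => .cell a i

theorem QName.ren_injective {m : ℕ} (e : Equiv.Perm ℕ) :
    Function.Injective (QName.ren (m := m) e) := by
  intro x y h
  cases x <;> cases y <;> simp_all [QName.ren]

/-- The action of a renaming on variables. -/
def QVar.ren {m : ℕ} (π : Ren) (x : QVar m) : QVar m := (x.1, x.2.ren (π x.1))

theorem QVar.ren_injective {m : ℕ} (π : Ren) : Function.Injective (QVar.ren (m := m) π) := by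
  rintro ⟨τ, x⟩ ⟨τ', y⟩ h
  obtain ⟨h1, h2⟩ := Prod.ext_iff.1 h
  obtain rfl : τ = τ' := h1
  exact Prod.ext rfl (QName.ren_injective _ h2)

/-- The configuration in which each `x` holds what the renamed variable holds in `σ`. -/
def Mem.pull {n m : ℕ} (π : Ren) (σ : Mem n m) : Mem n m := fun x => σ (QVar.ren π x)

def Ref.ren {m : ℕ} (π : Ren) (τ : Ty) : Ref m → Ref m
  | .var k => .var (π τ k)
  | .cell a i => .cell a i
  | .elem a j => .elem a (π Ty.cnt j)

def Regs.ren {m : ℕ} (π : Ren) (r : Regs m) : Regs m where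
  ι := r.ι
  τ := r.τ
  ref := fun i => (r.ref i).ren π (r.τ i)

/-! ## Programs -/

/-- Statements. `F` is the set of procedure names and `sig f` lists the types of the formal
parameters of `f`. `init r` is `r := |0⟩`, `unit r U` is `r *= U`, `ifm r M S` is the statement
`if (□ m · M[r] = m → S m)`, and `local r S` is `Local r; S; Release r`. -/
inductive Prog (n m : ℕ) {F : Type} (sig : F → List Ty) : Type 1 where
  | bot
  | skip
  | init (r : Regs m)
  | unit (r : Regs m) (U : Matrix (r.Cfg n) (r.Cfg n) ℂ)
  | seq (S₁ S₂ : Prog n m sig)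
  | ifm (r : Regs m) {κ : Type} [Fintype κ] (M : κ → Matrix (r.Cfg n) (r.Cfg n) ℂ)
      (S : κ → Prog n m sig)
  | locl (r : Regs m) (S : Prog n m sig)
  | call (f : F) (args : Fin (sig f).length → Ref m)

namespace Prog

variable {n m : ℕ} {F : Type} {sig : F → List Ty}

/-- The action of a renaming on statements, bound variables included. -/
def ren (π : Ren) : Prog n m sig → Prog n m sig
  | bot => bot
  | skip => skip
  | init r => init (r.ren π)
  | unit r U => unit (r.ren π) U
  | seq S₁ S₂ => seq (S₁.ren π) (S₂.ren π)
  | @ifm _ _ _ _ r κ inst M S => @ifm _ _ _ _ (r.ren π) κ inst M fun k => (S k).ren π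
  | locl r S => locl (r.ren π) (S.ren π)
  | call f args => call f fun i => (args i).ren π ((sig f).get i)

end Prog

/-- The individual variables occurring in a reference of type `τ`. -/
def Ref.vars {m : ℕ} (τ : Ty) : Ref m → Set (Ty × ℕ)
  | .var k => {(τ, k)}
  | .cell _ _ => ∅
  | .elem _ j => {(Ty.cnt, j)}

def Regs.vars {m : ℕ} (r : Regs m) : Set (Ty × ℕ) := ⋃ i, (r.ref i).vars (r.τ i)

/-- The individual variables that are themselves entries of the tuple (not just indices). -/
def Regs.entries {m : ℕ} (r : Regs m) : Set (Ty × ℕ) :=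
  {x | ∃ i, r.τ i = x.1 ∧ r.ref i = Ref.var x.2}

/-- The individual variables that are indices of array references of the tuple. -/
def Regs.indices {m : ℕ} (r : Regs m) : Set (Ty × ℕ) :=
  {x | ∃ i a j, r.ref i = Ref.elem a j ∧ x = (Ty.cnt, j)}

/-- The individual variables occurring free in a statement. -/
def Prog.fv {n m : ℕ} {F : Type} {sig : F → List Ty} : Prog n m sig → Set (Ty × ℕ)
  | .bot => ∅
  | .skip => ∅
  | .init r => r.vars
  | .unit r _ => r.vars
  | .seq S₁ S₂ => S₁.fv ∪ S₂.fv
  | @Prog.ifm _ _ _ _ r _ _inst _ S => r.vars ∪ ⋃ k, (S k).fv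
  | .locl r S => (S.fv \ r.entries) ∪ r.indices
  | .call f args => ⋃ i, (args i).vars ((sig f).get i)

/-- Declarations of (mutually recursive) parameterized procedures: for each `f` a list of pairwise
distinct formal parameters, which are individual variables, and a body. -/
structure Decl (n m : ℕ) {F : Type} (sig : F → List Ty) : Type 1 where
  formal : (f : F) → Fin (sig f).length → ℕ
  formal_inj : ∀ f, Function.Injective fun i => ((sig f).get i, formal f i)
  body : F → Prog n m sig

/-- The statement `Call f(y)`, with `y` the formal parameters of `f`. -/
def Decl.callFormal {n m : ℕ} {F : Type} {sig : F → List Ty} (D : Decl n m sig) (f : F) :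
    Prog n m sig :=
  .call f fun i => .var (D.formal f i)

/-- The individual variables that occur free in procedure bodies without being formal
parameters. -/
def Decl.globals {n m : ℕ} {F : Type} {sig : F → List Ty} (D : Decl n m sig) : Set (Ty × ℕ) :=
  {x | ∃ f, x ∈ (D.body f).fv ∧ ∀ i, x ≠ ((sig f).get i, D.formal f i)}

/-- The renaming fixes every variable in `V`. -/
def Ren.Fixes (π : Ren) (V : Set (Ty × ℕ)) : Prop := ∀ x ∈ V, π x.1 x.2 = x.2

/-! ## Parameterized quantum predicate terms -/

/-- A completely positive super operator `A ↦ ∑ K A K†`, in Kraus form. -/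
structure Kraus (b : Type) : Type 1 where
  idx : Type
  [fin : Fintype idx]
  op : idx → Matrix b b ℂ

attribute [instance] Kraus.fin

/-- The Schrödinger-Heisenberg dual `A ↦ ∑ K† A K`. -/
noncomputable def Kraus.dual {b : Type} [Fintype b] (E : Kraus b) (A : Matrix b b ℂ) :
    Matrix b b ℂ :=
  ∑ k, (E.op k)ᴴ * A * E.op k

/-- The zero operation. -/
def Kraus.zero (b : Type) : Kraus b where
  idx := Empty
  op := Empty.elim

/-- The operation with a single Kraus operator. -/
def Kraus.single {b : Type} (K : Matrix b b ℂ) : Kraus b where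
  idx := Unit
  op := fun _ => K

theorem Kraus.dual_zero {b : Type} [Fintype b] (A : Matrix b b ℂ) : (Kraus.zero b).dual A = 0 :=
  Finset.sum_of_isEmpty (ι := Empty) _

theorem Kraus.dual_single {b : Type} [Fintype b] (K A : Matrix b b ℂ) :
    (Kraus.single K).dual A = Kᴴ * A * K :=
  Fintype.sum_unique (ι := Unit) fun _ => Kᴴ * A * K

/-- `E` is a quantum operation: it does not increase the trace. -/
def Kraus.IsQOp {b : Type} [Fintype b] [DecidableEq b] (E : Kraus b) : Prop :=
  (1 - E.dual 1).PosSemidef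

/-- The order `E ⊑ F` of quantum operations: `E + G = F` for some completely positive `G`. -/
def Kraus.Le {b : Type} [Fintype b] (E F : Kraus b) : Prop :=
  ∃ G : Kraus b, ∀ A, E.dual A + G.dual A = F.dual A

/-- A quantum predicate variable: a first-order variable that ranges over the quantum predicates
on the variables in `sup`. -/
structure PVar (m : ℕ) where
  name : ℕ
  sup : Finset (QVar m)

def PVar.ren {m : ℕ} (π : Ren) (X : PVar m) : PVar m where
  name := X.name
  sup := X.sup.map ⟨QVar.ren π, QVar.ren_injective π⟩

/-- Assignments of quantum predicates `0 ⊑ M ⊑ I` to the quantum predicate variables. -/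
abbrev Assign (n m : ℕ) :=
  (X : PVar m) → {M : Matrix (Cfg n X.sup) (Cfg n X.sup) ℂ // M.PosSemidef ∧ (1 - M).PosSemidef}

/-- A parameterized quantum predicate term `E*(B) + F*(I)` on the variables in `Γ`, where the base
`B` is the tensor product of the (finitely many) predicate variables in `base`, which live on
disjoint subsets of `Γ`, with the identity on the remaining variables of `Γ`. -/
structure PQPT (n : ℕ) {m : ℕ} (Γ : Finset (QVar m)) : Type 1 where
  base : Finset (PVar m)
  sub : ∀ X ∈ base, X.sup ⊆ Γ
  disj : ∀ X ∈ base, ∀ Y ∈ base, X ≠ Y → Disjoint X.sup Y.sup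
  E : Kraus (Cfg n Γ)
  F : Kraus (Cfg n Γ)
  tni : (1 - (E.dual 1 + F.dual 1)).PosSemidef

open Classical in
/-- The denotation of the base under an assignment. -/
noncomputable def PQPT.baseDen {n m : ℕ} {Γ : Finset (QVar m)} (P : PQPT n Γ) (v : Assign n m) :
    Matrix (Cfg n Γ) (Cfg n Γ) ℂ :=
  Matrix.of fun a b =>
    if ∀ x : Γ, (∀ X ∈ P.base, x.1 ∉ X.sup) → a x = b x then
      ∏ X ∈ P.base.attach, (v X.1).1 (a.restrict (P.sub _ X.2)) (b.restrict (P.sub _ X.2))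
    else 0

/-- The denotation of a term under an assignment, an operator on `H_Γ`. -/
noncomputable def PQPT.den {n m : ℕ} {Γ : Finset (QVar m)} (P : PQPT n Γ) (v : Assign n m) :
    Matrix (Cfg n Γ) (Cfg n Γ) ℂ :=
  P.E.dual (P.baseDen v) + P.F.dual 1

/-- Assertions: terms on some finite set of quantum variables. -/
structure Assn (n m : ℕ) : Type 1 where
  ctx : Finset (QVar m)
  term : PQPT n ctx

/-- The set of parameters of an assertion. -/
def Assn.params {n m : ℕ} (P : Assn n m) : Finset (PVar m) := P.term.base

/-- The denotation of an assertion, extended by the identity to all variables. -/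
noncomputable def Assn.den {n m : ℕ} (P : Assn n m) (v : Assign n m) : Op n m :=
  ext P.ctx (P.term.den v)

/-- The set of true Löwner ordering formulas `P ⊑ Q` (with equal parameter sets). -/
def trueOrder (n m : ℕ) : Set (Assn n m × Assn n m) :=
  {PQ | PQ.1.params = PQ.2.params ∧ ∀ v, (PQ.2.den v - PQ.1.den v).PosSemidef}

/-- `P'` is the result `P[R/X]` of substituting the term `R` for the variable `X` in `P`. -/
def IsSubst {n m : ℕ} (X : PVar m) (R : PQPT n X.sup) (P P' : Assn n m) : Prop :=
  ∀ v v' : Assign n m, (v' X).1 = R.den v → (∀ Y, Y ≠ X → v' Y = v Y) → P'.den v = P.den v'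

/-- `P'` is the result of renaming quantum variables in `P` (also in the index sets of predicate
variables). -/
def IsRenaming {n m : ℕ} (π : Ren) (P P' : Assn n m) : Prop :=
  ∀ v v' : Assign n m,
    (∀ X σ σ', ext (X.ren π).sup (v (X.ren π)).1 σ σ' =
      ext X.sup (v' X).1 (σ.pull π) (σ'.pull π)) →
    ∀ σ σ', P'.den v σ σ' = P.den v' (σ.pull π) (σ'.pull π)

/-- `P 0 ⊑ P 1 ⊑ …` is an increasing sequence of assertions `P j = E_j*(R)`, for a term `R` and
quantum operations `E_0 ⊑ E_1 ⊑ …` with limit `E`, and `L = E*(R)` is its upper limit. -/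
def IsIncreasing {n m : ℕ} (P : ℕ → Assn n m) (L : Assn n m) : Prop :=
  ∃ (Γ : Finset (QVar m)) (R : PQPT n Γ) (E : ℕ → Kraus (Cfg n Γ)) (E' : Kraus (Cfg n Γ)),
    (∀ j, (E j).IsQOp) ∧ E'.IsQOp ∧ (∀ j, (E j).Le (E (j + 1))) ∧
    (∀ A, Filter.Tendsto (fun j => (E j).dual A) Filter.atTop (nhds (E'.dual A))) ∧
    (∀ j, (P j).params = R.base ∧ ∀ v, (P j).den v = ext Γ ((E j).dual (R.den v))) ∧
    (L.params = R.base ∧ ∀ v, L.den v = ext Γ (E'.dual (R.den v)))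

/-! ## The proof systems -/

/-- Total-correctness formulas `⟨P⟩ S ⟨Q⟩`. -/
structure Triple (n m : ℕ) {F : Type} (sig : F → List Ty) : Type 1 where
  pre : Assn n m
  prog : Prog n m sig
  post : Assn n m

/-- A triple is legitimate if its pre- and postcondition have the same parameters. -/
def Triple.Legit {n m : ℕ} {F : Type} {sig : F → List Ty} (t : Triple n m sig) : Prop :=
  t.pre.params = t.post.params

/-- Instances `premises / conclusion` of the axioms and rules of the extended base system qBE for
total correctness, relative to the assertion theory `T` and the declarations `D`. -/
inductive BERule {n m : ℕ} {F : Type} {sig : F → List Ty} (T : Set (Assn n m × Assn n m))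
    (D : Decl n m sig) : Set (Triple n m sig) → Triple n m sig → Prop
  /-- (A Bot) -/
  | bot (P Q : Assn n m) : (∀ v, P.den v = 0) → BERule T D ∅ ⟨P, .bot, Q⟩
  /-- (A Skip) -/
  | skip (P : Assn n m) : BERule T D ∅ ⟨P, .skip, P⟩
  /-- (A Init): the precondition is `∑ |c⟩⟨0| Q |0⟩⟨c|`. -/
  | init (r : Regs m) (P Q : Assn n m) : r.WF n →
      (∀ v, P.den v = ∑ c : r.Cfg n, r.conj (Matrix.single 0 c 1) (Q.den v)) →
      BERule T D ∅ ⟨P, .init r, Q⟩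
  /-- (A Unit): the precondition is `U† Q U`. -/
  | unit (r : Regs m) (U : Matrix (r.Cfg n) (r.Cfg n) ℂ) (P Q : Assn n m) : r.WF n →
      U * Uᴴ = 1 → Uᴴ * U = 1 → (∀ v, P.den v = r.conj U (Q.den v)) →
      BERule T D ∅ ⟨P, .unit r U, Q⟩
  /-- (R Comp) -/
  | comp (P Q R : Assn n m) (S₁ S₂ : Prog n m sig) :
      BERule T D {⟨P, S₁, Q⟩, ⟨Q, S₂, R⟩} ⟨P, .seq S₁ S₂, R⟩
  /-- (R Case): the precondition is `∑ M_k† P_k M_k`. -/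
  | case (r : Regs m) {κ : Type} [Fintype κ] (M : κ → Matrix (r.Cfg n) (r.Cfg n) ℂ)
      (S : κ → Prog n m sig) (P : κ → Assn n m) (P' Q : Assn n m) : r.WF n →
      (∑ k, (M k)ᴴ * M k = 1) → (∀ v, P'.den v = ∑ k, r.conj (M k) ((P k).den v)) →
      BERule T D (Set.range fun k => ⟨P k, S k, Q⟩) ⟨P', .ifm r M S, Q⟩
  /-- (R Order) -/
  | order (P P' Q' Q : Assn n m) (S : Prog n m sig) : (P, P') ∈ T → (Q', Q) ∈ T →
      BERule T D {⟨P', S, Q'⟩} ⟨P, S, Q⟩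
  /-- (R Subst) -/
  | subst (X : PVar m) (R : PQPT n X.sup) (P Q P' Q' : Assn n m) (S : Prog n m sig) :
      IsSubst X R P P' → IsSubst X R Q Q' → BERule T D {⟨P, S, Q⟩} ⟨P', S, Q'⟩
  /-- (R Loc): the individual variables among `r` are renamed to fresh ones by `π`, an array
  component `𝕏[q]` is its own fresh instance. The new registers occur neither in the
  assertions `P`, `Q` nor otherwise in the program. -/
  | locl (π : Ren) (r : Regs m) (S : Prog n m sig) (P Q : Assn n m) :
      π.Fixes ((Prog.locl r S).fv ∪ D.globals) → (r.ren π).WF n →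
      (∀ v, (r.ren π).Indep (P.den v)) → (∀ v, (r.ren π).Indep (Q.den v)) →
      BERule T D {⟨P, .seq (.init (r.ren π)) (S.ren π), Q⟩} ⟨P, .locl r S, Q⟩
  /-- (R Adap): simultaneous renaming of pairwise distinct variables in program and assertions.
  Variables that procedure bodies access without parameter passing are not renamed. -/
  | adap (π : Ren) (P Q P' Q' : Assn n m) (S : Prog n m sig) : π.Fixes D.globals →
      IsRenaming π P P' → IsRenaming π Q Q' → BERule T D {⟨P, S, Q⟩} ⟨P', S.ren π, Q'⟩

/-- `T, A ⊢_qBE t`: derivability in the extended base system from the hypotheses `A`. -/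
inductive QBE {n m : ℕ} {F : Type} {sig : F → List Ty} (T : Set (Assn n m × Assn n m))
    (D : Decl n m sig) (A : Set (Triple n m sig)) : Triple n m sig → Prop
  | hyp {t : Triple n m sig} : t ∈ A → QBE T D A t
  | rule {B : Set (Triple n m sig)} {t : Triple n m sig} : BERule T D B t → t.Legit →
      (∀ s ∈ B, QBE T D A s) → QBE T D A t

/-- `T ⊢_qTP t`: derivability in qTP, the extension of qBE by the rule (Rt pRec) for total
correctness of parameterized recursive procedures. -/
inductive QTP {n m : ℕ} {F : Type} {sig : F → List Ty} (T : Set (Assn n m × Assn n m))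
    (D : Decl n m sig) : Triple n m sig → Prop
  | rule {B : Set (Triple n m sig)} {t : Triple n m sig} : BERule T D B t → t.Legit →
      (∀ s ∈ B, QTP T D s) → QTP T D t
  /-- (Rt pRec), with `L f` the upper limit of the increasing sequence `P f 0, P f 1, …`. -/
  | pRec (P : F → ℕ → Assn n m) (L P' Q : F → Assn n m) :
      (∀ f, IsIncreasing (P f) (L f)) → (∀ f v, (P f 0).den v = 0) →
      (∀ f j, (P f j).params = (Q f).params) → (∀ f, (P' f).params = (Q f).params) →
      (∀ j f, QBE T D (Set.range fun f' => ⟨P f' j, D.callFormal f', Q f'⟩)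
        ⟨P f (j + 1), D.body f, Q f⟩) →
      (∀ f, (P' f, L f) ∈ T) → ∀ f, QTP T D ⟨P' f, D.callFormal f, Q f⟩

/-! ## Recursive quantum Fourier sampling -/

/-- The tensor product of an operator on `r` and an operator on `s`. -/
def tens {n m : ℕ} {r s : Regs m} (A : Matrix (r.Cfg n) (r.Cfg n) ℂ)
    (B : Matrix (s.Cfg n) (s.Cfg n) ℂ) : Matrix ((r.app s).Cfg n) ((r.app s).Cfg n) ℂ :=
  Matrix.of fun a b =>
    A (fun i => a (Sum.inl i)) (fun i => b (Sum.inl i)) *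
      B (fun i => a (Sum.inr i)) (fun i => b (Sum.inr i))

/-- An operator on the space of type `τ`, as operator on the tuple `(v)`. -/
def on {n m : ℕ} (τ : Ty) (v : Ref m) (A : Matrix (Basis n m τ) (Basis n m τ) ℂ) :
    Matrix ((Regs.one τ v).Cfg n) ((Regs.one τ v).Cfg n) ℂ :=
  Matrix.of fun a b => A (a ()) (b ())

/-- The Hadamard operator `H`. -/
noncomputable def hadamard : Matrix (ZMod 2) (ZMod 2) ℂ :=
  Matrix.of fun a b => (1 / (Real.sqrt 2 : ℂ)) * if a = 1 ∧ b = 1 then -1 else 1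

/-- The Pauli operator `X`. -/
def pauliX : Matrix (ZMod 2) (ZMod 2) ℂ := Matrix.of fun a b => if a = b + 1 then 1 else 0

/-- The operator `H^{⊗n}`. -/
noncomputable def hadamardPow (n : ℕ) : Matrix (Fin n → ZMod 2) (Fin n → ZMod 2) ℂ :=
  Matrix.of fun x y => ∏ i, hadamard (x i) (y i)

/-- The operator `U_{+1} |x⟩ = |x + 1 mod 2^m⟩`. -/
def incr (m : ℕ) : Matrix (Fin (2 ^ m)) (Fin (2 ^ m)) ℂ :=
  Matrix.of fun a b => if a = b + 1 then 1 else 0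

/-- The operator `U_{-1} |x⟩ = |x - 1 mod 2^m⟩`. -/
def decr (m : ℕ) : Matrix (Fin (2 ^ m)) (Fin (2 ^ m)) ℂ :=
  Matrix.of fun a b => if a = b - 1 then 1 else 0

/-- The oracle `|u⟩|y⟩ ↦ |u⟩|y ⊕ h(u)⟩` on the concatenation of a tuple `r` and one qubit. -/
def oracle {n m : ℕ} (r : Regs m) (v : Ref m) (h : r.Cfg n → ZMod 2) :
    Matrix ((r.app (Regs.one Ty.bit v)).Cfg n) ((r.app (Regs.one Ty.bit v)).Cfg n) ℂ :=
  Matrix.of fun a b =>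
    if (∀ i, a (Sum.inl i) = b (Sum.inl i)) ∧
        (show ZMod 2 from a (Sum.inr ())) =
          (show ZMod 2 from b (Sum.inr ())) + h (fun i => b (Sum.inl i))
    then 1 else 0

/-- The counter variables `p`, `q`. -/
def p (m : ℕ) : Ref m := .var 0
def q (m : ℕ) : Ref m := .var 1

/-- The qubit variables `Y`, `Y'`, `Z`. -/
def Y (m : ℕ) : Ref m := .var 0
def Y' (m : ℕ) : Ref m := .var 1
def Z (m : ℕ) : Ref m := .var 2

/-- The array component `𝕏[q]`. -/
def Xq (m : ℕ) : Ref m := .elem 0 1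

/-- The array components `𝕏[1], …, 𝕏[l]`. -/
def Xs (m l : ℕ) : Regs m where
  ι := Fin l
  τ := fun _ => Ty.vec
  ref := fun j => .cell 0 (Fin.ofNat (2 ^ m) (j.val + 1))

/-- There is one procedure, `RQFS`, with a counter and a qubit as parameters. -/
def sig : Unit → List Ty := fun _ => [Ty.cnt, Ty.bit]

/-- The statement `Call RQFS(a, b)`. -/
def callRQFS {n m : ℕ} (a b : Ref m) : Prog n m sig := .call () (![a, b] : Fin 2 → Ref m)

/-- The measurement `M` of the counter: is it less than, equal to, or greater than `l`? -/
def meas (m l : ℕ) (k : Fin 3) : Matrix (Fin (2 ^ m)) (Fin (2 ^ m)) ℂ :=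
  Matrix.diagonal fun i =>
    if (![decide (i.val < l), decide (i.val = l), decide (l < i.val)] : Fin 3 → Bool) k then 1
    else 0

/-- The branch for outcome `0`. -/
noncomputable def branch0 {n m : ℕ} (g : (Fin n → ZMod 2) → ZMod 2) : Prog n m sig :=
  let XY' := (Regs.one Ty.vec (Xq m)).app (Regs.one Ty.bit (Y' m))
  .seq (.unit (Regs.one Ty.cnt (q m)) (on Ty.cnt (q m) (incr m))) <|
  .seq (.locl XY' <|
    .seq (.unit XY' (tens (on Ty.vec (Xq m) (hadamardPow n))
      (on Ty.bit (Y' m) (hadamard * pauliX)))) <|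
    .seq (callRQFS (q m) (Y' m)) <|
    .seq (.unit (Regs.one Ty.vec (Xq m)) (on Ty.vec (Xq m) (hadamardPow n))) <|
    .seq (.unit ((Regs.one Ty.vec (Xq m)).app (Regs.one Ty.bit (Y m)))
      (oracle (Regs.one Ty.vec (Xq m)) (Y m) fun u => g (u ()))) <|
    .seq (.unit (Regs.one Ty.vec (Xq m)) (on Ty.vec (Xq m) (hadamardPow n))) <|
    .seq (callRQFS (q m) (Y' m)) <|
    .unit XY' (tens (on Ty.vec (Xq m) (hadamardPow n))
      (on Ty.bit (Y' m) (pauliX * hadamard)))) <|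
  .unit (Regs.one Ty.cnt (q m)) (on Ty.cnt (q m) (decr m))

/-- The branch for outcome `1`: the oracle `𝒪` on `(𝕏[1], …, 𝕏[l], Y)`, which computes the bit
`g(s_(x_1,…,x_l))`. -/
def branch1 {n m : ℕ} (l : ℕ) (g : (Fin n → ZMod 2) → ZMod 2)
    (s : List (Fin n → ZMod 2) → (Fin n → ZMod 2)) : Prog n m sig :=
  .unit ((Xs m l).app (Regs.one Ty.bit (Y m)))
    (oracle (Xs m l) (Y m) fun x => g (s (List.ofFn (n := l) fun j => x j)))

/-- The declaration of `RQFS(q, Y)`. -/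
noncomputable def rqfs {n m : ℕ} (l : ℕ) (g : (Fin n → ZMod 2) → ZMod 2)
    (s : List (Fin n → ZMod 2) → (Fin n → ZMod 2)) : Decl n m sig where
  formal := fun _ => (![1, 0] : Fin 2 → ℕ)
  formal_inj := fun _ => by
    change Function.Injective fun i : Fin 2 =>
      (([Ty.cnt, Ty.bit] : List Ty).get i, (![1, 0] : Fin 2 → ℕ) i)
    decide
  body := fun _ => .ifm (Regs.one Ty.cnt (q m)) (fun k : Fin 3 => on Ty.cnt (q m) (meas m l k))
    ![branch0 g, branch1 l g s, .bot]

/-- The main program: `(p, Z) := |0⟩; Call RQFS(p, Z); if (□ m · M'[Z] = m → skip)`, with `M'` the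
measurement of `Z` in the computational basis. -/
def mainProg (n m : ℕ) : Prog n m sig :=
  .seq (.init ((Regs.one Ty.cnt (p m)).app (Regs.one Ty.bit (Z m)))) <|
  .seq (callRQFS (p m) (Z m)) <|
  .ifm (Regs.one Ty.bit (Z m))
    (fun b : ZMod 2 => on Ty.bit (Z m) (Matrix.single b b 1)) fun _ => .skip

/-- The variables `p`, `Z` of the starting state space. -/
def pZ (m : ℕ) : Finset (QVar m) := {(Ty.cnt, .var 0), (Ty.bit, .var 2)}

/-- The assertion `I` on `H_Γ`. -/
def Assn.top (n : ℕ) {m : ℕ} (Γ : Finset (QVar m)) : Assn n m where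
  ctx := Γ
  term :=
    { base := ∅
      sub := by simp
      disj := by simp
      E := Kraus.zero _
      F := Kraus.single 1
      tni := by
        rw [Kraus.dual_zero, Kraus.dual_single]
        simpa using Matrix.PosSemidef.zero (n := Cfg n Γ) (R := ℂ) }

/-- The assertion `|a⟩⟨a|` on `H_Γ`, for a basis configuration `a` of `Γ`. -/
def Assn.ketbra {n m : ℕ} (Γ : Finset (QVar m)) (a : Cfg n Γ) : Assn n m where
  ctx := Γ
  term :=
    { base := ∅
      sub := by simp
      disj := by simp
      E := Kraus.zero _
      F := Kraus.single (Matrix.single a a 1)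
      tni := by
        have h : (1 - ((Kraus.zero (Cfg n Γ)).dual 1 +
            (Kraus.single (Matrix.single a a (1 : ℂ))).dual 1)) =
            Matrix.diagonal fun b => if b = a then 0 else 1 := by
          rw [Kraus.dual_zero, Kraus.dual_single, mul_one, Matrix.conjTranspose_single,
            Matrix.single_mul_single_same]
          ext b c
          by_cases hbc : b = c <;> by_cases hba : a = b <;>
            simp_all [eq_comm]
        rw [h]
        refine Matrix.PosSemidef.diagonal fun b => ?_
        by_cases hb : b = a <;> simp [hb] }

/-- The basis configuration of `Γ` with `|0⟩` in counters and `n`-qubit registers and `|y⟩` in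
qubits; on `p`, `Z` this is `|0⟩_p ⊗ |y⟩_Z`. -/
def outCfg (n : ℕ) {m : ℕ} (Γ : Finset (QVar m)) (y : ZMod 2) : Cfg n Γ := fun x =>
  match x.1.1 with
  | .bit => y
  | .cnt => (0 : Fin (2 ^ m))
  | .vec => (0 : Fin n → ZMod 2)

end RQFS

namespace RQFS

section PositiveSemidefinite

open Classical in
theorem posSemidef_block {α β : Type*} (o : α → β) {A : Matrix α α ℂ} (hA : A.PosSemidef) :
    (Matrix.of fun i j => if o i = o j then A i j else 0).PosSemidef := by
  refine ⟨?_, fun x => ?_⟩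
  · ext i j
    have := congrFun (congrFun hA.1 i) j
    simp only [Matrix.conjTranspose_apply] at this
    by_cases h : o i = o j
    · simp [h, this]
    · simp [h, Ne.symm h]
  · simp only [Finsupp.sum, Matrix.of_apply]
    rw [← Finset.sum_fiberwise_of_maps_to
      (g := o) (t := x.support.image o) (fun i hi => Finset.mem_image_of_mem o hi)]
    refine Finset.sum_nonneg fun c _ => ?_
    have h := hA.2 (x.filter fun i => o i = c)
    simp only [Finsupp.sum, Finsupp.support_filter] at h
    refine h.trans_eq (Finset.sum_congr rfl fun i hi => ?_)
    have hi' := (Finset.mem_filter.1 hi).2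
    rw [Finset.sum_filter]
    refine Finset.sum_congr rfl fun j _ => ?_
    subst hi'
    by_cases hj : o j = o i
    · simp [hj]
    · simp [hj, Ne.symm hj]

theorem Kraus.dual_posSemidef {b : Type} [Fintype b] (E : Kraus b) {A : Matrix b b ℂ}
    (hA : A.PosSemidef) : (E.dual A).PosSemidef :=
  Matrix.posSemidef_sum _ fun _ _ => hA.conjTranspose_mul_mul_same _

theorem Kraus.dual_sub {b : Type} [Fintype b] (E : Kraus b) (A B : Matrix b b ℂ) :
    E.dual (A - B) = E.dual A - E.dual B := by
  simp [Kraus.dual, Matrix.mul_sub, Matrix.sub_mul]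

end PositiveSemidefinite

/-! ## Operations on Kraus families -/

section KrausOperations

variable {b c : Type} [Fintype b] [Fintype c]

def Kraus.comp (E F : Kraus b) : Kraus b where
  idx := E.idx × F.idx
  op := fun i => E.op i.1 * F.op i.2

theorem Kraus.dual_comp (E F : Kraus b) (A : Matrix b b ℂ) :
    (E.comp F).dual A = F.dual (E.dual A) := by
  unfold Kraus.dual Kraus.comp
  rw [Fintype.sum_prod_type, Finset.sum_comm]
  simp [Matrix.conjTranspose_mul, Matrix.mul_assoc, Finset.mul_sum, Finset.sum_mul]

theorem Kraus.IsQOp.comp [DecidableEq b] {E F : Kraus b} (hE : E.IsQOp) (hF : F.IsQOp) :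
    (E.comp F).IsQOp := by
  have h := (F.dual_posSemidef hE).add hF
  rw [Kraus.dual_sub] at h
  unfold Kraus.IsQOp
  rw [Kraus.dual_comp]
  convert h using 1
  abel

theorem Kraus.isQOp_of_dual_one [DecidableEq b] {E : Kraus b} (h : E.dual 1 = 1) : E.IsQOp := by
  unfold Kraus.IsQOp
  rw [h, sub_self]
  exact .zero

def Kraus.reindex (e : b ≃ c) (E : Kraus c) : Kraus b where
  idx := E.idx
  op := fun i => (E.op i).submatrix e e

theorem Kraus.dual_reindex (e : b ≃ c) (E : Kraus c) (A : Matrix c c ℂ) :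
    (E.reindex e).dual (A.submatrix e e) = (E.dual A).submatrix e e := by
  unfold Kraus.dual Kraus.reindex
  ext i j
  simp only [Matrix.conjTranspose_submatrix, Matrix.submatrix_mul_equiv, Matrix.sum_apply,
    Matrix.submatrix_apply]

theorem Kraus.IsQOp.reindex [DecidableEq b] [DecidableEq c] (e : b ≃ c) {E : Kraus c}
    (hE : E.IsQOp) : (E.reindex e).IsQOp := by
  unfold Kraus.IsQOp
  have h1 : (1 : Matrix b b ℂ) = (1 : Matrix c c ℂ).submatrix e e := by simp
  rw [h1, Kraus.dual_reindex]
  exact hE.submatrix e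

open Classical in
/-- The operation that sends a basis state `σ` with `T σ` to `f σ` and leaves the record `r σ` in
the environment. -/
noncomputable def Kraus.basisMap {Ω : Type} [Fintype Ω] (T : b → Prop) (f : b → b) (r : b → Ω) :
    Kraus b where
  idx := Ω
  op := fun c => Matrix.of fun ρ σ => if T σ ∧ r σ = c ∧ ρ = f σ then 1 else 0

open Classical in
theorem Kraus.dual_basisMap {Ω : Type} [Fintype Ω] (T : b → Prop) (f : b → b) (r : b → Ω)
    (A : Matrix b b ℂ) (σ σ' : b) : (Kraus.basisMap T f r).dual A σ σ' =
      if T σ ∧ T σ' ∧ r σ = r σ' then A (f σ) (f σ') else 0 := by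
  unfold Kraus.dual
  refine (Matrix.sum_apply _ _ _ _).trans ?_
  have h : ∀ k : Ω, (((Kraus.basisMap T f r).op k)ᴴ * A * (Kraus.basisMap T f r).op k) σ σ' =
      if T σ ∧ r σ = k then (if T σ' ∧ r σ' = k then A (f σ) (f σ') else 0) else 0 := by
    intro k
    simp only [Kraus.basisMap, Matrix.mul_apply, Matrix.conjTranspose_apply, Matrix.of_apply,
      Finset.sum_mul]
    by_cases h1 : T σ ∧ r σ = k
    · by_cases h2 : T σ' ∧ r σ' = k
      · simp [h1.1, h1.2, h2.1, h2.2]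
      · simp only [← and_assoc, h2, false_and, if_false, mul_zero, Finset.sum_const_zero, ite_self]
    · simp only [← and_assoc, h1, false_and, if_false, star_zero, zero_mul, Finset.sum_const_zero]
  refine (Finset.sum_congr rfl fun k _ => h k).trans ?_
  change (∑ k : Ω, if T σ ∧ r σ = k then (if T σ' ∧ r σ' = k then A (f σ) (f σ') else 0) else 0) = _
  by_cases h1 : T σ
  · by_cases h2 : T σ'
    · simp [h1, h2, eq_comm]
    · simp [h2]
  · simp [h1]

theorem Kraus.dual_basisMap_of {Ω : Type} [Fintype Ω] {T : b → Prop} {f : b → b} {r : b → Ω}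
    (A : Matrix b b ℂ) {σ σ' : b} (h : T σ) (h' : T σ') (hr : r σ = r σ') :
    (Kraus.basisMap T f r).dual A σ σ' = A (f σ) (f σ') := by
  rw [Kraus.dual_basisMap, if_pos ⟨h, h', hr⟩]

theorem Kraus.dual_basisMap_of_not {Ω : Type} [Fintype Ω] {T : b → Prop} {f : b → b} {r : b → Ω}
    (A : Matrix b b ℂ) {σ σ' : b} (h : ¬(T σ ∧ T σ' ∧ r σ = r σ')) :
    (Kraus.basisMap T f r).dual A σ σ' = 0 := by
  rw [Kraus.dual_basisMap, if_neg h]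

open Classical in
theorem Kraus.isQOp_basisMap [DecidableEq b] {Ω : Type} [Fintype Ω] (T : b → Prop) (f : b → b)
    (r : b → Ω) (h : ∀ σ σ', T σ → T σ' → r σ = r σ' → f σ = f σ' → σ = σ') :
    (Kraus.basisMap T f r).IsQOp := by
  unfold Kraus.IsQOp
  have : (1 - (Kraus.basisMap T f r).dual 1) =
      Matrix.diagonal fun σ => if T σ then (0 : ℂ) else 1 := by
    ext σ σ'
    rw [Matrix.sub_apply, Kraus.dual_basisMap]
    by_cases hσ : σ = σ'
    · subst hσ
      by_cases h1 : T σ <;> simp [h1]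
    · rw [Matrix.one_apply_ne hσ, Matrix.diagonal_apply_ne _ hσ]
      by_cases h1 : T σ ∧ T σ' ∧ r σ = r σ'
      · rw [if_pos h1, Matrix.one_apply_ne, sub_self]
        exact fun h2 => hσ (h _ _ h1.1 h1.2.1 h1.2.2 h2)
      · simp [h1]
  rw [this]
  refine Matrix.PosSemidef.diagonal fun σ => ?_
  by_cases h1 : T σ <;> simp [h1]

end KrausOperations

/-! ## The state space of the program -/

/-- Basis configurations of the variables `p`, `q`, the array `𝕏` and `l + 2` qubits. -/
@[ext] structure St (n l m : ℕ) where
  p : Fin (2 ^ m)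
  q : Fin (2 ^ m)
  X : Fin (2 ^ m) → (Fin n → ZMod 2)
  b : Fin (l + 2) → ZMod 2

section State

variable {n l m : ℕ}

def St.equivProd : St n l m ≃
    (Fin (2 ^ m) × Fin (2 ^ m)) × (Fin (2 ^ m) → (Fin n → ZMod 2)) × (Fin (l + 2) → ZMod 2) where
  toFun s := ((s.p, s.q), s.X, s.b)
  invFun t := ⟨t.1.1, t.1.2, t.2.1, t.2.2⟩

instance : Fintype (St n l m) := Fintype.ofEquiv _ St.equivProd.symm

instance : DecidableEq (St n l m) := St.equivProd.decidableEq

/-- The variables of which `St` lists the contents. -/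
def vars (l m : ℕ) : Finset (QVar m) :=
  {(Ty.cnt, .var 0), (Ty.cnt, .var 1)} ∪
    (Finset.univ.image fun i : Fin (2 ^ m) => (Ty.vec, .cell 0 i)) ∪
    (Finset.univ.image fun j : Fin (l + 2) => (Ty.bit, .var j.val))

theorem mem_vars {x : QVar m} : x ∈ vars l m ↔ x = (Ty.cnt, .var 0) ∨ x = (Ty.cnt, .var 1) ∨
    (∃ i, x = (Ty.vec, .cell 0 i)) ∨ ∃ j : Fin (l + 2), x = (Ty.bit, .var j.val) := by
  simp [vars, eq_comm]

/-- The contents of the variables in `vars`. -/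
def St.read (l : ℕ) (σ : Mem n m) : St n l m where
  p := σ (Ty.cnt, .var 0)
  q := σ (Ty.cnt, .var 1)
  X := fun i => σ (Ty.vec, .cell 0 i)
  b := fun j => σ (Ty.bit, .var j.val)

/-- A configuration with given contents of the variables in `vars`. -/
def St.write (s : St n l m) : Mem n m
  | (.cnt, .var k) => if k = 0 then s.p else s.q
  | (.cnt, .cell _ i) => i
  | (.vec, .var _) => fun _ => 0
  | (.vec, .cell _ i) => s.X i
  | (.bit, .var k) => if h : k < l + 2 then s.b ⟨k, h⟩ else (0 : ZMod 2)
  | (.bit, .cell _ _) => (0 : ZMod 2)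

theorem St.read_write (s : St n l m) : St.read l s.write = s := by
  ext : 1
  · rfl
  · rfl
  · rfl
  · funext j
    simp [St.read, St.write]

theorem St.read_eq_iff (σ σ' : Mem n m) :
    St.read l σ = St.read l σ' ↔ ∀ x ∈ vars l m, σ x = σ' x := by
  constructor
  · intro h x hx
    rcases mem_vars.1 hx with rfl | rfl | ⟨i, rfl⟩ | ⟨j, rfl⟩
    · exact congrArg St.p h
    · exact congrArg St.q h
    · exact congrFun (congrArg St.X h) i
    · exact congrFun (congrArg St.b h) j
  · intro h
    ext : 1
    · exact h _ (mem_vars.2 (.inl rfl))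
    · exact h _ (mem_vars.2 (.inr (.inl rfl)))
    · exact funext fun i => h _ (mem_vars.2 (.inr (.inr (.inl ⟨i, rfl⟩))))
    · exact funext fun j => h _ (mem_vars.2 (.inr (.inr (.inr ⟨j, rfl⟩))))

open Classical in
/-- Extension of a configuration of a finite set of variables by zero. -/
noncomputable def Cfg.extend {Γ : Finset (QVar m)} (a : Cfg n Γ) : Mem n m :=
  fun x => if h : x ∈ Γ then a ⟨x, h⟩ else 0

theorem Cfg.extend_apply {Γ : Finset (QVar m)} (a : Cfg n Γ) {x : QVar m} (h : x ∈ Γ) :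
    a.extend x = a ⟨x, h⟩ := dif_pos h

/-- Configurations of `vars` are the same as elements of `St`. -/
noncomputable def St.equivCfg (n l m : ℕ) : Cfg n (vars l m) ≃ St n l m where
  toFun a := St.read l a.extend
  invFun s := s.write.restrict _
  left_inv a := by
    funext x
    have h := (St.read_eq_iff _ _).1 (St.read_write (St.read l a.extend)) x.1 x.2
    exact h.trans (Cfg.extend_apply a x.2)
  right_inv s := by
    rw [← St.read_write s, St.read_eq_iff, St.read_write]
    intro x hx
    exact Cfg.extend_apply _ hx

theorem St.equivCfg_restrict (σ : Mem n m) :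
    St.equivCfg n l m (σ.restrict _) = St.read l σ := by
  refine (St.read_eq_iff _ _).2 fun x hx => Cfg.extend_apply _ hx

open Classical in
/-- The operator `A ⊗ I`, where `A` acts on `St`. -/
noncomputable def extSt (A : Matrix (St n l m) (St n l m) ℂ) : Op n m :=
  Matrix.of fun σ σ' =>
    if ∀ x, x ∉ vars l m → σ x = σ' x then A (St.read l σ) (St.read l σ') else 0

theorem extSt_of_agree (A : Matrix (St n l m) (St n l m) ℂ) {σ σ' : Mem n m}
    (h : ∀ x, x ∉ vars l m → σ x = σ' x) : extSt A σ σ' = A (St.read l σ) (St.read l σ') :=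
  if_pos h

theorem extSt_of_not_agree (A : Matrix (St n l m) (St n l m) ℂ) {σ σ' : Mem n m}
    (h : ¬∀ x, x ∉ vars l m → σ x = σ' x) : extSt A σ σ' = 0 :=
  if_neg h

theorem ext_vars (A : Matrix (St n l m) (St n l m) ℂ) :
    ext (vars l m) (A.submatrix (St.equivCfg n l m) (St.equivCfg n l m)) = extSt A := by
  ext σ σ'
  simp [ext, extSt, St.equivCfg_restrict]

theorem extSt_posSemidef {A : Matrix (St n l m) (St n l m) ℂ} (hA : A.PosSemidef) :
    (extSt A).PosSemidef := by
  have h := posSemidef_block (fun (σ : Mem n m) (x : {x // x ∉ vars l m}) => σ x.1)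
    (hA.submatrix (St.read l))
  convert h using 1
  ext σ σ'
  have h1 : (∀ x, x ∉ vars l m → σ x = σ' x) ↔
      (fun x : {x // x ∉ vars l m} => σ x.1) = fun x : {x // x ∉ vars l m} => σ' x.1 :=
    ⟨fun h => funext fun x => h x.1 x.2, fun h x hx => congrFun h (⟨x, hx⟩ : {x // x ∉ vars l m})⟩
  simp only [extSt, Matrix.of_apply, Matrix.submatrix_apply]
  by_cases h2 : ∀ x, x ∉ vars l m → σ x = σ' x
  · rw [if_pos h2, if_pos (h1.1 h2)]
  · rw [if_neg h2, if_neg (mt h1.2 h2)]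

theorem extSt_sub (A B : Matrix (St n l m) (St n l m) ℂ) :
    extSt (A - B) = extSt A - extSt B := by
  ext σ σ'
  simp only [extSt, Matrix.of_apply, Matrix.sub_apply]
  split_ifs <;> simp

theorem extSt_zero : extSt (0 : Matrix (St n l m) (St n l m) ℂ) = 0 := by
  ext σ σ'
  simp [extSt]

theorem extSt_add (A B : Matrix (St n l m) (St n l m) ℂ) :
    extSt (A + B) = extSt A + extSt B := by
  ext σ σ'
  simp only [extSt, Matrix.of_apply, Matrix.add_apply]
  split_ifs <;> simp

theorem extSt_sum {κ : Type*} (t : Finset κ) (A : κ → Matrix (St n l m) (St n l m) ℂ) :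
    extSt (∑ k ∈ t, A k) = ∑ k ∈ t, extSt (A k) := by
  classical
  induction t using Finset.induction_on with
  | empty => simp [extSt_zero]
  | insert a t ha ih => rw [Finset.sum_insert ha, Finset.sum_insert ha, extSt_add, ih]

open Classical in
theorem extSt_one : extSt (1 : Matrix (St n l m) (St n l m) ℂ) = 1 := by
  ext σ σ'
  rw [Matrix.one_apply]
  simp only [extSt, Matrix.of_apply, Matrix.one_apply]
  by_cases h : σ = σ'
  · simp [h]
  · rw [if_neg h]
    split_ifs with h1 h2
    · exact absurd (funext fun x => by
        by_cases hx : x ∈ vars l m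
        · exact (St.read_eq_iff _ _).1 h2 x hx
        · exact h1 x hx) h
    · rfl
    · rfl

/-- Two states can be extended by the same contents of the other variables. -/
theorem St.exists_read_eq (s s' : St n l m) : ∃ σ σ' : Mem n m,
    St.read l σ = s ∧ St.read l σ' = s' ∧ ∀ x, x ∉ vars l m → σ x = σ' x := by
  classical
  refine ⟨s.write, fun x => if x ∈ vars l m then s'.write x else s.write x, s.read_write, ?_, ?_⟩
  · rw [← St.read_write s', St.read_eq_iff, St.read_write]
    intro x hx
    simp [hx]
  · intro x hx
    simp [hx]

theorem submatrix_equiv_symm {α β : Type*} (e : α ≃ β) (A : Matrix β β ℂ) :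
    (A.submatrix e e).submatrix e.symm e.symm = A := by
  ext
  simp

theorem submatrix_symm_equiv {α β : Type*} (e : α ≃ β) (A : Matrix α α ℂ) :
    (A.submatrix e.symm e.symm).submatrix e e = A := by
  ext
  simp

end State

/-! ## Access to registers -/

section Access

variable {n l m : ℕ}

/-- Reading and writing a tuple of registers on the level of `St`. -/
structure Lens (n l m : ℕ) (r : Regs m) where
  get : St n l m → r.Cfg n
  set : St n l m → r.Cfg n → St n l m
  get_set : ∀ s a, get (set s a) = a
  set_get : ∀ s, set s (get s) = s
  set_set : ∀ s a a', set (set s a) a' = set s a'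
  wf : r.WF n
  get_read : ∀ σ : Mem n m, r.get σ = get (St.read l σ)
  read_set : ∀ (σ : Mem n m) (a), St.read l (r.set σ a) = set (St.read l σ) a
  set_outside : ∀ (σ : Mem n m) (a) (x), x ∉ vars l m → r.set σ a x = σ x

namespace Lens

variable {r : Regs m} (L : Lens n l m r)

/-- The extension of an operator on a tuple of registers to `St`. -/
def lift (A : Matrix (r.Cfg n) (r.Cfg n) ℂ) : Matrix (St n l m) (St n l m) ℂ :=
  Matrix.of fun ρ s => ∑ a, if ρ = L.set s a then A a (L.get s) else 0

theorem lift_mulVec_single (A : Matrix (r.Cfg n) (r.Cfg n) ℂ) (s : St n l m) :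
    L.lift A *ᵥ Pi.single s 1 = ∑ a, A a (L.get s) • Pi.single (L.set s a) 1 := by
  ext ρ
  simp [lift, Pi.single_apply, Finset.sum_apply]

theorem set_eq_set_iff (s s' : St n l m) (a a' : r.Cfg n) :
    L.set s a = L.set s' a' ↔ a = a' ∧ L.set s a = L.set s' a := by
  constructor
  · intro h
    have h1 : a = a' := by rw [← L.get_set s a, h, L.get_set]
    subst h1
    exact ⟨rfl, h⟩
  · rintro ⟨rfl, h⟩
    exact h

theorem set_congr {s s' : St n l m} {a : r.Cfg n} (h : L.set s a = L.set s' a) (b : r.Cfg n) :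
    L.set s b = L.set s' b := by
  rw [← L.set_set s a, h, L.set_set]

theorem sum_mul_lift (A : Matrix (r.Cfg n) (r.Cfg n) ℂ) (F : St n l m → ℂ) (s : St n l m) :
    ∑ ρ, F ρ * L.lift A ρ s = ∑ a, F (L.set s a) * A a (L.get s) := by
  simp only [lift, Matrix.of_apply, Finset.mul_sum]
  rw [Finset.sum_comm]
  simp

theorem conjTranspose_lift_mul_mul (A : Matrix (r.Cfg n) (r.Cfg n) ℂ)
    (B : Matrix (St n l m) (St n l m) ℂ) (s s' : St n l m) :
    ((L.lift A)ᴴ * B * L.lift A) s s' = ∑ a, ∑ b,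
      star (A a (L.get s)) * B (L.set s a) (L.set s' b) * A b (L.get s') := by
  have h (s : St n l m) (F : St n l m → ℂ) : ∑ ρ, star (L.lift A ρ s) * F ρ =
      ∑ a, star (A a (L.get s)) * F (L.set s a) := by
    have := congrArg star (L.sum_mul_lift A (fun ρ => star (F ρ)) s)
    simpa only [star_sum, star_mul', star_star, mul_comm] using this
  rw [Matrix.mul_apply, L.sum_mul_lift, Finset.sum_comm]
  refine Finset.sum_congr rfl fun b _ => ?_
  simp only [Matrix.mul_apply, Matrix.conjTranspose_apply]
  rw [h, Finset.sum_mul]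

theorem conjTranspose_lift_mul_lift (A : Matrix (r.Cfg n) (r.Cfg n) ℂ) (hA : Aᴴ * A = 1) :
    (L.lift A)ᴴ * L.lift A = 1 := by
  ext s s'
  have h := L.conjTranspose_lift_mul_mul A 1 s s'
  rw [mul_one] at h
  rw [h]
  simp only [Matrix.one_apply, mul_ite, mul_one, mul_zero, ite_mul, zero_mul]
  by_cases hs : L.set s 0 = L.set s' 0
  · have h1 : ∀ a b, L.set s a = L.set s' b ↔ a = b := fun a b =>
      ⟨fun h => ((L.set_eq_set_iff _ _ _ _).1 h).1, fun h => h ▸ L.set_congr hs a⟩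
    simp only [h1, Finset.sum_ite_eq, Finset.mem_univ, if_true]
    have h2 := congrFun (congrFun hA (L.get s)) (L.get s')
    simp only [Matrix.mul_apply, Matrix.conjTranspose_apply, Matrix.one_apply] at h2
    rw [h2]
    refine if_congr ⟨fun h => ?_, fun h => h ▸ rfl⟩ rfl rfl
    rw [← L.set_get s, h, L.set_congr hs, L.set_get]
  · have h1 : ∀ a b, L.set s a ≠ L.set s' b := fun a b h =>
      hs (L.set_congr ((L.set_eq_set_iff _ _ _ _).1 h).2 0)
    simp only [h1, if_false, Finset.sum_const_zero]
    rw [if_neg]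
    rintro rfl
    exact hs rfl

theorem set_agree (L : Lens n l m r) (σ σ' : Mem n m) (a b : r.Cfg n) :
    (∀ x, x ∉ vars l m → r.set σ a x = r.set σ' b x) ↔ ∀ x, x ∉ vars l m → σ x = σ' x := by
  refine forall_congr' fun x => forall_congr' fun hx => ?_
  rw [L.set_outside _ _ _ hx, L.set_outside _ _ _ hx]

theorem conj_extSt (A : Matrix (r.Cfg n) (r.Cfg n) ℂ) (B : Matrix (St n l m) (St n l m) ℂ) :
    r.conj A (extSt B) = extSt ((L.lift A)ᴴ * B * L.lift A) := by
  ext σ σ'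
  simp only [Regs.conj, Matrix.of_apply, L.get_read]
  by_cases h : ∀ x, x ∉ vars l m → σ x = σ' x
  · rw [extSt_of_agree _ h, L.conjTranspose_lift_mul_mul]
    simp only [extSt_of_agree _ ((L.set_agree σ σ' _ _).2 h), L.read_set]
  · rw [extSt_of_not_agree _ h]
    simp only [extSt_of_not_agree _ (mt (L.set_agree σ σ' _ _).1 h), mul_zero, zero_mul,
      Finset.sum_const_zero]

/-- Initialization of a tuple of registers. -/
noncomputable def reset : Kraus (St n l m) :=
  Kraus.basisMap (fun _ => True) (fun s => L.set s 0) L.get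

theorem reset_dual (B : Matrix (St n l m) (St n l m) ℂ) :
    L.reset.dual B = ∑ c : r.Cfg n,
      (L.lift (Matrix.single 0 c 1))ᴴ * B * L.lift (Matrix.single 0 c 1) := by
  ext s s'
  rw [reset, Kraus.dual_basisMap, Matrix.sum_apply]
  simp only [L.conjTranspose_lift_mul_mul]
  simp only [Matrix.single_apply, ite_and, apply_ite (star : ℂ → ℂ), star_one, star_zero, ite_mul,
    mul_ite, one_mul, mul_one, zero_mul, mul_zero, Finset.sum_ite_eq,
    Finset.mem_univ, if_true]
  simp [eq_comm]

theorem indep_extSt {B : Matrix (St n l m) (St n l m) ℂ}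
    (h0 : ∀ s s', L.get s ≠ L.get s' → B s s' = 0)
    (h1 : ∀ s s', L.get s = L.get s' → ∀ a, B (L.set s a) (L.set s' a) = B s s') :
    r.Indep (extSt B) := by
  intro σ σ'
  rw [L.get_read, L.get_read]
  by_cases h : ∀ x, x ∉ vars l m → σ x = σ' x
  · rw [extSt_of_agree _ h]
    refine ⟨h0 _ _, fun h2 a => ?_⟩
    rw [extSt_of_agree _ ((L.set_agree σ σ' _ _).2 h), L.read_set, L.read_set, h1 _ _ h2]
  · rw [extSt_of_not_agree _ h]
    exact ⟨fun _ => rfl, fun _ a =>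
      extSt_of_not_agree _ (mt (L.set_agree σ σ' _ _).1 h)⟩

end Lens

end Access

/-! ## Assertions on the variables of the program -/

section Assertions

variable {n l m : ℕ}

/-- The parameter of the assertions. -/
def param (l m : ℕ) : PVar m := ⟨0, vars l m⟩

/-- The terms `E*(K)` (with the parameter `K`) and `E*(I)`. -/
noncomputable def term (b : Bool) (E : Kraus (St n l m)) (hE : E.IsQOp) : PQPT n (vars l m) where
  base := if b then {param l m} else ∅
  sub := by
    cases b
    · simp
    · intro X hX
      rw [if_pos rfl, Finset.mem_singleton] at hX
      exact hX ▸ Finset.Subset.refl _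
  disj := by
    cases b
    · simp
    · intro X hX Y hY h
      rw [if_pos rfl, Finset.mem_singleton] at hX hY
      exact absurd (hX.trans hY.symm) h
  E := E.reindex (St.equivCfg n l m)
  F := Kraus.zero _
  tni := by
    rw [Kraus.dual_zero, add_zero]
    exact hE.reindex _

noncomputable def assn (b : Bool) (E : Kraus (St n l m)) (hE : E.IsQOp) : Assn n m :=
  ⟨vars l m, term b E hE⟩

/-- The value of the base of a term. -/
noncomputable def val (b : Bool) (v : Assign n m) : Matrix (St n l m) (St n l m) ℂ :=
  if b then (v (param l m)).1.submatrix (St.equivCfg n l m).symm (St.equivCfg n l m).symm else 1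

theorem val_posSemidef (b : Bool) (v : Assign n m) : (val (l := l) b v).PosSemidef := by
  cases b
  · exact .one
  · exact (v (param l m)).2.1.submatrix _

theorem term_baseDen (b : Bool) (E : Kraus (St n l m)) (hE : E.IsQOp) (v : Assign n m) :
    (term b E hE).baseDen v =
      (val b v).submatrix (St.equivCfg n l m) (St.equivCfg n l m) := by
  cases b
  · ext a a'
    change (if ∀ x, (∀ X ∈ (∅ : Finset (PVar m)), x.1 ∉ X.sup) → a x = a' x then (1 : ℂ) else 0) =
      (1 : Matrix (St n l m) (St n l m) ℂ) (St.equivCfg n l m a) (St.equivCfg n l m a')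
    rw [Matrix.one_apply]
    by_cases h : a = a'
    · simp [h]
    · rw [if_neg, if_neg]
      · simpa using h
      · exact fun h1 => h (funext fun x => h1 x (by simp))
  · have h : ({param l m} : Finset (PVar m)).attach =
        {⟨param l m, Finset.mem_singleton_self _⟩} := by
      ext X
      simp [Subtype.ext_iff, Finset.mem_singleton.1 X.2]
    ext a a'
    change (if ∀ x, (∀ X ∈ ({param l m} : Finset (PVar m)), x.1 ∉ X.sup) → a x = a' x then
      ∏ X ∈ ({param l m} : Finset (PVar m)).attach, (v X.1).1
        (a.restrict ((term true E hE).sub _ X.2)) (a'.restrict ((term true E hE).sub _ X.2))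
      else 0) = (v (param l m)).1 ((St.equivCfg n l m).symm (St.equivCfg n l m a))
        ((St.equivCfg n l m).symm (St.equivCfg n l m a'))
    rw [h, Finset.prod_singleton, if_pos, Equiv.symm_apply_apply, Equiv.symm_apply_apply]
    · rfl
    · intro x hx
      exact absurd x.2 (hx _ (Finset.mem_singleton_self _))

theorem term_den (b : Bool) (E : Kraus (St n l m)) (hE : E.IsQOp) (v : Assign n m) :
    (term b E hE).den v =
      (E.dual (val b v)).submatrix (St.equivCfg n l m) (St.equivCfg n l m) := by
  unfold PQPT.den
  rw [term_baseDen]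
  change (E.reindex (St.equivCfg n l m)).dual _ + (Kraus.zero _).dual 1 = _
  rw [Kraus.dual_zero, add_zero, Kraus.dual_reindex]

theorem assn_den (b : Bool) (E : Kraus (St n l m)) (hE : E.IsQOp) (v : Assign n m) :
    (assn b E hE).den v = extSt (E.dual (val b v)) := by
  rw [← ext_vars, ← term_den b E hE]
  rfl

theorem assn_params (b : Bool) (E : Kraus (St n l m)) (hE : E.IsQOp) :
    (assn b E hE).params = if b then {param l m} else ∅ := rfl

end Assertions

/-! ## Derivable triples with assertions on the variables of the program -/

section Rules

variable {n l m : ℕ} {F : Type} {sig : F → List Ty} {D : Decl n m sig}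

/-- `J` is closed under the axioms and rules of qBE. -/
def Closed (D : Decl n m sig) (J : Triple n m sig → Prop) : Prop :=
  ∀ B t, BERule (trueOrder n m) D B t → t.Legit → (∀ s ∈ B, J s) → J t

theorem closed_QBE (A : Set (Triple n m sig)) : Closed D (QBE (trueOrder n m) D A) :=
  fun _ _ h h' h'' => .rule h h' h''

theorem closed_QTP : Closed D (QTP (trueOrder n m) D) :=
  fun _ _ h h' h'' => .rule h h' h''

/-- The map is the dual of a quantum operation. -/
def IsDual (f : Matrix (St n l m) (St n l m) ℂ → Matrix (St n l m) (St n l m) ℂ) : Prop :=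
  ∃ E : Kraus (St n l m), E.IsQOp ∧ ∀ A, E.dual A = f A

theorem Kraus.IsQOp.isDual {E : Kraus (St n l m)} (h : E.IsQOp) : IsDual E.dual :=
  ⟨E, h, fun _ => rfl⟩

theorem IsDual.comp {f g : Matrix (St n l m) (St n l m) ℂ → Matrix (St n l m) (St n l m) ℂ}
    (hf : IsDual f) (hg : IsDual g) : IsDual fun A => g (f A) := by
  obtain ⟨E, hE, hE'⟩ := hf
  obtain ⟨E₁, h, h'⟩ := hg
  exact ⟨E.comp E₁, hE.comp h, fun A => by rw [Kraus.dual_comp, hE', h']⟩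

theorem isDual_conj {M : Matrix (St n l m) (St n l m) ℂ} (hM : Mᴴ * M = 1) :
    IsDual fun A => Mᴴ * A * M := by
  refine ⟨Kraus.single M, ?_, Kraus.dual_single M⟩
  apply Kraus.isQOp_of_dual_one
  rw [Kraus.dual_single, mul_one, hM]

/-- Whenever the duals of `E` and `E'` are `f` and `g`, the triple with the assertions given by `E`
and `E'` belongs to `J`. The parameter `K` is present if `b` is true. -/
def Derives (J : Triple n m sig → Prop) (b : Bool)
    (f : Matrix (St n l m) (St n l m) ℂ → Matrix (St n l m) (St n l m) ℂ) (S : Prog n m sig)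
    (g : Matrix (St n l m) (St n l m) ℂ → Matrix (St n l m) (St n l m) ℂ) : Prop :=
  ∀ (E E' : Kraus (St n l m)) (h : E.IsQOp) (h' : E'.IsQOp), (∀ A, E.dual A = f A) →
    (∀ A, E'.dual A = g A) → J ⟨assn b E h, S, assn b E' h'⟩

variable {J : Triple n m sig → Prop} {b : Bool}
  {f g f' g' : Matrix (St n l m) (St n l m) ℂ → Matrix (St n l m) (St n l m) ℂ}
  {S S₁ S₂ : Prog n m sig}

theorem mem_trueOrder {P Q : Assn n m} (h : P.params = Q.params)
    (h' : ∀ v, ((Q.den v) - P.den v).PosSemidef) : (P, Q) ∈ trueOrder n m :=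
  ⟨h, h'⟩

theorem mem_trueOrder_assn (E E' : Kraus (St n l m)) (h : E.IsQOp) (h' : E'.IsQOp)
    (hE : ∀ A, A.PosSemidef → (E'.dual A - E.dual A).PosSemidef) :
    (assn b E h, assn b E' h') ∈ trueOrder n m := by
  refine mem_trueOrder rfl fun v => ?_
  rw [assn_den, assn_den, ← extSt_sub]
  exact extSt_posSemidef (hE _ (val_posSemidef b v))

theorem Derives.order (hJ : Closed D J) (hf' : IsDual f') (hg' : IsDual g')
    (h : Derives J b f' S g') (hf : ∀ A, A.PosSemidef → (f' A - f A).PosSemidef)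
    (hg : ∀ A, A.PosSemidef → (g A - g' A).PosSemidef) : Derives J b f S g := by
  intro E E' hE hE' h1 h2
  obtain ⟨E₁, hE₁, h3⟩ := hf'
  obtain ⟨E₂, hE₂, h4⟩ := hg'
  refine hJ _ _ (.order _ (assn b E₁ hE₁) (assn b E₂ hE₂) _ S ?_ ?_) rfl ?_
  · exact mem_trueOrder_assn _ _ _ _ fun A hA => by rw [h3, h1]; exact hf A hA
  · exact mem_trueOrder_assn _ _ _ _ fun A hA => by rw [h2, h4]; exact hg A hA
  · rintro s rfl
    exact h _ _ _ _ h3 h4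

theorem Derives.of_pre_eq (h : Derives J b f' S g) (hf : ∀ A, f A = f' A) :
    Derives J b f S g :=
  fun E E' hE hE' h1 h2 => h E E' hE hE' (fun A => (h1 A).trans (hf A)) h2

theorem Derives.of_post_eq (h : Derives J b f S g') (hg : ∀ A, g A = g' A) :
    Derives J b f S g :=
  fun E E' hE hE' h1 h2 => h E E' hE hE' h1 fun A => (h2 A).trans (hg A)

theorem Derives.seq (hJ : Closed D J) (hg : IsDual g) (h₁ : Derives J b f S₁ g)
    (h₂ : Derives J b g S₂ g') : Derives J b f (.seq S₁ S₂) g' := by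
  intro E E' hE hE' h1 h2
  obtain ⟨E₁, hE₁, h3⟩ := hg
  refine hJ _ _ (.comp _ (assn b E₁ hE₁) _ S₁ S₂) rfl ?_
  rintro s (rfl | rfl)
  · exact h₁ _ _ _ _ h1 h3
  · exact h₂ _ _ _ _ h3 h2

theorem derives_unit (hJ : Closed D J) {r : Regs m} (L : Lens n l m r)
    {U : Matrix (r.Cfg n) (r.Cfg n) ℂ} (hU : U * Uᴴ = 1) (hU' : Uᴴ * U = 1) :
    Derives J b (fun A => (L.lift U)ᴴ * g A * L.lift U) (.unit r U) g := by
  intro E E' hE hE' h1 h2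
  refine hJ _ _ (.unit r U _ _ L.wf hU hU' fun v => ?_) rfl (by simp)
  rw [assn_den, assn_den, L.conj_extSt, h1, h2]

theorem derives_init (hJ : Closed D J) {r : Regs m} (L : Lens n l m r) :
    Derives J b (fun A => L.reset.dual (g A)) (.init r) g := by
  intro E E' hE hE' h1 h2
  refine hJ _ _ (.init r _ _ L.wf fun v => ?_) rfl (by simp)
  simp only [assn_den, L.conj_extSt, h1, h2, L.reset_dual, extSt_sum]

theorem derives_bot (hJ : Closed D J) : Derives J b (fun _ => 0) .bot g := by
  intro E E' hE hE' h1 h2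
  refine hJ _ _ (.bot _ _ fun v => ?_) rfl (by simp)
  rw [assn_den, h1, extSt_zero]

theorem derives_ifm (hJ : Closed D J) {r : Regs m} (L : Lens n l m r) {κ : Type} [Fintype κ]
    {M : κ → Matrix (r.Cfg n) (r.Cfg n) ℂ} (hM : ∑ k, (M k)ᴴ * M k = 1) {S : κ → Prog n m sig}
    {f : κ → Matrix (St n l m) (St n l m) ℂ → Matrix (St n l m) (St n l m) ℂ}
    (hf : ∀ k, IsDual (f k)) (h : ∀ k, Derives J b (f k) (S k) g) :
    Derives J b (fun A => ∑ k, (L.lift (M k))ᴴ * f k A * L.lift (M k)) (.ifm r M S) g := by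
  intro E E' hE hE' h1 h2
  choose E₁ hE₁ h3 using hf
  refine hJ _ _ (.case r M S (fun k => assn b (E₁ k) (hE₁ k)) _ _ L.wf hM fun v => ?_) rfl ?_
  · simp only [assn_den, L.conj_extSt, h1, h3, extSt_sum]
  · rintro _ ⟨k, rfl⟩
    exact h k _ _ _ _ (h3 k) h2

theorem derives_subst (hJ : Closed D J) {r : Matrix (St n l m) (St n l m) ℂ →
      Matrix (St n l m) (St n l m) ℂ} (hf : IsDual f) (hg : IsDual g) (hr : IsDual r)
    (h : Derives J true f S g) :
    Derives J b (fun A => f (r A)) S (fun A => g (r A)) := by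
  intro E E' hE hE' h1 h2
  obtain ⟨E₁, hE₁, h3⟩ := hf
  obtain ⟨E₂, hE₂, h4⟩ := hg
  obtain ⟨R, hR, h5⟩ := hr
  have key (v v' : Assign n m) (hv : (v' (param l m)).1 = (term b R hR).den v) :
      val true v' = r (val b v) := by
    change (v' (param l m)).1.submatrix _ _ = _
    rw [hv, term_den, h5]
    exact submatrix_equiv_symm _ _
  refine hJ _ _ (.subst (param l m) (term b R hR) (assn true E₁ hE₁) (assn true E₂ hE₂) _ _ S
    ?_ ?_) rfl ?_
  · intro v v' hv _
    rw [assn_den, assn_den, key v v' hv, h3, h1]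
  · intro v v' hv _
    rw [assn_den, assn_den, key v v' hv, h4, h2]
  · rintro s rfl
    exact h _ _ _ _ h3 h4

/-- `e` describes the effect of the renaming `π` of the variables of the program. -/
structure Ren.ActsBy (π : Ren) (e : St n l m ≃ St n l m) : Prop where
  mem_vars : ∀ x : QVar m, QVar.ren π x ∈ vars l m ↔ x ∈ vars l m
  surj : ∀ x : QVar m, x ∉ vars l m → ∃ y, y ∉ vars l m ∧ QVar.ren π y = x
  read_pull : ∀ σ : Mem n m, St.read l (σ.pull π) = e (St.read l σ)

theorem Ren.ActsBy.param_ren {π : Ren} {e : St n l m ≃ St n l m} (h : π.ActsBy e) :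
    (param l m).ren π = param l m := by
  have : (vars l m).map ⟨QVar.ren π, QVar.ren_injective π⟩ = vars l m := by
    refine Finset.eq_of_subset_of_card_le (fun x hx => ?_) (by simp)
    obtain ⟨y, hy, rfl⟩ := Finset.mem_map.1 hx
    exact (h.mem_vars y).2 hy
  unfold PVar.ren param
  rw [this]

theorem Ren.ActsBy.agree_pull {π : Ren} {e : St n l m ≃ St n l m} (h : π.ActsBy e)
    (σ σ' : Mem n m) : (∀ x, x ∉ vars l m → σ.pull π x = σ'.pull π x) ↔
      ∀ x, x ∉ vars l m → σ x = σ' x := by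
  constructor
  · intro h1 x hx
    obtain ⟨y, hy, rfl⟩ := h.surj x hx
    exact h1 y hy
  · intro h1 x hx
    exact h1 _ (mt (h.mem_vars x).1 hx)

theorem Ren.ActsBy.extSt_pull {π : Ren} {e : St n l m ≃ St n l m} (h : π.ActsBy e)
    (A : Matrix (St n l m) (St n l m) ℂ) (σ σ' : Mem n m) :
    extSt A (σ.pull π) (σ'.pull π) = extSt (A.submatrix e e) σ σ' := by
  by_cases h1 : ∀ x, x ∉ vars l m → σ x = σ' x
  · rw [extSt_of_agree _ h1, extSt_of_agree _ ((h.agree_pull _ _).2 h1), h.read_pull, h.read_pull]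
    rfl
  · rw [extSt_of_not_agree _ h1, extSt_of_not_agree _ (mt (h.agree_pull _ _).1 h1)]

theorem ext_param (v : Assign n m) :
    ext (param l m).sup (v (param l m)).1 = extSt (val (l := l) true v) := by
  rw [← ext_vars]
  change ext (vars l m) _ = ext (vars l m) _
  congr 1
  exact (submatrix_symm_equiv (St.equivCfg n l m) _).symm

theorem Ren.ActsBy.isRenaming {π : Ren} {e : St n l m ≃ St n l m} (h : π.ActsBy e)
    {E E' : Kraus (St n l m)} (hE : E.IsQOp) (hE' : E'.IsQOp)
    (hEE' : ∀ A, E'.dual A = (E.dual (A.submatrix e.symm e.symm)).submatrix e e) :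
    IsRenaming π (assn true E hE) (assn true E' hE') := by
  intro v v' hv σ σ'
  have h1 : val (l := l) true v = (val true v').submatrix e e := by
    ext s s'
    obtain ⟨τ, τ', rfl, rfl, h2⟩ := St.exists_read_eq s s'
    have h3 := hv (param l m) τ τ'
    have h4 : ∀ X, X = param l m → ext X.sup (v X).1 = extSt (val (l := l) true v) := by
      rintro _ rfl
      exact ext_param v
    rw [h4 _ h.param_ren, ext_param, h.extSt_pull, extSt_of_agree _ h2,
      extSt_of_agree _ h2] at h3
    exact h3
  rw [assn_den, assn_den, h.extSt_pull, hEE', h1]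
  simp

theorem derives_adap (hJ : Closed D J) {π : Ren} {e : St n l m ≃ St n l m} (he : π.ActsBy e)
    (hπ : π.Fixes D.globals) (hf : IsDual f) (hg : IsDual g) (h : Derives J true f S g) :
    Derives J true (fun A => (f (A.submatrix e.symm e.symm)).submatrix e e) (S.ren π)
      (fun A => (g (A.submatrix e.symm e.symm)).submatrix e e) := by
  intro E E' hE hE' h1 h2
  obtain ⟨E₁, hE₁, h3⟩ := hf
  obtain ⟨E₂, hE₂, h4⟩ := hg
  refine hJ _ _ (.adap π (assn true E₁ hE₁) (assn true E₂ hE₂) _ _ S hπ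
    (he.isRenaming _ _ fun A => by rw [h1, h3]) (he.isRenaming _ _ fun A => by rw [h2, h4])) rfl ?_
  rintro s rfl
  exact h _ _ _ _ h3 h4

/-! ### The identity renaming -/

theorem Ref.ren_one (τ : Ty) (r : Ref m) : r.ren 1 τ = r := by
  cases r <;> rfl

theorem Regs.ren_one (r : Regs m) : r.ren 1 = r := by
  cases r
  simp only [Regs.ren, Ref.ren_one]

theorem Prog.ren_one (S : Prog n m sig) : S.ren 1 = S := by
  induction S with
  | bot => rfl
  | skip => rfl
  | init r => simp only [Prog.ren, Regs.ren_one]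
  | unit r U =>
    obtain ⟨ι, τ, ref⟩ := r
    have key : ∀ ref' : ι → Ref m, ref' = ref →
        (Prog.unit ⟨ι, τ, ref'⟩ U : Prog n m sig) = .unit ⟨ι, τ, ref⟩ U := by
      rintro _ rfl
      rfl
    exact key _ (funext fun i => Ref.ren_one _ _)
  | seq S₁ S₂ h₁ h₂ => simp only [Prog.ren, h₁, h₂]
  | ifm r M S h =>
    obtain ⟨ι, τ, ref⟩ := r
    have key : ∀ ref' : ι → Ref m, ref' = ref → ∀ S', S' = S →
        (Prog.ifm ⟨ι, τ, ref'⟩ M S' : Prog n m sig) = .ifm ⟨ι, τ, ref⟩ M S := by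
      rintro _ rfl _ rfl
      rfl
    exact key _ (funext fun i => Ref.ren_one _ _) _ (funext h)
  | locl r S h => simp only [Prog.ren, Regs.ren_one, h]
  | call f args =>
    simp only [Prog.ren, Ref.ren_one]

theorem derives_locl (hJ : Closed D J) {r : Regs m} (L : Lens n l m r)
    (hf : ∀ A s s', (L.get s ≠ L.get s' → f A s s' = 0) ∧
      (L.get s = L.get s' → ∀ a, f A (L.set s a) (L.set s' a) = f A s s'))
    (hg : ∀ A s s', (L.get s ≠ L.get s' → g A s s' = 0) ∧
      (L.get s = L.get s' → ∀ a, g A (L.set s a) (L.set s' a) = g A s s'))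
    (h : Derives J b f (.seq (.init r) S) g) : Derives J b f (.locl r S) g := by
  intro E E' hE hE' h1 h2
  refine hJ _ _ (.locl 1 r S _ _ (fun x _ => rfl) ?_ ?_ ?_) rfl ?_
  · rw [Regs.ren_one]
    exact L.wf
  · rw [Regs.ren_one]
    intro v
    rw [assn_den, h1]
    exact L.indep_extSt (fun s s' => (hf _ s s').1) fun s s' => (hf _ s s').2
  · rw [Regs.ren_one]
    intro v
    rw [assn_den, h2]
    exact L.indep_extSt (fun s s' => (hg _ s s').1) fun s s' => (hg _ s s').2
  · rintro s rfl
    rw [Regs.ren_one, Prog.ren_one]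
    exact h _ _ _ _ h1 h2

end Rules

/-! ## The registers of the program -/

section Registers

variable {n l m : ℕ}

theorem Regs.set_loc {r : Regs m} {σ : Mem n m} (h : Function.Injective (r.loc σ)) (a : r.Cfg n)
    (i : r.ι) : HEq (r.set σ a (r.loc σ i)) (a i) := by
  have hi : ∃ j, r.loc σ j = r.loc σ i := ⟨i, rfl⟩
  unfold Regs.set
  rw [dif_pos hi]
  refine (cast_heq _ _).trans ?_
  rw [h hi.choose_spec]

theorem Regs.set_of_ne {r : Regs m} {σ : Mem n m} {x : QVar m} (h : ∀ i, r.loc σ i ≠ x)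
    (a : r.Cfg n) : r.set σ a x = σ x :=
  dif_neg fun ⟨i, hi⟩ => h i hi

/-- The first component of the contents of a concatenation. -/
def Regs.Cfg.fst {r s : Regs m} (a : (r.app s).Cfg n) : r.Cfg n := fun i => a (Sum.inl i)

/-- The second component of the contents of a concatenation. -/
def Regs.Cfg.snd {r s : Regs m} (a : (r.app s).Cfg n) : s.Cfg n := fun j => a (Sum.inr j)

theorem Regs.app_loc (r s : Regs m) (σ : Mem n m) :
    (r.app s).loc σ = Sum.elim (r.loc σ) (s.loc σ) := by
  funext i
  cases i <;> rfl

/-- The tuples are disjoint, and none contains an index of an array reference of the other. -/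
structure Regs.Disj (n : ℕ) {m : ℕ} (r s : Regs m) : Prop where
  ne : ∀ (σ : Mem n m) i j, r.loc σ i ≠ s.loc σ j
  left : ∀ (σ : Mem n m) a, r.loc (s.set σ a) = r.loc σ
  right : ∀ (σ : Mem n m) a, s.loc (r.set σ a) = s.loc σ

theorem Regs.app_loc_injective {r s : Regs m} (hr : r.WF n) (hs : s.WF n) (h : r.Disj n s)
    (σ : Mem n m) : Function.Injective ((r.app s).loc σ) := by
  rw [Regs.app_loc]
  exact (hr σ).1.sumElim (hs σ).1 (h.ne σ)

theorem Regs.app_set {r s : Regs m} (hr : r.WF n) (hs : s.WF n) (h : r.Disj n s) (σ : Mem n m)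
    (a : (r.app s).Cfg n) : (r.app s).set σ a =
      r.set (s.set σ (Regs.Cfg.snd a)) (Regs.Cfg.fst a) := by
  funext x
  have hinj := Regs.app_loc_injective hr hs h σ
  by_cases h1 : ∃ i, r.loc σ i = x
  · obtain ⟨i, rfl⟩ := h1
    have h2 := Regs.set_loc (r := r) (hr (s.set σ (Regs.Cfg.snd a))).1 (Regs.Cfg.fst a) i
    rw [h.left] at h2
    exact eq_of_heq ((Regs.set_loc (r := r.app s) hinj a (.inl i)).trans h2.symm)
  · push Not at h1
    have h1' : ∀ i, r.loc (s.set σ (Regs.Cfg.snd a)) i ≠ x := by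
      rw [h.left]
      exact h1
    rw [Regs.set_of_ne h1']
    by_cases h2 : ∃ j, s.loc σ j = x
    · obtain ⟨j, rfl⟩ := h2
      exact eq_of_heq ((Regs.set_loc (r := r.app s) hinj a (.inr j)).trans
        (Regs.set_loc (hs σ).1 (Regs.Cfg.snd a) j).symm)
    · push Not at h2
      rw [Regs.set_of_ne h2, Regs.set_of_ne]
      rw [Regs.app_loc]
      rintro (i | j)
      · exact h1 i
      · exact h2 j

theorem Regs.app_wf {r s : Regs m} (hr : r.WF n) (hs : s.WF n) (h : r.Disj n s) :
    (r.app s).WF n := by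
  refine fun σ => ⟨Regs.app_loc_injective hr hs h σ, fun a => ?_⟩
  rw [Regs.app_loc, Regs.app_loc, Regs.app_set hr hs h, (hr _).2, h.right, h.left, (hs _).2]

/-- Access to the concatenation of two tuples. -/
def Lens.app {r s : Regs m} (L : Lens n l m r) (L' : Lens n l m s) (h : r.Disj n s)
    (h₁ : ∀ x a, L'.get (L.set x a) = L'.get x)
    (h₂ : ∀ x a b, L.set (L'.set x a) b = L'.set (L.set x b) a) : Lens n l m (r.app s) where
  get x
    | .inl i => L.get x i
    | .inr j => L'.get x j
  set x a := L.set (L'.set x (Regs.Cfg.snd a)) (Regs.Cfg.fst a)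
  get_set x a := by
    funext i
    cases i with
    | inl i => exact congrFun (L.get_set _ (Regs.Cfg.fst a)) i
    | inr j =>
      refine congrFun ((h₁ _ _).trans (L'.get_set x (Regs.Cfg.snd a))) j
  set_get x := by
    change L.set (L'.set x (L'.get x)) (L.get x) = x
    rw [L'.set_get, L.set_get]
  set_set x a a' := by
    rw [← h₂ (L'.set x (Regs.Cfg.snd a)) (Regs.Cfg.snd a'), L'.set_set, L.set_set]
  wf := Regs.app_wf L.wf L'.wf h
  get_read σ := by
    funext i
    cases i with
    | inl i => exact congrFun (L.get_read σ) i
    | inr j => exact congrFun (L'.get_read σ) j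
  read_set σ a := by
    rw [Regs.app_set L.wf L'.wf h, L.read_set, L'.read_set]
  set_outside σ a x hx := by
    rw [Regs.app_set L.wf L'.wf h, L.set_outside _ _ _ hx, L'.set_outside _ _ _ hx]

theorem Regs.one_set_self {τ : Ty} {v : Ref m} (σ : Mem n m) (a : (Regs.one τ v).Cfg n) :
    HEq ((Regs.one τ v).set σ a (v.loc σ τ)) (a ()) :=
  Regs.set_loc (r := Regs.one τ v) (fun _ _ _ => rfl) a ()

theorem Regs.one_set_of_ne {τ : Ty} {v : Ref m} {σ : Mem n m} {x : QVar m} (h : v.loc σ τ ≠ x)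
    (a : (Regs.one τ v).Cfg n) : (Regs.one τ v).set σ a x = σ x :=
  Regs.set_of_ne (r := Regs.one τ v) (fun _ => h) a

theorem Regs.one_wf_var (τ : Ty) (k : ℕ) : (Regs.one (m := m) τ (.var k)).WF n :=
  fun _ => ⟨fun _ _ _ => rfl, fun _ => rfl⟩

/-- Access to the counter `p`. -/
def lensP : Lens n l m (Regs.one Ty.cnt (p m)) where
  get s _ := s.p
  set s a := { s with p := a () }
  get_set _ _ := rfl
  set_get _ := rfl
  set_set _ _ _ := rfl
  wf := Regs.one_wf_var _ _
  get_read _ := rfl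
  read_set σ a := by
    ext : 1
    · exact eq_of_heq (Regs.one_set_self (v := p m) σ a)
    · exact Regs.one_set_of_ne (x := (Ty.cnt, .var 1)) (by simp [p, Ref.loc]) a
    · exact funext fun i => Regs.one_set_of_ne (x := (Ty.vec, .cell 0 i)) (by simp [p, Ref.loc]) a
    · exact funext fun i => Regs.one_set_of_ne (x := (Ty.bit, .var i.val)) (by simp [p, Ref.loc]) a
  set_outside σ a x hx := by
    refine Regs.one_set_of_ne ?_ a
    rintro rfl
    exact hx (mem_vars.2 (.inl rfl))

/-- Access to the counter `q`. -/
def lensQ : Lens n l m (Regs.one Ty.cnt (q m)) where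
  get s _ := s.q
  set s a := { s with q := a () }
  get_set _ _ := rfl
  set_get _ := rfl
  set_set _ _ _ := rfl
  wf := Regs.one_wf_var _ _
  get_read _ := rfl
  read_set σ a := by
    ext : 1
    · exact Regs.one_set_of_ne (x := (Ty.cnt, .var 0)) (by simp [q, Ref.loc]) a
    · exact eq_of_heq (Regs.one_set_self (v := q m) σ a)
    · exact funext fun i => Regs.one_set_of_ne (x := (Ty.vec, .cell 0 i)) (by simp [q, Ref.loc]) a
    · exact funext fun i => Regs.one_set_of_ne (x := (Ty.bit, .var i.val)) (by simp [q, Ref.loc]) a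
  set_outside σ a x hx := by
    refine Regs.one_set_of_ne ?_ a
    rintro rfl
    exact hx (mem_vars.2 (.inr (.inl rfl)))

/-- Access to a qubit. -/
def lensB (j : Fin (l + 2)) : Lens n l m (Regs.one Ty.bit (.var j.val)) where
  get s _ := s.b j
  set s a := { s with b := Function.update s.b j (a ()) }
  get_set s a := funext fun _ => Function.update_self (f := s.b) _ _
  set_get s := by simp
  set_set s a a' := by
    ext : 1 <;> first | rfl | exact Function.update_idem ..
  wf := Regs.one_wf_var _ _
  get_read _ := rfl
  read_set σ a := by
    ext : 1
    · exact Regs.one_set_of_ne (x := (Ty.cnt, .var 0)) (by simp [Ref.loc]) a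
    · exact Regs.one_set_of_ne (x := (Ty.cnt, .var 1)) (by simp [Ref.loc]) a
    · exact funext fun i => Regs.one_set_of_ne (x := (Ty.vec, .cell 0 i)) (by simp [Ref.loc]) a
    · funext i
      by_cases h : i = j
      · subst h
        refine (eq_of_heq (Regs.one_set_self (v := .var i.val) σ a)).trans ?_
        exact (Function.update_self (f := (St.read l σ).b) ..).symm
      · refine (Regs.one_set_of_ne (x := (Ty.bit, .var i.val)) ?_ a).trans ?_
        · simp [Ref.loc, Fin.val_inj, Ne.symm h]
        · exact (Function.update_of_ne h (a ()) (St.read l σ).b).symm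
  set_outside σ a x hx := by
    refine Regs.one_set_of_ne ?_ a
    rintro rfl
    exact hx (mem_vars.2 (.inr (.inr (.inr ⟨j, rfl⟩))))

/-- Access to the array component `𝕏[q]`. -/
def lensX : Lens n l m (Regs.one Ty.vec (Xq m)) where
  get s _ := s.X s.q
  set s a := { s with X := Function.update s.X s.q (a ()) }
  get_set s a := funext fun _ => Function.update_self (f := s.X) _ _
  set_get s := by simp
  set_set s a a' := by
    ext : 1 <;> first | rfl | exact Function.update_idem ..
  wf σ := ⟨fun _ _ _ => rfl, fun a => by
    have h : (Regs.one Ty.vec (Xq m)).set σ a (Ty.cnt, .var 1) = σ (Ty.cnt, .var 1) :=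
      Regs.one_set_of_ne (by simp [Xq, Ref.loc]) a
    funext i
    simp only [Regs.loc, Regs.one, Xq, Ref.loc] at h ⊢
    rw [h]⟩
  get_read _ := rfl
  read_set σ a := by
    ext : 1
    · exact Regs.one_set_of_ne (x := (Ty.cnt, .var 0)) (by simp [Xq, Ref.loc]) a
    · exact Regs.one_set_of_ne (x := (Ty.cnt, .var 1)) (by simp [Xq, Ref.loc]) a
    · funext i
      by_cases h : i = σ (Ty.cnt, .var 1)
      · subst h
        refine (eq_of_heq (Regs.one_set_self (v := Xq m) σ a)).trans ?_
        exact (Function.update_self (f := (St.read l σ).X) ..).symm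
      · refine (Regs.one_set_of_ne (x := (Ty.vec, .cell 0 i)) ?_ a).trans ?_
        · simpa [Xq, Ref.loc] using fun h1 => h (QName.cell.inj h1).2.symm
        · exact (Function.update_of_ne h (a ()) (St.read l σ).X).symm
    · exact funext fun i => Regs.one_set_of_ne (x := (Ty.bit, .var i.val)) (by simp [Xq, Ref.loc]) a
  set_outside σ a x hx := by
    refine Regs.one_set_of_ne ?_ a
    rintro rfl
    exact hx (mem_vars.2 (.inr (.inr (.inl ⟨_, rfl⟩))))

theorem Xs_index_injective (hlm : l < 2 ^ m) :
    Function.Injective fun j : Fin l => Fin.ofNat (2 ^ m) (j.val + 1) := by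
  intro i j h
  have h1 := congrArg Fin.val h
  simp only [Fin.val_ofNat] at h1
  rw [Nat.mod_eq_of_lt (by omega), Nat.mod_eq_of_lt (by omega)] at h1
  omega

theorem Xs_loc_injective (hlm : l < 2 ^ m) (σ : Mem n m) :
    Function.Injective ((Xs m l).loc σ) := by
  intro i j h
  simp only [Regs.loc, Xs, Ref.loc, Prod.mk.injEq, QName.cell.injEq, true_and] at h
  exact Xs_index_injective hlm h

open Classical in
/-- Writing to the components `1, …, l` of an array. -/
noncomputable def setXs (x : Fin (2 ^ m) → (Fin n → ZMod 2)) (a : Fin l → (Fin n → ZMod 2))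
    (i : Fin (2 ^ m)) : Fin n → ZMod 2 :=
  if h : ∃ j : Fin l, Fin.ofNat (2 ^ m) (j.val + 1) = i then a h.choose else x i

theorem setXs_index (hlm : l < 2 ^ m) (x : Fin (2 ^ m) → (Fin n → ZMod 2))
    (a : Fin l → (Fin n → ZMod 2)) (j : Fin l) : setXs x a (Fin.ofNat (2 ^ m) (j.val + 1)) = a j := by
  have h : ∃ i : Fin l, Fin.ofNat (2 ^ m) (i.val + 1) = Fin.ofNat (2 ^ m) (j.val + 1) := ⟨j, rfl⟩
  refine (dif_pos h).trans ?_
  rw [Xs_index_injective hlm h.choose_spec]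

theorem setXs_of_ne (x : Fin (2 ^ m) → (Fin n → ZMod 2)) (a : Fin l → (Fin n → ZMod 2))
    {i : Fin (2 ^ m)} (h : ¬∃ j : Fin l, Fin.ofNat (2 ^ m) (j.val + 1) = i) : setXs x a i = x i :=
  dif_neg h

/-- Access to `𝕏[1], …, 𝕏[l]`. -/
noncomputable def lensXs (hlm : l < 2 ^ m) : Lens n l m (Xs m l) where
  get s j := s.X (Fin.ofNat (2 ^ m) (j.val + 1))
  set s a := { s with X := setXs s.X a }
  get_set s a := funext fun j => setXs_index hlm s.X a j
  set_get s := by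
    ext : 1
    · rfl
    · rfl
    · funext i
      by_cases h : ∃ j : Fin l, Fin.ofNat (2 ^ m) (j.val + 1) = i
      · obtain ⟨j, rfl⟩ := h
        exact setXs_index hlm s.X (fun j : Fin l => s.X (Fin.ofNat (2 ^ m) (j.val + 1))) j
      · exact setXs_of_ne s.X (fun j : Fin l => s.X (Fin.ofNat (2 ^ m) (j.val + 1))) h
    · rfl
  set_set s a a' := by
    ext : 1
    · rfl
    · rfl
    · funext i
      by_cases h : ∃ j : Fin l, Fin.ofNat (2 ^ m) (j.val + 1) = i
      · obtain ⟨j, rfl⟩ := h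
        exact (setXs_index hlm _ a' j).trans (setXs_index hlm _ a' j).symm
      · exact (setXs_of_ne _ a' h).trans ((setXs_of_ne _ a h).trans (setXs_of_ne _ a' h).symm)
    · rfl
  wf σ := ⟨Xs_loc_injective hlm σ, fun _ => rfl⟩
  get_read _ := rfl
  read_set σ a := by
    ext : 1
    · exact Regs.set_of_ne (x := (Ty.cnt, .var 0)) (fun i => by simp [Regs.loc, Xs, Ref.loc]) a
    · exact Regs.set_of_ne (x := (Ty.cnt, .var 1)) (fun i => by simp [Regs.loc, Xs, Ref.loc]) a
    · funext i
      by_cases h : ∃ j : Fin l, Fin.ofNat (2 ^ m) (j.val + 1) = i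
      · obtain ⟨j, rfl⟩ := h
        exact (eq_of_heq (Regs.set_loc (r := Xs m l) (Xs_loc_injective hlm σ) a j)).trans
          (setXs_index hlm _ a j).symm
      · refine Eq.trans ?_ (setXs_of_ne (St.read l σ).X a h).symm
        refine Regs.set_of_ne (x := (Ty.vec, .cell 0 i)) (fun j hj => h ⟨j, ?_⟩) a
        exact (QName.cell.inj (Prod.ext_iff.1 hj).2).2
    · exact funext fun i => Regs.set_of_ne (x := (Ty.bit, .var i.val))
        (fun j => by simp [Regs.loc, Xs, Ref.loc]) a
  set_outside σ a x hx := by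
    refine Regs.set_of_ne (fun j => ?_) a
    rintro rfl
    exact hx (mem_vars.2 (.inr (.inr (.inl ⟨_, rfl⟩))))

/-- Access to `𝕏[q]` and a qubit. -/
def lensXB (j : Fin (l + 2)) :
    Lens n l m ((Regs.one Ty.vec (Xq m)).app (Regs.one Ty.bit (.var j.val))) :=
  lensX.app (lensB j)
    { ne := fun σ _ _ => by simp [Regs.loc, Regs.one, Xq, Ref.loc]
      left := fun σ a => by
        have h : (Regs.one Ty.bit (.var j.val)).set σ a (Ty.cnt, .var 1) = σ (Ty.cnt, .var 1) :=
          Regs.one_set_of_ne (by simp [Ref.loc]) a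
        funext i
        simp only [Regs.loc, Regs.one, Xq, Ref.loc] at h ⊢
        rw [h]
      right := fun _ _ => rfl }
    (fun _ _ => rfl) (fun _ _ _ => rfl)

/-- Access to `𝕏[1], …, 𝕏[l]` and `Y`. -/
noncomputable def lensXsY (hlm : l < 2 ^ m) : Lens n l m ((Xs m l).app (Regs.one Ty.bit (Y m))) :=
  (lensXs hlm).app (lensB 0)
    { ne := fun σ _ _ => by simp [Regs.loc, Regs.one, Xs, Y, Ref.loc]
      left := fun _ _ => rfl
      right := fun _ _ => rfl }
    (fun _ _ => rfl) (fun _ _ _ => rfl)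

/-- Access to `p` and a qubit. -/
def lensPB (j : Fin (l + 2)) :
    Lens n l m ((Regs.one Ty.cnt (p m)).app (Regs.one Ty.bit (.var j.val))) :=
  lensP.app (lensB j)
    { ne := fun σ _ _ => by simp [Regs.loc, Regs.one, p, Ref.loc]
      left := fun _ _ => rfl
      right := fun _ _ => rfl }
    (fun _ _ => rfl) (fun _ _ _ => rfl)

end Registers

/-! ## The operators of the program -/

section Operators

variable {n l m : ℕ}

def Regs.oneEquiv (τ : Ty) (v : Ref m) : (Regs.one τ v).Cfg n ≃ Basis n m τ where
  toFun a := a ()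
  invFun x _ := x
  left_inv _ := rfl
  right_inv _ := rfl

def Regs.appEquiv (r s : Regs m) : (r.app s).Cfg n ≃ r.Cfg n × s.Cfg n where
  toFun a := (Regs.Cfg.fst a, Regs.Cfg.snd a)
  invFun x
    | .inl i => x.1 i
    | .inr j => x.2 j
  left_inv a := by
    funext i
    cases i <;> rfl
  right_inv _ := rfl

theorem tens_mul {r s : Regs m} (A C : Matrix (r.Cfg n) (r.Cfg n) ℂ)
    (B E : Matrix (s.Cfg n) (s.Cfg n) ℂ) : tens A B * tens C E = tens (A * C) (B * E) := by
  ext a b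
  rw [Matrix.mul_apply]
  change ∑ c, _ = (A * C) (Regs.Cfg.fst a) (Regs.Cfg.fst b) * (B * E) (Regs.Cfg.snd a) (Regs.Cfg.snd b)
  rw [Matrix.mul_apply, Matrix.mul_apply, Finset.sum_mul_sum, ← Fintype.sum_prod_type']
  refine Fintype.sum_equiv (Regs.appEquiv r s) _ _ fun c => ?_
  exact mul_mul_mul_comm _ _ _ _

theorem tens_conjTranspose {r s : Regs m} (A : Matrix (r.Cfg n) (r.Cfg n) ℂ)
    (B : Matrix (s.Cfg n) (s.Cfg n) ℂ) : (tens A B)ᴴ = tens Aᴴ Bᴴ := by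
  ext a b
  exact star_mul' _ _

theorem tens_one {r s : Regs m} : tens (1 : Matrix (r.Cfg n) (r.Cfg n) ℂ)
    (1 : Matrix (s.Cfg n) (s.Cfg n) ℂ) = 1 := by
  ext a b
  change (1 : Matrix (r.Cfg n) (r.Cfg n) ℂ) (Regs.Cfg.fst a) (Regs.Cfg.fst b) *
    (1 : Matrix (s.Cfg n) (s.Cfg n) ℂ) (Regs.Cfg.snd a) (Regs.Cfg.snd b) = _
  simp only [Matrix.one_apply]
  by_cases h : a = b
  · simp [h]
  · rw [if_neg h]
    by_cases h1 : Regs.Cfg.fst a = Regs.Cfg.fst b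
    · rw [if_neg (c := Regs.Cfg.snd a = _), mul_zero]
      exact fun h2 => h ((Regs.appEquiv r s).injective (Prod.ext h1 h2))
    · rw [if_neg h1, zero_mul]

theorem on_eq_submatrix (τ : Ty) (v : Ref m) (A : Matrix (Basis n m τ) (Basis n m τ) ℂ) :
    on τ v A = A.submatrix (Regs.oneEquiv τ v) (Regs.oneEquiv τ v) := rfl

theorem on_mul (τ : Ty) (v : Ref m) (A B : Matrix (Basis n m τ) (Basis n m τ) ℂ) :
    on τ v A * on τ v B = on τ v (A * B) := by
  simp only [on_eq_submatrix, Matrix.submatrix_mul_equiv]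

theorem on_conjTranspose (τ : Ty) (v : Ref m) (A : Matrix (Basis n m τ) (Basis n m τ) ℂ) :
    (on τ v A)ᴴ = on τ v Aᴴ := rfl

theorem on_one (τ : Ty) (v : Ref m) :
    on τ v (1 : Matrix (Basis n m τ) (Basis n m τ) ℂ) = 1 := by
  rw [on_eq_submatrix, Matrix.submatrix_one_equiv]

/-- The operator that permutes the computational basis by `f`. -/
def permMatrix {α : Type*} [DecidableEq α] (f : α → α) : Matrix α α ℂ :=
  Matrix.of fun a b => if a = f b then 1 else 0

theorem permMatrix_unitary {α : Type*} [Fintype α] [DecidableEq α] {f : α → α}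
    (hf : Function.Injective f) :
    permMatrix f * (permMatrix f)ᴴ = 1 ∧ (permMatrix f)ᴴ * permMatrix f = 1 := by
  have h : (permMatrix f)ᴴ * permMatrix f = 1 := by
    ext a b
    simp [permMatrix, Matrix.mul_apply, Matrix.one_apply, hf.eq_iff, eq_comm]
  exact ⟨mul_eq_one_comm.1 h, h⟩

theorem Lens.lift_permMatrix_mulVec {r : Regs m} (L : Lens n l m r) (f : r.Cfg n → r.Cfg n)
    (s : St n l m) : L.lift (permMatrix f) *ᵥ Pi.single s 1 =
      Pi.single (L.set s (f (L.get s))) 1 := by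
  rw [L.lift_mulVec_single, Finset.sum_eq_single (f (L.get s))]
  · simp [permMatrix]
  · intro a _ ha
    simp [permMatrix, ha]
  · simp

theorem Lens.lift_permMatrix_conj {r : Regs m} (L : Lens n l m r) (f : r.Cfg n → r.Cfg n)
    (B : Matrix (St n l m) (St n l m) ℂ) (s s' : St n l m) :
    ((L.lift (permMatrix f))ᴴ * B * L.lift (permMatrix f)) s s' =
      B (L.set s (f (L.get s))) (L.set s' (f (L.get s'))) := by
  rw [L.conjTranspose_lift_mul_mul, Finset.sum_eq_single (f (L.get s)),
    Finset.sum_eq_single (f (L.get s'))]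
  · simp [permMatrix]
  · intro a _ ha
    simp [permMatrix, ha]
  · simp
  · intro a _ ha
    simp [permMatrix, ha]
  · simp

theorem Lens.lift_diagonal_conj {r : Regs m} (L : Lens n l m r) (d : r.Cfg n → ℂ)
    (B : Matrix (St n l m) (St n l m) ℂ) (s s' : St n l m) :
    ((L.lift (Matrix.diagonal d))ᴴ * B * L.lift (Matrix.diagonal d)) s s' =
      star (d (L.get s)) * B s s' * d (L.get s') := by
  rw [L.conjTranspose_lift_mul_mul, Finset.sum_eq_single (L.get s),
    Finset.sum_eq_single (L.get s')]
  · simp [L.set_get]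
  · intro a _ ha
    simp [ha]
  · simp
  · intro a _ ha
    simp [ha]
  · simp

/-- A map on counter values as a map on one-element tuples. -/
def cntMap (v : Ref m) (f : Fin (2 ^ m) → Fin (2 ^ m)) (a : (Regs.one Ty.cnt v).Cfg n) :
    (Regs.one Ty.cnt v).Cfg n :=
  fun _ => f (a ())

theorem on_permMatrix (v : Ref m) (f : Fin (2 ^ m) → Fin (2 ^ m)) :
    on (n := n) Ty.cnt v (permMatrix f) = permMatrix (cntMap v f) := by
  ext a b
  change (if (show Fin (2 ^ m) from a ()) = f (b ()) then (1 : ℂ) else 0) =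
    if a = cntMap v f b then 1 else 0
  exact if_congr ⟨fun h => funext fun _ => h, fun h => congrFun h ()⟩ rfl rfl

theorem on_permMatrix_unitary (v : Ref m) {f : Fin (2 ^ m) → Fin (2 ^ m)}
    (hf : Function.Injective f) :
    on (n := n) Ty.cnt v (permMatrix f) * (on (n := n) Ty.cnt v (permMatrix f))ᴴ = 1 ∧
      (on (n := n) Ty.cnt v (permMatrix f))ᴴ * on (n := n) Ty.cnt v (permMatrix f) = 1 := by
  rw [on_permMatrix]
  refine permMatrix_unitary fun a b h => funext fun _ => hf ?_
  exact congrFun h ()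

/-- The effect of an oracle on the computational basis. -/
def oracleFun (r : Regs m) (v : Ref m) (h : r.Cfg n → ZMod 2)
    (a : (r.app (Regs.one Ty.bit v)).Cfg n) : (r.app (Regs.one Ty.bit v)).Cfg n
  | .inl i => a (.inl i)
  | .inr _ => ((show ZMod 2 from a (.inr ())) + h (Regs.Cfg.fst a) : ZMod 2)

theorem oracle_eq (r : Regs m) (v : Ref m) (h : r.Cfg n → ZMod 2) :
    oracle r v h = permMatrix (oracleFun r v h) := by
  ext a b
  refine if_congr ⟨fun h => funext fun i => ?_, fun h => ⟨fun i => ?_, ?_⟩⟩ rfl rfl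
  · cases i with
    | inl i => exact h.1 i
    | inr j => exact h.2
  · exact congrFun h (.inl i)
  · exact congrFun h (.inr ())

theorem oracle_unitary (r : Regs m) (v : Ref m) (h : r.Cfg n → ZMod 2) :
    oracle r v h * (oracle r v h)ᴴ = 1 ∧ (oracle r v h)ᴴ * oracle r v h = 1 := by
  rw [oracle_eq]
  refine permMatrix_unitary fun a b hab => ?_
  have h1 : Regs.Cfg.fst a = Regs.Cfg.fst b := funext fun i => congrFun hab (.inl i)
  have h2 : ((show ZMod 2 from a (.inr ())) + h (Regs.Cfg.fst a) : ZMod 2) =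
    (show ZMod 2 from b (.inr ())) + h (Regs.Cfg.fst b) := congrFun hab (.inr ())
  rw [h1] at h2
  funext i
  cases i with
  | inl i => exact congrFun h1 i
  | inr j => exact add_right_cancel (G := ZMod 2) h2

theorem on_meas (k : Fin 3) : on (n := n) Ty.cnt (q m) (meas m l k) =
    Matrix.diagonal fun a => if (![decide ((show Fin (2 ^ m) from a ()).val < l),
      decide ((show Fin (2 ^ m) from a ()).val = l),
      decide (l < (show Fin (2 ^ m) from a ()).val)] : Fin 3 → Bool) k then 1 else 0 := by
  exact Matrix.submatrix_diagonal _ _ (Regs.oneEquiv Ty.cnt (q m)).injective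

theorem sum_meas : ∑ k, (on (n := n) Ty.cnt (q m) (meas m l k))ᴴ *
    on (n := n) Ty.cnt (q m) (meas m l k) = 1 := by
  simp only [on_meas, Matrix.diagonal_conjTranspose, Matrix.diagonal_mul_diagonal]
  rw [← Matrix.diagonal_one, Fin.sum_univ_three]
  simp only [Matrix.diagonal_add]
  congr 1
  funext a
  rcases lt_trichotomy (show Fin (2 ^ m) from a ()).val l with h | h | h
  · simp [h, h.ne, h.not_gt]
  · simp [h]
  · simp [h, h.ne', h.not_gt]

/-! ### Hadamard operators -/

/-- The character of `ZMod 2`. -/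
def sgn (a : ZMod 2) : ℂ := if a = 0 then 1 else -1

theorem zmod_two_cases (a : ZMod 2) : a = 0 ∨ a = 1 := by
  revert a
  decide

theorem one_add_one_zmod_two : (1 + 1 : ZMod 2) = 0 := rfl

theorem sgn_add (a b : ZMod 2) : sgn (a + b) = sgn a * sgn b := by
  rcases zmod_two_cases a with rfl | rfl <;> rcases zmod_two_cases b with rfl | rfl <;>
    simp [sgn, one_add_one_zmod_two]

theorem sgn_zero : sgn 0 = 1 := if_pos rfl

theorem sum_zmod_two {α : Type*} [AddCommMonoid α] (f : ZMod 2 → α) : ∑ c, f c = f 0 + f 1 :=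
  Fin.sum_univ_two f

theorem sgn_mul_self (a : ZMod 2) : sgn a * sgn a = 1 := by
  unfold sgn
  split_ifs <;> simp

theorem sgn_sum {ι : Type*} (t : Finset ι) (f : ι → ZMod 2) :
    sgn (∑ i ∈ t, f i) = ∏ i ∈ t, sgn (f i) := by
  classical
  induction t using Finset.induction_on with
  | empty => simp [sgn]
  | insert a t ha ih => rw [Finset.sum_insert ha, Finset.prod_insert ha, sgn_add, ih]

/-- The amplitude `1 / √2`. -/
noncomputable def amp : ℂ := 1 / (Real.sqrt 2 : ℂ)

theorem amp_mul_self : amp * amp = 1 / 2 := by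
  unfold amp
  rw [div_mul_div_comm, one_mul, ← Complex.ofReal_mul, Real.mul_self_sqrt (by norm_num)]
  simp

theorem hadamard_apply (a b : ZMod 2) : hadamard a b = amp * sgn (a * b) := by
  rcases zmod_two_cases a with rfl | rfl <;> rcases zmod_two_cases b with rfl | rfl <;>
    simp [sgn, hadamard, amp]

theorem hadamard_mul_self : hadamard * hadamard = 1 := by
  ext a b
  have h : ∑ c, hadamard a c * hadamard c b = 1 / 2 * (1 + sgn a * sgn b) := by
    simp only [hadamard_apply]
    rw [← amp_mul_self]
    refine (sum_zmod_two _).trans ?_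
    simp only [mul_zero, zero_mul, mul_one, one_mul, sgn_zero]
    ring
  rw [Matrix.mul_apply, h]
  rcases zmod_two_cases a with rfl | rfl <;> rcases zmod_two_cases b with rfl | rfl <;>
    simp [sgn] <;> norm_num

theorem hadamard_conjTranspose : hadamardᴴ = hadamard := by
  ext a b
  rw [Matrix.conjTranspose_apply]
  rcases zmod_two_cases a with rfl | rfl <;> rcases zmod_two_cases b with rfl | rfl <;>
    simp [hadamard]

theorem hadamardPow_apply (x y : Fin n → ZMod 2) :
    hadamardPow n x y = amp ^ n * sgn (x ⬝ᵥ y) := by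
  simp [hadamardPow, hadamard_apply, Finset.prod_mul_distrib, dotProduct, sgn_sum]

theorem hadamardPow_mul_self : hadamardPow n * hadamardPow n = 1 := by
  ext x y
  simp only [Matrix.mul_apply, hadamardPow, Matrix.of_apply, ← Finset.prod_mul_distrib]
  rw [← Fintype.piFinset_univ, ← Finset.prod_univ_sum (fun _ => Finset.univ)
    (fun i z => hadamard (x i) z * hadamard z (y i))]
  have h (a b : ZMod 2) : ∑ z, hadamard a z * hadamard z b = if a = b then 1 else 0 := by
    rw [← Matrix.mul_apply, hadamard_mul_self, Matrix.one_apply]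
  simp only [h, Matrix.one_apply, funext_iff]
  rw [Finset.prod_ite_zero]
  simp

theorem hadamardPow_conjTranspose : (hadamardPow n)ᴴ = hadamardPow n := by
  ext x y
  simp only [Matrix.conjTranspose_apply, hadamardPow, Matrix.of_apply, star_prod]
  refine Finset.prod_congr rfl fun i _ => ?_
  exact congrFun (congrFun hadamard_conjTranspose (x i)) (y i)

theorem pauliX_conjTranspose : pauliXᴴ = pauliX := by
  ext a b
  rw [Matrix.conjTranspose_apply]
  rcases zmod_two_cases a with rfl | rfl <;> rcases zmod_two_cases b with rfl | rfl <;>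
    simp [pauliX, one_add_one_zmod_two]

theorem pauliX_mul_self : pauliX * pauliX = 1 := by
  have h : pauliX = permMatrix fun a => a + 1 := rfl
  have h' := (permMatrix_unitary (f := fun a : ZMod 2 => a + 1) (add_left_injective 1)).2
  rwa [← h, pauliX_conjTranspose] at h'

end Operators

/-! ## One level of the recursion on basis states -/

section Level

variable {n l m : ℕ}

/-- The qubit `Y'`. -/
def ixY' (l : ℕ) : Fin (l + 2) := ⟨1, by omega⟩

theorem ixY'_ne_zero : ixY' l ≠ 0 := by simp [ixY']

/-- Write `x` to `𝕏[q]` and `y` to `Y'`. -/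
def St.put (s : St n l m) (x : Fin n → ZMod 2) (y : ZMod 2) : St n l m :=
  { s with X := Function.update s.X s.q x, b := Function.update s.b (ixY' l) y }

/-- Add `z` to the qubit `j`. -/
def St.addBit (j : Fin (l + 2)) (z : ZMod 2) (s : St n l m) : St n l m :=
  { s with b := Function.update s.b j (s.b j + z) }

theorem St.put_put (s : St n l m) (x x' : Fin n → ZMod 2) (y y' : ZMod 2) :
    (s.put x y).put x' y' = s.put x' y' := by
  simp [St.put]

theorem St.put_X (s : St n l m) (x : Fin n → ZMod 2) (y : ZMod 2) :
    (s.put x y).X (s.put x y).q = x := by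
  simp [St.put]

theorem St.put_b (s : St n l m) (x : Fin n → ZMod 2) (y : ZMod 2) :
    (s.put x y).b (ixY' l) = y := by
  simp [St.put]

theorem St.addBit_put (s : St n l m) (x : Fin n → ZMod 2) (y z : ZMod 2) :
    St.addBit 0 z (s.put x y) = (St.addBit 0 z s).put x y := by
  ext : 1
  · rfl
  · rfl
  · rfl
  · simp only [St.addBit, St.put, Function.update_of_ne (ixY'_ne_zero).symm]
    exact Function.update_comm ixY'_ne_zero ..

theorem St.addBit_put' (s : St n l m) (x : Fin n → ZMod 2) (y z : ZMod 2) :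
    St.addBit (ixY' l) z (s.put x y) = s.put x (y + z) := by
  simp [St.addBit, St.put]

/-- The product state `|φ⟩|c⟩` of `𝕏[q]` and `Y'`, the other registers being as in `s`. -/
noncomputable def superpos (φ : (Fin n → ZMod 2) → ℂ) (c : ZMod 2 → ℂ) (s : St n l m) :
    St n l m → ℂ :=
  ∑ x, ∑ y, (φ x * c y) • Pi.single (s.put x y) 1

theorem superpos_single (v : Fin n → ZMod 2) (c : ZMod 2 → ℂ) (s : St n l m) :
    superpos (Pi.single v 1) c s = ∑ y, c y • Pi.single (s.put v y) 1 := by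
  unfold superpos
  rw [Finset.sum_eq_single v]
  · simp
  · intro x _ hx
    simp [hx]
  · simp

theorem superpos_zero (s : St n l m) (hX : s.X s.q = 0) (hb : s.b (ixY' l) = 0) :
    superpos (Pi.single 0 1) (Pi.single 0 1) s = Pi.single s 1 := by
  rw [superpos_single, Finset.sum_eq_single 0]
  · have h : s.put 0 0 = s := by
      ext : 1
      · rfl
      · rfl
      · exact Function.update_eq_self_iff.2 hX.symm
      · exact Function.update_eq_self_iff.2 hb.symm
    simp [h]
  · intro y _ hy
    simp [hy]
  · simp

/-- The contents of `𝕏[q]` and a qubit as a pair. -/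
def pairEquiv (j : ℕ) : ((Regs.one Ty.vec (Xq m)).app (Regs.one Ty.bit (.var j))).Cfg n ≃
    (Fin n → ZMod 2) × ZMod 2 :=
  (Regs.appEquiv _ _).trans
    (Equiv.prodCongr (Regs.oneEquiv Ty.vec (Xq m)) (Regs.oneEquiv Ty.bit (.var j)))

theorem lift_tens_mulVec_single (A : Matrix (Fin n → ZMod 2) (Fin n → ZMod 2) ℂ)
    (B : Matrix (ZMod 2) (ZMod 2) ℂ) (s : St n l m) :
    (lensXB (ixY' l)).lift (tens (on Ty.vec (Xq m) A) (on Ty.bit (Y' m) B)) *ᵥ Pi.single s 1 =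
      ∑ x, ∑ y, (A x (s.X s.q) * B y (s.b (ixY' l))) • Pi.single (s.put x y) 1 := by
  rw [Lens.lift_mulVec_single, ← Fintype.sum_prod_type']
  exact Fintype.sum_equiv (pairEquiv (ixY' l).val) _ _ fun a => rfl

theorem lift_tens_mulVec_superpos (A : Matrix (Fin n → ZMod 2) (Fin n → ZMod 2) ℂ)
    (B : Matrix (ZMod 2) (ZMod 2) ℂ) (φ : (Fin n → ZMod 2) → ℂ) (c : ZMod 2 → ℂ)
    (s : St n l m) :
    (lensXB (ixY' l)).lift (tens (on Ty.vec (Xq m) A) (on Ty.bit (Y' m) B)) *ᵥ superpos φ c s =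
      superpos (A *ᵥ φ) (B *ᵥ c) s := by
  conv_lhs => rw [superpos]
  simp only [Matrix.mulVec_sum, Matrix.mulVec_smul, lift_tens_mulVec_single, St.put_put,
    St.put_X, St.put_b]
  unfold superpos
  simp only [Finset.smul_sum, smul_smul, Matrix.mulVec, dotProduct, Finset.sum_mul_sum,
    Finset.sum_smul]
  simp only [← Fintype.sum_prod_type']
  refine Fintype.sum_equiv ⟨fun t => (t.2.2.1, t.2.2.2, t.1, t.2.1),
    fun t => (t.2.2.1, t.2.2.2, t.1, t.2.1), fun _ => rfl, fun _ => rfl⟩ _ _ fun t => ?_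
  simp only [Equiv.coe_fn_mk]
  congr 1
  ring

theorem lift_on_mulVec_single (A : Matrix (Fin n → ZMod 2) (Fin n → ZMod 2) ℂ) (s : St n l m) :
    lensX.lift (on Ty.vec (Xq m) A) *ᵥ Pi.single s 1 =
      ∑ x, A x (s.X s.q) • Pi.single { s with X := Function.update s.X s.q x } 1 := by
  rw [Lens.lift_mulVec_single]
  exact Fintype.sum_equiv (Regs.oneEquiv Ty.vec (Xq m)) _ _ fun a => rfl

theorem lift_on_mulVec_superpos (A : Matrix (Fin n → ZMod 2) (Fin n → ZMod 2) ℂ)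
    (φ : (Fin n → ZMod 2) → ℂ) (c : ZMod 2 → ℂ) (s : St n l m) :
    lensX.lift (on Ty.vec (Xq m) A) *ᵥ superpos φ c s = superpos (A *ᵥ φ) c s := by
  have h (x x' : Fin n → ZMod 2) (y : ZMod 2) : ({ s.put x y with
      X := Function.update (s.put x y).X (s.put x y).q x' } : St n l m) = s.put x' y := by
    simp [St.put]
  conv_lhs => rw [superpos]
  simp only [Matrix.mulVec_sum, Matrix.mulVec_smul, lift_on_mulVec_single, h, St.put_X]
  unfold superpos
  simp only [Finset.smul_sum, smul_smul, Matrix.mulVec, dotProduct, Finset.sum_mul,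
    Finset.sum_smul]
  conv_lhs => enter [2, x]; rw [Finset.sum_comm]
  rw [Finset.sum_comm]
  refine Finset.sum_congr rfl fun _ _ => ?_
  rw [Finset.sum_comm]
  refine Finset.sum_congr rfl fun _ _ => Finset.sum_congr rfl fun _ _ => ?_
  congr 1
  ring

theorem lift_oracle_mulVec_single (g : (Fin n → ZMod 2) → ZMod 2) (s : St n l m) :
    (lensXB 0).lift (oracle (Regs.one Ty.vec (Xq m)) (Y m) fun u => g (u ())) *ᵥ
      Pi.single s 1 = Pi.single (St.addBit 0 (g (s.X s.q)) s) 1 := by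
  rw [oracle_eq]
  refine ((lensXB 0).lift_permMatrix_mulVec _ s).trans ?_
  congr 1
  ext : 1
  · rfl
  · rfl
  · exact Function.update_eq_self ..
  · rfl

theorem lift_oracle_mulVec_superpos (g : (Fin n → ZMod 2) → ZMod 2) (v : Fin n → ZMod 2)
    (c : ZMod 2 → ℂ) (s : St n l m) :
    (lensXB 0).lift (oracle (Regs.one Ty.vec (Xq m)) (Y m) fun u => g (u ())) *ᵥ
      superpos (Pi.single v 1) c s = superpos (Pi.single v 1) c (St.addBit 0 (g v) s) := by
  simp only [superpos_single, Matrix.mulVec_sum, Matrix.mulVec_smul, lift_oracle_mulVec_single,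
    St.put_X, St.addBit_put]

/-- The path `𝕏[1], …, 𝕏[k]`. -/
def St.path (s : St n l m) (k : ℕ) : List (Fin n → ZMod 2) :=
  List.ofFn fun j : Fin k => s.X (Fin.ofNat (2 ^ m) (j.val + 1))

theorem St.path_congr {s s' : St n l m} {k : ℕ}
    (h : ∀ i : Fin (2 ^ m), i.val ≤ k → s.X i = s'.X i) (hk : k < 2 ^ m) :
    s.path k = s'.path k := by
  unfold St.path
  congr 1
  funext j
  refine h _ ?_
  rw [Fin.val_ofNat, Nat.mod_eq_of_lt (by omega)]
  omega

theorem St.path_put (s : St n l m) {k : ℕ} (hk : s.q.val = k + 1) (x : Fin n → ZMod 2)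
    (y : ZMod 2) : (s.put x y).path (k + 1) = s.path k ++ [x] := by
  have hq := s.q.isLt
  have h : (s.put x y).path k = s.path k := by
    refine St.path_congr (fun i hi => ?_) (by omega)
    refine Function.update_of_ne ?_ ..
    rintro rfl
    omega
  rw [← h]
  unfold St.path
  rw [List.ofFn_succ_last]
  congr 2
  have h1 : Fin.ofNat (2 ^ m) ((Fin.last k).val + 1) = s.q := by
    ext
    rw [Fin.val_ofNat, Fin.val_last, Nat.mod_eq_of_lt (by omega), hk]
  rw [h1]
  exact s.put_X x y

variable (g : (Fin n → ZMod 2) → ZMod 2) (sec : List (Fin n → ZMod 2) → (Fin n → ZMod 2))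

/-- The map `RQFS` computes at the level given by `q`, with output in the qubit `j`. -/
def St.query (j : Fin (l + 2)) (s : St n l m) : St n l m :=
  St.addBit j (g (sec (s.path s.q))) s

/-- The operator `St.query` restricted to levels in `T`. -/
def queryMatrix (T : Fin (2 ^ m) → Prop) [DecidablePred T] (j : Fin (l + 2)) :
    Matrix (St n l m) (St n l m) ℂ :=
  Matrix.of fun ρ s => if T s.q ∧ ρ = St.query g sec j s then 1 else 0

theorem queryMatrix_mulVec_single (T : Fin (2 ^ m) → Prop) [DecidablePred T] (j : Fin (l + 2))
    (s : St n l m) : queryMatrix g sec T j *ᵥ Pi.single s 1 =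
      if T s.q then Pi.single (St.query g sec j s) 1 else 0 := by
  ext ρ
  by_cases h : T s.q <;> simp [queryMatrix, h, Pi.single_apply]

/-- The Fourier basis of `𝕏[q]`. -/
noncomputable def fourier (v x : Fin n → ZMod 2) : ℂ := amp ^ n * sgn (v ⬝ᵥ x)

theorem hadamardPow_mulVec_single (v : Fin n → ZMod 2) :
    hadamardPow n *ᵥ Pi.single v 1 = fourier v := by
  ext x
  simp [hadamardPow_apply, fourier, dotProduct_comm]

theorem hadamardPow_mulVec_fourier (v : Fin n → ZMod 2) :
    hadamardPow n *ᵥ fourier v = Pi.single v 1 := by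
  rw [← hadamardPow_mulVec_single, Matrix.mulVec_mulVec, hadamardPow_mul_self, Matrix.one_mulVec]

/-- The state `|-⟩`. -/
noncomputable def minus (y : ZMod 2) : ℂ := amp * sgn y

theorem hadamard_pauliX_mulVec : (hadamard * pauliX) *ᵥ Pi.single 0 1 = minus := by
  ext y
  rw [Matrix.mulVec_single_one, Matrix.col_apply, Matrix.mul_apply, sum_zmod_two]
  simp [pauliX, hadamard_apply, minus]

theorem pauliX_hadamard_mulVec : (pauliX * hadamard) *ᵥ minus = Pi.single 0 1 := by
  rw [← hadamard_pauliX_mulVec, Matrix.mulVec_mulVec, Matrix.mul_assoc,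
    ← Matrix.mul_assoc hadamard, hadamard_mul_self, Matrix.one_mul, pauliX_mul_self,
    Matrix.one_mulVec]

theorem queryMatrix_mulVec_superpos (hs : ∀ (path : List (Fin n → ZMod 2)) (x : Fin n → ZMod 2),
      path.length < l → g (sec (path ++ [x])) = sec path ⬝ᵥ x)
    (T : Fin (2 ^ m) → Prop) [DecidablePred T] {s : St n l m} (hT : T s.q) {k : ℕ}
    (hk : s.q.val = k + 1) (hkl : k < l) (φ : (Fin n → ZMod 2) → ℂ) :
    queryMatrix g sec T (ixY' l) *ᵥ superpos φ minus s =
      superpos (fun x => φ x * sgn (sec (s.path k) ⬝ᵥ x)) minus s := by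
  have h (x : Fin n → ZMod 2) (y : ZMod 2) : St.query g sec (ixY' l) (s.put x y) =
      s.put x (y + sec (s.path k) ⬝ᵥ x) := by
    have h1 : (s.put x y).q.val = k + 1 := hk
    rw [St.query, St.addBit_put', h1, St.path_put s hk, hs _ _ (by simpa [St.path] using hkl)]
  have h2 (x : Fin n → ZMod 2) (y : ZMod 2) : T (s.put x y).q := hT
  conv_lhs => rw [superpos]
  simp only [Matrix.mulVec_sum, Matrix.mulVec_smul, queryMatrix_mulVec_single, h, h2, if_true]
  unfold superpos
  refine Finset.sum_congr rfl fun x _ => ?_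
  refine Fintype.sum_equiv (Equiv.addRight (sec (s.path k) ⬝ᵥ x)) _ _ fun y => ?_
  simp only [Equiv.coe_addRight, minus, sgn_add]
  congr 1
  linear_combination (-φ x * amp * sgn y) * sgn_mul_self (sec (s.path k) ⬝ᵥ x)

theorem fourier_mul_sgn (v x : Fin n → ZMod 2) : fourier 0 x * sgn (v ⬝ᵥ x) = fourier v x := by
  simp [fourier, sgn_zero]

theorem fourier_mul_sgn' (v x : Fin n → ZMod 2) : fourier v x * sgn (v ⬝ᵥ x) = fourier 0 x := by
  simp [fourier, sgn_zero, mul_assoc, sgn_mul_self]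

/-- Quantum Fourier sampling: the statements between initialization and the end of the block. -/
theorem level_mulVec (hs : ∀ (path : List (Fin n → ZMod 2)) (x : Fin n → ZMod 2),
      path.length < l → g (sec (path ++ [x])) = sec path ⬝ᵥ x)
    (T : Fin (2 ^ m) → Prop) [DecidablePred T] {s : St n l m} (hT : T s.q) {k : ℕ}
    (hk : s.q.val = k + 1) (hkl : k < l) (hX : s.X s.q = 0) (hb : s.b (ixY' l) = 0) :
    (lensXB (ixY' l)).lift (tens (on Ty.vec (Xq m) (hadamardPow n))
        (on Ty.bit (Y' m) (pauliX * hadamard))) *ᵥ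
      (queryMatrix g sec T (ixY' l) *ᵥ
      (lensX.lift (on Ty.vec (Xq m) (hadamardPow n)) *ᵥ
      ((lensXB 0).lift (oracle (Regs.one Ty.vec (Xq m)) (Y m) fun u => g (u ())) *ᵥ
      (lensX.lift (on Ty.vec (Xq m) (hadamardPow n)) *ᵥ
      (queryMatrix g sec T (ixY' l) *ᵥ
      ((lensXB (ixY' l)).lift (tens (on Ty.vec (Xq m) (hadamardPow n))
        (on Ty.bit (Y' m) (hadamard * pauliX))) *ᵥ Pi.single s 1)))))) =
    Pi.single (St.addBit 0 (g (sec (s.path k))) s) 1 := by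
  have hT' : T (St.addBit 0 (g (sec (s.path k))) s).q := hT
  have hk' : (St.addBit 0 (g (sec (s.path k))) s).q.val = k + 1 := hk
  have hpath : (St.addBit 0 (g (sec (s.path k))) s).path k = s.path k := rfl
  rw [← superpos_zero s hX hb, lift_tens_mulVec_superpos, hadamardPow_mulVec_single,
    hadamard_pauliX_mulVec, queryMatrix_mulVec_superpos g sec hs T hT hk hkl]
  simp only [fourier_mul_sgn]
  rw [lift_on_mulVec_superpos, hadamardPow_mulVec_fourier, lift_oracle_mulVec_superpos,
    lift_on_mulVec_superpos, hadamardPow_mulVec_single,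
    queryMatrix_mulVec_superpos g sec hs T hT' hk' hkl, hpath]
  simp only [fourier_mul_sgn']
  rw [lift_tens_mulVec_superpos, hadamardPow_mulVec_fourier, pauliX_hadamard_mulVec, superpos_zero]
  · exact hX
  · simp [St.addBit, Function.update_of_ne ixY'_ne_zero, hb]

end Level

/-! ## The assertions -/

section LevelAssertions

variable {n l m : ℕ}

open Classical in
/-- Keep, at level `q`, the array components `𝕏[0], …, 𝕏[q]` and the qubits in `κ q`; the other
registers are set to zero. -/
noncomputable def St.keep (κ : Fin (2 ^ m) → Fin (l + 2) → Prop) (s : St n l m) : St n l m where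
  p := s.p
  q := s.q
  X := fun i => if i ≤ s.q then s.X i else 0
  b := fun j => if κ s.q j then s.b j else 0

open Classical in
/-- The level and the registers that are not kept by `St.keep`. -/
noncomputable def St.drop (κ : Fin (2 ^ m) → Fin (l + 2) → Prop) (s : St n l m) : St n l m where
  p := 0
  q := s.q
  X := fun i => if i ≤ s.q then 0 else s.X i
  b := fun j => if κ s.q j then 0 else s.b j

theorem St.drop_eq_iff (κ : Fin (2 ^ m) → Fin (l + 2) → Prop) (s s' : St n l m) :
    s.drop κ = s'.drop κ ↔ s.q = s'.q ∧ (∀ i, ¬i ≤ s.q → s.X i = s'.X i) ∧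
      ∀ j, ¬κ s.q j → s.b j = s'.b j := by
  rw [St.ext_iff]
  constructor
  · rintro ⟨-, hq, hX, hb⟩
    change s.q = s'.q at hq
    refine ⟨hq, fun i hi => ?_, fun j hj => ?_⟩
    · have h := congrFun hX i
      simpa only [St.drop, if_neg hi, if_neg (hq ▸ hi)] using h
    · have h := congrFun hb j
      simpa only [St.drop, if_neg hj, if_neg (hq ▸ hj)] using h
  · rintro ⟨hq, hX, hb⟩
    refine ⟨rfl, hq, funext fun i => ?_, funext fun j => ?_⟩
    · by_cases hi : i ≤ s.q
      · simp only [St.drop, if_pos hi, if_pos (hq ▸ hi)]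
      · simp only [St.drop, if_neg hi, if_neg (hq ▸ hi), hX i hi]
    · by_cases hj : κ s.q j
      · simp only [St.drop, if_pos hj, if_pos (hq ▸ hj)]
      · simp only [St.drop, if_neg hj, if_neg (hq ▸ hj), hb j hj]

theorem St.keep_eq_iff (κ : Fin (2 ^ m) → Fin (l + 2) → Prop) (s s' : St n l m) :
    s.keep κ = s'.keep κ ↔ s.p = s'.p ∧ s.q = s'.q ∧ (∀ i, i ≤ s.q → s.X i = s'.X i) ∧
      ∀ j, κ s.q j → s.b j = s'.b j := by
  rw [St.ext_iff]
  constructor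
  · rintro ⟨hp, hq, hX, hb⟩
    change s.q = s'.q at hq
    refine ⟨hp, hq, fun i hi => ?_, fun j hj => ?_⟩
    · have h := congrFun hX i
      simpa only [St.keep, if_pos hi, if_pos (hq ▸ hi)] using h
    · have h := congrFun hb j
      simpa only [St.keep, if_pos hj, if_pos (hq ▸ hj)] using h
  · rintro ⟨hp, hq, hX, hb⟩
    refine ⟨hp, hq, funext fun i => ?_, funext fun j => ?_⟩
    · by_cases hi : i ≤ s.q
      · simp only [St.keep, if_pos hi, if_pos (hq ▸ hi), hX i hi]
      · simp only [St.keep, if_neg hi, if_neg (hq ▸ hi)]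
    · by_cases hj : κ s.q j
      · simp only [St.keep, if_pos hj, if_pos (hq ▸ hj), hb j hj]
      · simp only [St.keep, if_neg hj, if_neg (hq ▸ hj)]

theorem St.keep_drop_injective (κ : Fin (2 ^ m) → Fin (l + 2) → Prop) {s s' : St n l m}
    (h : s.drop κ = s'.drop κ) (h' : s.keep κ = s'.keep κ) : s = s' := by
  obtain ⟨hq, hX, hb⟩ := (St.drop_eq_iff κ s s').1 h
  obtain ⟨hp, -, hX', hb'⟩ := (St.keep_eq_iff κ s s').1 h'
  ext : 1
  · exact hp
  · exact hq
  · exact funext fun i => (em (i ≤ s.q)).elim (hX' i) (hX i)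
  · exact funext fun j => (em (κ s.q j)).elim (hb' j) (hb j)

/-- The operation that forgets the registers that are not kept, in a basis. -/
noncomputable def forget (κ : Fin (2 ^ m) → Fin (l + 2) → Prop) : Kraus (St n l m) :=
  Kraus.basisMap (fun _ => True) (St.keep κ) (St.drop κ)

theorem isQOp_forget (κ : Fin (2 ^ m) → Fin (l + 2) → Prop) :
    (forget (n := n) κ).IsQOp :=
  Kraus.isQOp_basisMap _ _ _ fun _ _ _ _ h h' => St.keep_drop_injective κ h h'

theorem forget_dual_of {κ : Fin (2 ^ m) → Fin (l + 2) → Prop} (A : Matrix (St n l m) (St n l m) ℂ)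
    {s s' : St n l m} (h : s.drop κ = s'.drop κ) :
    (forget κ).dual A s s' = A (s.keep κ) (s'.keep κ) :=
  Kraus.dual_basisMap_of A trivial trivial h

theorem forget_dual_of_ne {κ : Fin (2 ^ m) → Fin (l + 2) → Prop}
    (A : Matrix (St n l m) (St n l m) ℂ) {s s' : St n l m} (h : s.drop κ ≠ s'.drop κ) :
    (forget κ).dual A s s' = 0 :=
  Kraus.dual_basisMap_of_not A fun h1 => h h1.2.2

theorem St.q_eq_of_drop_eq {κ : Fin (2 ^ m) → Fin (l + 2) → Prop} {s s' : St n l m}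
    (h : s.drop κ = s'.drop κ) : s.q = s'.q :=
  ((St.drop_eq_iff κ s s').1 h).1

/-- The Kraus operators of `forget`. -/
noncomputable def forgetOp (κ : Fin (2 ^ m) → Fin (l + 2) → Prop) (c : St n l m) :
    Matrix (St n l m) (St n l m) ℂ :=
  (forget κ).op c

open Classical in
theorem forgetOp_mulVec (κ : Fin (2 ^ m) → Fin (l + 2) → Prop) (c s : St n l m) :
    forgetOp κ c *ᵥ Pi.single s 1 = if s.drop κ = c then Pi.single (s.keep κ) 1 else 0 := by
  ext ρ
  by_cases h : s.drop κ = c <;> simp [forgetOp, forget, Kraus.basisMap, h, Pi.single_apply]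

theorem forget_dual_eq_sum (κ : Fin (2 ^ m) → Fin (l + 2) → Prop)
    (A : Matrix (St n l m) (St n l m) ℂ) :
    (forget κ).dual A = ∑ c, (forgetOp κ c)ᴴ * A * forgetOp κ c := rfl

theorem conj_apply {α : Type*} [Fintype α] [DecidableEq α] (N B : Matrix α α ℂ) (s s' : α) :
    (Nᴴ * B * N) s s' = star (N *ᵥ Pi.single s 1) ⬝ᵥ (B *ᵥ (N *ᵥ Pi.single s' 1)) := by
  simp only [Matrix.mul_assoc, Matrix.mulVec_mulVec]
  rw [Matrix.mul_apply]
  simp [dotProduct, Matrix.conjTranspose_apply]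

theorem conj_apply_of_single {α : Type*} [Fintype α] [DecidableEq α] {N : Matrix α α ℂ}
    (B : Matrix α α ℂ) {s s' t t' : α} (h : N *ᵥ Pi.single s 1 = Pi.single t 1)
    (h' : N *ᵥ Pi.single s' 1 = Pi.single t' 1) : (Nᴴ * B * N) s s' = B t t' := by
  rw [conj_apply, h, h']
  simp

theorem matrix_ext_mulVec {α : Type*} [Fintype α] [DecidableEq α] {A B : Matrix α α ℂ}
    (h : ∀ s, A *ᵥ Pi.single s 1 = B *ᵥ Pi.single s 1) : A = B := by
  ext i j
  simpa using congrFun (h j) i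

/-- Forgetting commutes with operators on kept registers. -/
def CommForget (κ : Fin (2 ^ m) → Fin (l + 2) → Prop) (N : Matrix (St n l m) (St n l m) ℂ) : Prop :=
  ∀ c, forgetOp κ c * N = N * forgetOp κ c

theorem CommForget.dual_conj {κ : Fin (2 ^ m) → Fin (l + 2) → Prop}
    {N B : Matrix (St n l m) (St n l m) ℂ} (h : CommForget κ N) (hB : (forget κ).dual B = B) :
    (forget κ).dual (Nᴴ * B * N) = Nᴴ * B * N := by
  conv_rhs => rw [← hB]
  rw [forget_dual_eq_sum, forget_dual_eq_sum, Finset.mul_sum, Finset.sum_mul]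
  refine Finset.sum_congr rfl fun c _ => ?_
  have h1 : (forgetOp κ c)ᴴ * Nᴴ = Nᴴ * (forgetOp κ c)ᴴ := by
    rw [← Matrix.conjTranspose_mul, ← Matrix.conjTranspose_mul, h c]
  calc (forgetOp κ c)ᴴ * (Nᴴ * B * N) * forgetOp κ c
      = ((forgetOp κ c)ᴴ * Nᴴ) * B * (N * forgetOp κ c) := by
        simp only [Matrix.mul_assoc]
    _ = _ := by
        rw [h1, ← h c]
        simp only [Matrix.mul_assoc]

theorem commForget_lift {κ : Fin (2 ^ m) → Fin (l + 2) → Prop} {r : Regs m} (L : Lens n l m r)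
    (hd : ∀ s a, (L.set s a).drop κ = s.drop κ)
    (hk : ∀ s a, (L.set s a).keep κ = L.set (s.keep κ) a) (hg : ∀ s, L.get (s.keep κ) = L.get s)
    (A : Matrix (r.Cfg n) (r.Cfg n) ℂ) : CommForget κ (L.lift A) := by
  intro c
  refine matrix_ext_mulVec fun s => ?_
  rw [← Matrix.mulVec_mulVec, ← Matrix.mulVec_mulVec, L.lift_mulVec_single, Matrix.mulVec_sum]
  simp only [Matrix.mulVec_smul]
  simp only [forgetOp_mulVec, hd, hk]
  by_cases h1 : s.drop κ = c
  · simp [h1, L.lift_mulVec_single, hg]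
  · simp [h1]

theorem St.keep_update_X (κ : Fin (2 ^ m) → Fin (l + 2) → Prop) (s : St n l m)
    (x : Fin n → ZMod 2) :
    St.keep κ { s with X := Function.update s.X s.q x } =
      { s.keep κ with X := Function.update (s.keep κ).X (s.keep κ).q x } := by
  ext : 1
  · rfl
  · rfl
  · funext i
    by_cases h : i = s.q
    · subst h
      simp [St.keep]
    · simp [St.keep, h]
  · rfl

theorem St.drop_update_X (κ : Fin (2 ^ m) → Fin (l + 2) → Prop) (s : St n l m)
    (x : Fin n → ZMod 2) :
    St.drop κ { s with X := Function.update s.X s.q x } = s.drop κ := by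
  ext : 1
  · rfl
  · rfl
  · funext i
    by_cases h : i = s.q
    · subst h
      simp [St.drop]
    · simp [St.drop, h]
  · rfl

theorem St.keep_update_b {κ : Fin (2 ^ m) → Fin (l + 2) → Prop} {j : Fin (l + 2)} (s : St n l m)
    (hj : κ s.q j) (y : ZMod 2) : St.keep κ { s with b := Function.update s.b j y } =
      { s.keep κ with b := Function.update (s.keep κ).b j y } := by
  ext : 1
  · rfl
  · rfl
  · rfl
  · funext i
    by_cases h : i = j
    · subst h
      simp [St.keep, hj]
    · simp [St.keep, h]

theorem St.drop_update_b {κ : Fin (2 ^ m) → Fin (l + 2) → Prop} {j : Fin (l + 2)} (s : St n l m)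
    (hj : κ s.q j) (y : ZMod 2) :
    St.drop κ { s with b := Function.update s.b j y } = s.drop κ := by
  ext : 1
  · rfl
  · rfl
  · rfl
  · funext i
    by_cases h : i = j
    · subst h
      simp [St.drop, hj]
    · simp [St.drop, h]

theorem commForget_lensX (κ : Fin (2 ^ m) → Fin (l + 2) → Prop)
    (A : Matrix ((Regs.one Ty.vec (Xq m)).Cfg n) ((Regs.one Ty.vec (Xq m)).Cfg n) ℂ) :
    CommForget κ ((lensX (l := l)).lift A) :=
  commForget_lift lensX (fun s a => St.drop_update_X κ s (a ()))
    (fun s a => St.keep_update_X κ s (a ())) (fun s => by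
      funext i
      exact if_pos le_rfl) A

theorem commForget_lensXB {κ : Fin (2 ^ m) → Fin (l + 2) → Prop} {j : Fin (l + 2)}
    (hj : ∀ k, κ k j) (A : Matrix (((Regs.one Ty.vec (Xq m)).app (Regs.one Ty.bit (.var j.val))).Cfg n)
      (((Regs.one Ty.vec (Xq m)).app (Regs.one Ty.bit (.var j.val))).Cfg n) ℂ) :
    CommForget κ ((lensXB j).lift A) := by
  refine commForget_lift (lensXB j) (fun s a => ?_) (fun s a => ?_) (fun s => ?_) A
  · refine (St.drop_update_X κ ((lensB j).set s (Regs.Cfg.snd a)) _).trans ?_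
    exact St.drop_update_b s (hj _) _
  · refine (St.keep_update_X κ ((lensB j).set s (Regs.Cfg.snd a)) _).trans ?_
    have h := St.keep_update_b s (hj s.q) (Regs.Cfg.snd a ())
    change ({ St.keep κ { s with b := Function.update s.b j (Regs.Cfg.snd a ()) } with
      X := _ } : St n l m) = _
    rw [h]
    rfl
  · funext i
    cases i with
    | inl _ => exact if_pos le_rfl
    | inr _ => exact if_pos (hj _)

variable (g : (Fin n → ZMod 2) → ZMod 2) (sec : List (Fin n → ZMod 2) → (Fin n → ZMod 2))

theorem St.path_keep (κ : Fin (2 ^ m) → Fin (l + 2) → Prop) (s : St n l m) {k : ℕ}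
    (hk : k ≤ s.q.val) : (s.keep κ).path k = s.path k :=
  St.path_congr (fun _ hi => if_pos (Fin.le_def.2 (hi.trans hk))) (hk.trans_lt s.q.isLt)

theorem St.keep_addBit {κ : Fin (2 ^ m) → Fin (l + 2) → Prop} {j : Fin (l + 2)} (s : St n l m)
    (hj : κ s.q j) (z : ZMod 2) : (St.addBit j z s).keep κ = St.addBit j z (s.keep κ) := by
  refine (St.keep_update_b s hj _).trans ?_
  simp [St.addBit, St.keep, hj]

theorem St.keep_query {κ : Fin (2 ^ m) → Fin (l + 2) → Prop} {j : Fin (l + 2)} (s : St n l m)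
    (hj : κ s.q j) : (St.query g sec j s).keep κ = St.query g sec j (s.keep κ) := by
  unfold St.query
  rw [St.keep_addBit s hj]
  congr 3
  exact (St.path_keep κ s le_rfl).symm

theorem St.drop_query {κ : Fin (2 ^ m) → Fin (l + 2) → Prop} {j : Fin (l + 2)} (s : St n l m)
    (hj : κ s.q j) : (St.query g sec j s).drop κ = s.drop κ :=
  St.drop_update_b s hj _

theorem commForget_queryMatrix {κ : Fin (2 ^ m) → Fin (l + 2) → Prop} {j : Fin (l + 2)}
    (hj : ∀ k, κ k j) (T : Fin (2 ^ m) → Prop) [DecidablePred T] :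
    CommForget κ (queryMatrix g sec T j) := by
  intro c
  refine matrix_ext_mulVec fun s => ?_
  have hT : T (s.keep κ).q = T s.q := rfl
  rw [← Matrix.mulVec_mulVec, ← Matrix.mulVec_mulVec, queryMatrix_mulVec_single,
    forgetOp_mulVec]
  by_cases h2 : T s.q
  · by_cases h3 : s.drop κ = c
    · rw [if_pos h2, if_pos h3, forgetOp_mulVec, St.drop_query g sec s (hj _), if_pos h3,
        queryMatrix_mulVec_single, if_pos (hT ▸ h2), St.keep_query g sec s (hj _)]
    · rw [if_pos h2, if_neg h3, forgetOp_mulVec, St.drop_query g sec s (hj _), if_neg h3,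
        Matrix.mulVec_zero]
  · rw [if_neg h2, Matrix.mulVec_zero]
    by_cases h3 : s.drop κ = c
    · rw [if_pos h3, queryMatrix_mulVec_single, if_neg (hT ▸ h2)]
    · rw [if_neg h3, Matrix.mulVec_zero]

end LevelAssertions

/-! ## Calls of the procedure -/

section Calls

variable {n l m : ℕ}

/-- The qubits on which the assertions depend at level `k`: `Y`, and `k + 1` further ones that
hold the qubits of the calling instances of the procedure. -/
def kept (l : ℕ) {m : ℕ} (k : Fin (2 ^ m)) (j : Fin (l + 2)) : Prop :=
  j = 0 ∨ l + 1 ≤ j.val + k.val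

/-- The rotation of `kept`. -/
def keptRot (l : ℕ) {m : ℕ} (k : Fin (2 ^ m)) (j : Fin (l + 2)) : Prop :=
  kept l k ((finRotate (l + 2)).symm j)

theorem finRotate_symm_zero : ((finRotate (l + 2)).symm 0) = Fin.last (l + 1) := by
  rw [Equiv.symm_apply_eq, finRotate_last]

theorem finRotate_zero : finRotate (l + 2) 0 = ixY' l := by
  ext
  simp [ixY']

theorem finRotate_symm_val {j : Fin (l + 2)} (hj : j ≠ 0) :
    ((finRotate (l + 2)).symm j).val + 1 = j.val := by
  obtain ⟨i, rfl⟩ := (finRotate (l + 2)).surjective j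
  rw [Equiv.symm_apply_apply]
  rw [coe_finRotate_of_ne_last]
  rintro rfl
  exact hj finRotate_last

theorem keptRot_zero (k : Fin (2 ^ m)) : keptRot l k 0 := by
  unfold keptRot
  rw [finRotate_symm_zero]
  exact .inr (Nat.le_add_right _ _)

theorem keptRot_ixY' (k : Fin (2 ^ m)) : keptRot l k (ixY' l) := by
  unfold keptRot
  rw [← finRotate_zero, Equiv.symm_apply_apply]
  exact .inl rfl

theorem keptRot_of_kept {k k' : Fin (2 ^ m)} (hk : k'.val = k.val + 1) {j : Fin (l + 2)}
    (h : kept l k j) : keptRot l k' j := by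
  by_cases hj : j = 0
  · exact hj ▸ keptRot_zero k'
  · have h1 := finRotate_symm_val hj
    rcases h with h | h
    · exact absurd h hj
    · exact .inr (by omega)

theorem not_kept_ixY' {k : Fin (2 ^ m)} (hk : k.val < l) : ¬kept l k (ixY' l) := by
  rintro (h | h)
  · exact ixY'_ne_zero h
  · simp only [ixY'] at h
    omega

/-- The cyclic renaming of the qubits. -/
def rot (l : ℕ) : Ren
  | .bit => (finRotate (l + 2)).extendDomain Fin.equivSubtype
  | _ => 1

theorem rot_val (j : Fin (l + 2)) : rot l Ty.bit j.val = (finRotate (l + 2) j).val :=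
  Equiv.Perm.extendDomain_apply_image (finRotate (l + 2)) Fin.equivSubtype j

theorem rot_of_le {k : ℕ} (hk : ¬k < l + 2) : rot l Ty.bit k = k :=
  Equiv.Perm.extendDomain_apply_not_subtype (finRotate (l + 2)) Fin.equivSubtype hk

/-- The effect of `rot`. -/
def cyc : St n l m ≃ St n l m where
  toFun s := { s with b := fun j => s.b (finRotate (l + 2) j) }
  invFun s := { s with b := fun j => s.b ((finRotate (l + 2)).symm j) }
  left_inv s := by simp
  right_inv s := by simp

theorem rot_actsBy : (rot l).ActsBy (cyc (n := n) (l := l) (m := m)) where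
  mem_vars x := by
    obtain ⟨τ, k | ⟨a, i⟩⟩ := x
    · cases τ with
      | bit =>
        by_cases hk : k < l + 2
        · have h1 : (Ty.bit, QName.var k) ∈ vars l m :=
            mem_vars.2 (.inr (.inr (.inr ⟨⟨k, hk⟩, rfl⟩)))
          have h2 : QVar.ren (rot l) (Ty.bit, QName.var k) ∈ vars l m :=
            mem_vars.2 (.inr (.inr (.inr ⟨finRotate (l + 2) ⟨k, hk⟩, by
              simp only [QVar.ren, QName.ren]
              rw [← rot_val]⟩)))
          exact iff_of_true h2 h1
        · have h1 : QVar.ren (m := m) (rot l) (Ty.bit, QName.var k) = (Ty.bit, QName.var k) := by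
            simp only [QVar.ren, QName.ren]
            rw [rot_of_le hk]
          rw [h1]
      | cnt => rfl
      | vec => rfl
    · rfl
  surj x hx := by
    obtain ⟨τ, k | ⟨a, i⟩⟩ := x
    · cases τ with
      | bit =>
        by_cases hk : k < l + 2
        · exact absurd (mem_vars.2 (.inr (.inr (.inr ⟨⟨k, hk⟩, rfl⟩)))) hx
        · refine ⟨_, hx, ?_⟩
          simp only [QVar.ren, QName.ren]
          rw [rot_of_le hk]
      | cnt => exact ⟨_, hx, rfl⟩
      | vec => exact ⟨_, hx, rfl⟩
    · exact ⟨_, hx, rfl⟩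
  read_pull σ := by
    ext : 1
    · rfl
    · rfl
    · rfl
    · funext j
      exact congrArg (fun k => σ (Ty.bit, QName.var k)) (rot_val j)

theorem cyc_symm_keep (s : St n l m) : cyc.symm ((cyc s).keep (kept l)) = s.keep (keptRot l) := by
  ext : 1
  · rfl
  · rfl
  · rfl
  · funext j
    simp only [cyc, St.keep, keptRot, Equiv.coe_fn_mk, Equiv.coe_fn_symm_mk,
      Equiv.apply_symm_apply]
    congr

theorem drop_cyc_iff (s s' : St n l m) :
    (cyc s).drop (kept l) = (cyc s').drop (kept l) ↔ s.drop (keptRot l) = s'.drop (keptRot l) := by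
  rw [St.drop_eq_iff, St.drop_eq_iff]
  refine and_congr_right fun _ => and_congr_right fun _ => ?_
  rw [← (finRotate (l + 2)).forall_congr_right (q := fun j => ¬keptRot l s.q j → s.b j = s'.b j)]
  simp only [cyc, keptRot, Equiv.coe_fn_mk, Equiv.symm_apply_apply]

theorem forget_cyc (A : Matrix (St n l m) (St n l m) ℂ) :
    ((forget (kept l)).dual (A.submatrix cyc.symm cyc.symm)).submatrix cyc cyc =
      (forget (keptRot l)).dual A := by
  ext s s'
  rw [Matrix.submatrix_apply]
  by_cases h : s.drop (keptRot l) = s'.drop (keptRot l)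
  · rw [forget_dual_of _ h, forget_dual_of _ ((drop_cyc_iff s s').2 h), Matrix.submatrix_apply,
      cyc_symm_keep, cyc_symm_keep]
  · rw [forget_dual_of_ne _ h, forget_dual_of_ne _ (mt (drop_cyc_iff s s').1 h)]

variable (g : (Fin n → ZMod 2) → ZMod 2) (sec : List (Fin n → ZMod 2) → (Fin n → ZMod 2))

/-- Run the procedure at the levels in `T`, then forget. -/
noncomputable def runForget (T : Fin (2 ^ m) → Prop) : Kraus (St n l m) :=
  Kraus.basisMap (fun s => T s.q) (fun s => (St.query g sec 0 s).keep (kept l))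
    (St.drop (kept l))

/-- Run the procedure at the levels in `T`. -/
noncomputable def run (T : Fin (2 ^ m) → Prop) : Kraus (St n l m) :=
  Kraus.basisMap (fun s => T s.q) (St.query g sec 0) St.q

theorem St.addBit_injective {j : Fin (l + 2)} {z : ZMod 2} :
    Function.Injective (St.addBit (n := n) (m := m) j z) := by
  intro s s' h
  obtain ⟨hp, hq, hX, hb⟩ := St.ext_iff.1 h
  refine St.ext hp hq hX (funext fun i => ?_)
  have h1 := congrFun hb i
  by_cases hi : i = j
  · subst hi
    simpa [St.addBit] using h1
  · simpa [St.addBit, hi] using h1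

theorem St.query_injective (j : Fin (l + 2)) :
    Function.Injective (St.query (l := l) (m := m) g sec j) := by
  intro s s' h
  obtain ⟨-, hq, hX, -⟩ := St.ext_iff.1 h
  change s.q = s'.q at hq
  change s.X = s'.X at hX
  have hp : s.path s.q = s'.path s'.q := by
    unfold St.path
    rw [hq, hX]
  unfold St.query at h
  rw [hp] at h
  exact St.addBit_injective h

theorem isQOp_run (T : Fin (2 ^ m) → Prop) : (run (l := l) g sec T).IsQOp :=
  Kraus.isQOp_basisMap _ _ _ fun _ _ _ _ _ h => St.query_injective g sec 0 h

theorem isQOp_runForget (T : Fin (2 ^ m) → Prop) : (runForget (l := l) g sec T).IsQOp :=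
  Kraus.isQOp_basisMap _ _ _ fun s s' _ _ h h' => by
    refine St.query_injective g sec 0 (St.keep_drop_injective (kept l) ?_ h')
    rw [St.drop_query g sec s (.inl rfl), St.drop_query g sec s' (.inl rfl), h]

variable {g sec} in
theorem run_dual_of {T : Fin (2 ^ m) → Prop} (A : Matrix (St n l m) (St n l m) ℂ)
    {s s' : St n l m} (h : T s.q) (h' : T s'.q) (hq : s.q = s'.q) :
    (run g sec T).dual A s s' = A (St.query g sec 0 s) (St.query g sec 0 s') :=
  Kraus.dual_basisMap_of (T := fun s : St n l m => T s.q) A h h' hq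

variable {g sec} in
theorem run_dual_of_not {T : Fin (2 ^ m) → Prop} (A : Matrix (St n l m) (St n l m) ℂ)
    {s s' : St n l m} (h : ¬(T s.q ∧ T s'.q ∧ s.q = s'.q)) : (run g sec T).dual A s s' = 0 :=
  Kraus.dual_basisMap_of_not (T := fun s : St n l m => T s.q) A h

variable {g sec} in
theorem runForget_dual_of {T : Fin (2 ^ m) → Prop} (A : Matrix (St n l m) (St n l m) ℂ)
    {s s' : St n l m} (h : T s.q) (h' : T s'.q) (hd : s.drop (kept l) = s'.drop (kept l)) :
    (runForget g sec T).dual A s s' =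
      A ((St.query g sec 0 s).keep (kept l)) ((St.query g sec 0 s').keep (kept l)) :=
  Kraus.dual_basisMap_of (T := fun s : St n l m => T s.q) A h h' hd

variable {g sec} in
theorem runForget_dual_of_not {T : Fin (2 ^ m) → Prop} (A : Matrix (St n l m) (St n l m) ℂ)
    {s s' : St n l m} (h : ¬(T s.q ∧ T s'.q ∧ s.drop (kept l) = s'.drop (kept l))) :
    (runForget g sec T).dual A s s' = 0 :=
  Kraus.dual_basisMap_of_not (T := fun s : St n l m => T s.q) A h

theorem run_dual_forget_dual (T : Fin (2 ^ m) → Prop) (A : Matrix (St n l m) (St n l m) ℂ) :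
    (run g sec T).dual ((forget (kept l)).dual A) = (runForget g sec T).dual A := by
  have hd (s : St n l m) := St.drop_query g sec (κ := kept l) (j := 0) s (.inl rfl)
  ext s s'
  by_cases h : T s.q ∧ T s'.q ∧ s.drop (kept l) = s'.drop (kept l)
  · rw [runForget_dual_of A h.1 h.2.1 h.2.2,
      run_dual_of _ h.1 h.2.1 (St.q_eq_of_drop_eq h.2.2), forget_dual_of]
    rw [hd, hd, h.2.2]
  · rw [runForget_dual_of_not A h]
    by_cases h1 : T s.q ∧ T s'.q ∧ s.q = s'.q
    · rw [run_dual_of _ h1.1 h1.2.1 h1.2.2]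
      refine forget_dual_of_ne _ fun h2 => ?_
      rw [hd, hd] at h2
      exact h ⟨h1.1, h1.2.1, h2⟩
    · exact run_dual_of_not _ h1

theorem Kraus.dual_basisMap_sub {b Ω : Type} [Fintype b] [Fintype Ω] {T T' : b → Prop}
    {f : b → b} {r : b → Ω} (hT : ∀ s, T' s → T s) (hr : ∀ s s', r s = r s' → (T' s ↔ T' s'))
    (A : Matrix b b ℂ) : (Kraus.basisMap T f r).dual A - (Kraus.basisMap T' f r).dual A =
      (Kraus.basisMap (fun s => T s ∧ ¬T' s) f r).dual A := by
  ext s s'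
  rw [Matrix.sub_apply]
  by_cases h1 : T s ∧ T s' ∧ r s = r s'
  · rw [Kraus.dual_basisMap_of A h1.1 h1.2.1 h1.2.2]
    by_cases h2 : T' s
    · rw [Kraus.dual_basisMap_of A h2 ((hr s s' h1.2.2).1 h2) h1.2.2,
        Kraus.dual_basisMap_of_not A fun h3 => h3.1.2 h2, sub_self]
    · rw [Kraus.dual_basisMap_of_not A fun h3 => h2 h3.1,
        Kraus.dual_basisMap_of (T := fun s => T s ∧ ¬T' s) A ⟨h1.1, h2⟩
          ⟨h1.2.1, mt (hr s s' h1.2.2).2 h2⟩ h1.2.2, sub_zero]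
  · rw [Kraus.dual_basisMap_of_not A h1,
      Kraus.dual_basisMap_of_not A fun h2 => h1 ⟨hT s h2.1, hT s' h2.2.1, h2.2.2⟩,
      Kraus.dual_basisMap_of_not A fun h2 => h1 ⟨h2.1.1, h2.2.1.1, h2.2.2⟩, sub_zero]

theorem Kraus.basisMap_mono {b Ω : Type} [Fintype b] [Fintype Ω] {T T' : b → Prop} {f : b → b}
    {r : b → Ω} (hT : ∀ s, T' s → T s) (hr : ∀ s s', r s = r s' → (T' s ↔ T' s'))
    {A : Matrix b b ℂ} (hA : A.PosSemidef) :
    ((Kraus.basisMap T f r).dual A - (Kraus.basisMap T' f r).dual A).PosSemidef := by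
  rw [Kraus.dual_basisMap_sub hT hr]
  exact Kraus.dual_posSemidef _ hA

theorem queryMatrix_conj_apply {B : Matrix (St n l m) (St n l m) ℂ} (T : Fin (2 ^ m) → Prop)
    [DecidablePred T] (j : Fin (l + 2)) (s s' : St n l m) :
    ((queryMatrix g sec T j)ᴴ * B * queryMatrix g sec T j) s s' =
      if T s.q ∧ T s'.q then B (St.query g sec j s) (St.query g sec j s') else 0 := by
  by_cases h : T s.q ∧ T s'.q
  · rw [if_pos h]
    refine conj_apply_of_single _ ?_ ?_
    · rw [queryMatrix_mulVec_single, if_pos h.1]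
    · rw [queryMatrix_mulVec_single, if_pos h.2]
  · rw [if_neg h, conj_apply, queryMatrix_mulVec_single, queryMatrix_mulVec_single]
    by_cases h1 : T s.q
    · rw [if_neg fun h2 => h ⟨h1, h2⟩, Matrix.mulVec_zero, dotProduct_zero]
    · rw [if_neg h1, star_zero, zero_dotProduct]

theorem runForget_cyc {B : Matrix (St n l m) (St n l m) ℂ} (T : Fin (2 ^ m) → Prop)
    [DecidablePred T] (hB : (forget (keptRot l)).dual B = B) :
    ((runForget g sec T).dual (B.submatrix cyc.symm cyc.symm)).submatrix cyc cyc =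
      (queryMatrix g sec T (ixY' l))ᴴ * B * queryMatrix g sec T (ixY' l) := by
  have hB' : (forget (kept l)).dual (B.submatrix cyc.symm cyc.symm) =
      B.submatrix cyc.symm cyc.symm := by
    rw [← submatrix_equiv_symm cyc ((forget (kept l)).dual _), forget_cyc, hB]
  have hq (s : St n l m) : cyc.symm (St.query g sec 0 (cyc s)) = St.query g sec (ixY' l) s := by
    ext : 1
    · rfl
    · rfl
    · rfl
    · funext j
      change Function.update (fun j => s.b (finRotate (l + 2) j)) 0 (s.b (finRotate (l + 2) 0) + _)
        ((finRotate (l + 2)).symm j) = Function.update s.b (ixY' l) (s.b (ixY' l) + _) j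
      rw [finRotate_zero]
      by_cases hj : j = ixY' l
      · rw [hj, ← finRotate_zero, Equiv.symm_apply_apply, Function.update_self,
          Function.update_self]
        rfl
      · rw [Function.update_of_ne hj, Function.update_of_ne, Equiv.apply_symm_apply]
        rwa [ne_eq, Equiv.symm_apply_eq, finRotate_zero]
  rw [← run_dual_forget_dual, hB']
  ext s s'
  rw [Matrix.submatrix_apply, queryMatrix_conj_apply]
  by_cases h : T s.q ∧ T s'.q
  · rw [if_pos h]
    by_cases h1 : s.q = s'.q
    · rw [run_dual_of _ (show T (cyc s).q from h.1) (show T (cyc s').q from h.2) h1,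
        Matrix.submatrix_apply, hq, hq]
    · refine (run_dual_of_not (s := cyc s) (s' := cyc s') _ fun h2 => h1 h2.2.2).trans ?_
      rw [← hB, forget_dual_of_ne]
      exact fun h2 => h1
        (St.q_eq_of_drop_eq (s := St.query g sec (ixY' l) s) (s' := St.query g sec (ixY' l) s') h2)
  · rw [if_neg h]
    exact run_dual_of_not _ fun h2 => h ⟨h2.1, h2.2.1⟩

end Calls

/-! ## Derivations of calls -/

section CallRule

variable {n l m : ℕ}

theorem Regs.vars_one (τ : Ty) (v : Ref m) : (Regs.one τ v).vars = v.vars τ := by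
  ext x
  simp only [Regs.vars, Set.mem_iUnion]
  exact ⟨fun ⟨_, h⟩ => h, fun h => ⟨(), h⟩⟩

theorem Regs.vars_app (r s : Regs m) : (r.app s).vars = r.vars ∪ s.vars := by
  ext x
  simp only [Regs.vars, Set.mem_iUnion, Set.mem_union]
  exact Sum.exists

theorem fv_callRQFS (a b : Ref m) :
    (callRQFS (n := n) a b).fv = a.vars Ty.cnt ∪ b.vars Ty.bit := by
  ext x
  simp only [callRQFS, Prog.fv, Set.mem_iUnion, Set.mem_union]
  exact Fin.exists_fin_two

theorem vars_Xs : (Xs m l).vars = ∅ := by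
  simp [Regs.vars, Xs, Ref.vars]

theorem fv_body (g : (Fin n → ZMod 2) → ZMod 2)
    (sec : List (Fin n → ZMod 2) → (Fin n → ZMod 2)) :
    ((rqfs (m := m) l g sec).body ()).fv ⊆ {(Ty.cnt, 1), (Ty.bit, 0)} := by
  have h1 : (Ty.bit, 1) ∈
      ((Regs.one Ty.vec (Xq m)).app (Regs.one Ty.bit (Y' m))).entries :=
    ⟨Sum.inr (), rfl, rfl⟩
  have h2 : ((Regs.one Ty.vec (Xq m)).app (Regs.one Ty.bit (Y' m))).indices ⊆ {(Ty.cnt, 1)} := by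
    rintro x ⟨i | i, a, j, h, rfl⟩
    · exact congrArg (Prod.mk Ty.cnt) (Ref.elem.inj h).2.symm
    · exact absurd (show Ref.var 1 = Ref.elem a j from h) (by simp)
  intro x hx
  simp only [rqfs, Prog.fv, Set.mem_union, Set.mem_iUnion, Fin.exists_fin_succ] at hx
  simp only [Matrix.cons_val_zero, Matrix.cons_val_succ, Prog.fv, branch0, branch1, fv_callRQFS,
    Regs.vars_one, Regs.vars_app, vars_Xs, q, Y, Y', Xq, Ref.vars, Set.mem_union, Set.mem_sdiff,
    Set.mem_empty_iff_false, Set.mem_singleton_iff] at hx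
  by_contra hne
  simp only [Set.mem_insert_iff, Set.mem_singleton_iff, not_or] at hne
  have h3 : x ∉ ((Regs.one Ty.vec (Xq m)).app (Regs.one Ty.bit (Y' m))).indices :=
    fun h => hne.1 (h2 h)
  have h4 : x = (Ty.bit, 1) →
      x ∈ ((Regs.one Ty.vec (Xq m)).app (Regs.one Ty.bit (Y' m))).entries := fun h => h ▸ h1
  simp only [Y', Xq] at h3 h4
  simp only [hne.1, hne.2, h3, false_or, or_false] at hx
  simp only [or_self, IsEmpty.exists_iff, or_false] at hx
  exact hx.2 (h4 hx.1)

theorem globals_rqfs (g : (Fin n → ZMod 2) → ZMod 2)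
    (sec : List (Fin n → ZMod 2) → (Fin n → ZMod 2)) :
    (rqfs (m := m) l g sec).globals = ∅ := by
  refine Set.eq_empty_of_forall_notMem fun x hx => ?_
  obtain ⟨f, hf, hx⟩ := hx
  rcases fv_body g sec hf with rfl | rfl
  · exact hx (0 : Fin 2) rfl
  · exact hx (1 : Fin 2) rfl

theorem callFormal_ren (g : (Fin n → ZMod 2) → ZMod 2)
    (sec : List (Fin n → ZMod 2) → (Fin n → ZMod 2)) (π : Ren) :
    ((rqfs (m := m) l g sec).callFormal ()).ren π =
      callRQFS (.var (π Ty.cnt 1)) (.var (π Ty.bit 0)) := by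
  unfold Decl.callFormal callRQFS
  rw [Prog.ren]
  congr 1
  funext (i : Fin 2)
  fin_cases i <;> rfl

variable {F : Type} {sig : F → List Ty} {D : Decl n m sig} {J : Triple n m sig → Prop}

theorem Derives.of_mem (hJ : Closed D J) {b : Bool} {S : Prog n m sig} {E E' : Kraus (St n l m)}
    {h : E.IsQOp} {h' : E'.IsQOp} (hm : J ⟨assn b E h, S, assn b E' h'⟩) :
    Derives J b E.dual S E'.dual := by
  intro E₁ E₂ h₁ h₂ h3 h4
  refine hJ _ _ (.order _ (assn b E h) (assn b E' h') _ S ?_ ?_) rfl ?_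
  · refine mem_trueOrder_assn _ _ _ _ fun A _ => ?_
    rw [h3, sub_self]
    exact .zero
  · refine mem_trueOrder_assn _ _ _ _ fun A _ => ?_
    rw [h4, sub_self]
    exact .zero
  · rintro s rfl
    exact hm

theorem IsDual.reindex {f : Matrix (St n l m) (St n l m) ℂ → Matrix (St n l m) (St n l m) ℂ}
    (hf : IsDual f) (e : St n l m ≃ St n l m) :
    IsDual fun A => (f (A.submatrix e.symm e.symm)).submatrix e e := by
  obtain ⟨E, hE, h⟩ := hf

  refine ⟨E.reindex e, hE.reindex e, fun A => ?_⟩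
  beta_reduce
  rw [← h, ← Kraus.dual_reindex, submatrix_symm_equiv]

theorem derives_call {g : (Fin n → ZMod 2) → ZMod 2}
    {sec : List (Fin n → ZMod 2) → (Fin n → ZMod 2)} {J : Triple n m RQFS.sig → Prop}
    (hJ : Closed (rqfs l g sec) J) {T : Fin (2 ^ m) → Prop} [DecidablePred T]
    (h : Derives J true (runForget g sec T).dual ((rqfs l g sec).callFormal ())
      (forget (kept l)).dual)
    {R : Matrix (St n l m) (St n l m) ℂ → Matrix (St n l m) (St n l m) ℂ} (hR : IsDual R)
    (hR' : ∀ A, (forget (keptRot l)).dual (R A) = R A) :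
    Derives J true (fun A => (queryMatrix g sec T (ixY' l))ᴴ * R A * queryMatrix g sec T (ixY' l))
      (callRQFS (q m) (Y' m)) R := by
  have h0 : ((rqfs (m := m) l g sec).callFormal ()).ren (rot l) = callRQFS (q m) (Y' m) := by
    rw [callFormal_ren]
    have h1 := rot_val (0 : Fin (l + 2))
    rw [finRotate_zero] at h1
    exact congrArg (fun k => callRQFS (q m) (.var k)) h1
  have h1 := derives_adap hJ rot_actsBy (by rw [globals_rqfs]; exact fun x hx => hx.elim)
    (isQOp_runForget g sec T).isDual (isQOp_forget _).isDual h
  rw [h0] at h1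
  have h2 := derives_subst (b := true) hJ ((isQOp_runForget g sec T).isDual.reindex cyc)
    ((isQOp_forget _).isDual.reindex cyc) hR h1
  exact (h2.of_pre_eq fun A => (runForget_cyc g sec T (hR' A)).symm).of_post_eq fun A => by
    rw [forget_cyc, hR']

end CallRule

/-! ## The assertions inside the body of the procedure -/

section BodyAssertions

variable {n l m : ℕ}

/-- Decrement the counter `q`. -/
def St.dec (s : St n l m) : St n l m := { s with q := s.q - 1 }

/-- The operator `U_{-1}` on `q`. -/
noncomputable def decrQ (n l m : ℕ) : Matrix (St n l m) (St n l m) ℂ :=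
  lensQ.lift (on Ty.cnt (q m) (decr m))

/-- The operator `U_{+1}` on `q`. -/
noncomputable def incrQ (n l m : ℕ) : Matrix (St n l m) (St n l m) ℂ :=
  lensQ.lift (on Ty.cnt (q m) (incr m))

theorem decrQ_conj (B : Matrix (St n l m) (St n l m) ℂ) (s s' : St n l m) :
    ((decrQ n l m)ᴴ * B * decrQ n l m) s s' = B s.dec s'.dec := by
  have h : on (n := n) Ty.cnt (q m) (decr m) = permMatrix (cntMap (q m) (· - 1)) :=
    on_permMatrix (q m) (· - 1)
  unfold decrQ
  rw [h, Lens.lift_permMatrix_conj]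
  rfl

theorem incrQ_conj (B : Matrix (St n l m) (St n l m) ℂ) (s s' : St n l m) :
    ((incrQ n l m)ᴴ * B * incrQ n l m) s s' =
      B { s with q := s.q + 1 } { s' with q := s'.q + 1 } := by
  have h : on (n := n) Ty.cnt (q m) (incr m) = permMatrix (cntMap (q m) (· + 1)) :=
    on_permMatrix (q m) (· + 1)
  unfold incrQ
  rw [h, Lens.lift_permMatrix_conj]
  rfl

theorem incrQ_decrQ_conj (B : Matrix (St n l m) (St n l m) ℂ) :
    (incrQ n l m)ᴴ * ((decrQ n l m)ᴴ * B * decrQ n l m) * incrQ n l m = B := by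
  ext s s'
  rw [incrQ_conj, decrQ_conj]
  simp [St.dec]

theorem val_eq_of_dec {k : Fin (2 ^ m)} (hlm : l < 2 ^ m) (h : (k - 1).val < l) :
    k.val = (k - 1).val + 1 := by
  have h1 := Fin.val_add_one_of_lt' (n := 2 ^ m) (i := k - 1) (by omega)
  rwa [sub_add_cancel] at h1

/-- Forget at the levels in `T`. -/
noncomputable def forgetOn (T : Fin (2 ^ m) → Prop) : Kraus (St n l m) :=
  Kraus.basisMap (fun s => T s.q) (St.keep (kept l)) (St.drop (kept l))

theorem isQOp_forgetOn (T : Fin (2 ^ m) → Prop) : (forgetOn (n := n) (l := l) T).IsQOp :=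
  Kraus.isQOp_basisMap _ _ _ fun _ _ _ _ h h' => St.keep_drop_injective (kept l) h h'

theorem forgetOn_dual_of {T : Fin (2 ^ m) → Prop} (A : Matrix (St n l m) (St n l m) ℂ)
    {s s' : St n l m} (h : T s.q) (hd : s.drop (kept l) = s'.drop (kept l)) :
    (forgetOn T).dual A s s' = A (s.keep (kept l)) (s'.keep (kept l)) :=
  Kraus.dual_basisMap_of (T := fun s : St n l m => T s.q) A h (St.q_eq_of_drop_eq hd ▸ h) hd

theorem forgetOn_dual_of_not {T : Fin (2 ^ m) → Prop} (A : Matrix (St n l m) (St n l m) ℂ)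
    {s s' : St n l m} (h : ¬(T s.q ∧ s.drop (kept l) = s'.drop (kept l))) :
    (forgetOn T).dual A s s' = 0 :=
  Kraus.dual_basisMap_of_not (T := fun s : St n l m => T s.q) A fun h' => h ⟨h'.1, h'.2.2⟩

theorem runForget_dual_eq (g : (Fin n → ZMod 2) → ZMod 2)
    (sec : List (Fin n → ZMod 2) → (Fin n → ZMod 2)) (T : Fin (2 ^ m) → Prop)
    (A : Matrix (St n l m) (St n l m) ℂ) : (runForget g sec T).dual A =
      (forgetOn T).dual (A.submatrix (St.query g sec 0) (St.query g sec 0)) := by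
  ext s s'
  by_cases h : T s.q ∧ s.drop (kept l) = s'.drop (kept l)
  · rw [forgetOn_dual_of _ h.1 h.2,
      runForget_dual_of A h.1 (St.q_eq_of_drop_eq h.2 ▸ h.1) h.2,
      St.keep_query g sec s (.inl rfl), St.keep_query g sec s' (.inl rfl)]
    rfl
  · rw [forgetOn_dual_of_not _ h, runForget_dual_of_not A fun h' => h ⟨h'.1, h'.2.2⟩]

theorem St.keep_X_eq_iff {κ : Fin (2 ^ m) → Fin (l + 2) → Prop} {s s' : St n l m}
    (h : s.drop κ = s'.drop κ) (i : Fin (2 ^ m)) :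
    (s.keep κ).X i = (s'.keep κ).X i ↔ s.X i = s'.X i := by
  obtain ⟨hq, hX, -⟩ := (St.drop_eq_iff κ s s').1 h
  by_cases hi : i ≤ s.q
  · simp only [St.keep, if_pos hi, if_pos (hq ▸ hi)]
  · simp only [St.keep, if_neg hi, if_neg (hq ▸ hi), hX i hi]

theorem St.keep_b_eq_iff {κ : Fin (2 ^ m) → Fin (l + 2) → Prop} {s s' : St n l m}
    (h : s.drop κ = s'.drop κ) (j : Fin (l + 2)) :
    (s.keep κ).b j = (s'.keep κ).b j ↔ s.b j = s'.b j := by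
  obtain ⟨hq, -, hb⟩ := (St.drop_eq_iff κ s s').1 h
  by_cases hj : κ s.q j
  · simp only [St.keep, if_pos hj, if_pos (hq ▸ hj)]
  · simp only [St.keep, if_neg hj, if_neg (hq ▸ hj), hb j hj]

theorem update_eq_update_iff {α β : Type*} [DecidableEq α] {f f' : α → β} {i : α}
    (h : f i = f' i) (x : β) (j : α) :
    Function.update f i x j = Function.update f' i x j ↔ f j = f' j := by
  by_cases hj : j = i
  · subst hj
    simp [h]
  · simp [hj]

variable {T : Fin (2 ^ m) → Prop}

/-- At the next level, all registers on which the assertion depends are kept. -/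
theorem forget_forgetOn_dec (hlm : l < 2 ^ m) (hT : ∀ k, T k → k.val < l)
    (A : Matrix (St n l m) (St n l m) ℂ) :
    (forget (keptRot l)).dual ((decrQ n l m)ᴴ * (forgetOn T).dual A * decrQ n l m) =
      (decrQ n l m)ᴴ * (forgetOn T).dual A * decrQ n l m := by
  have hle (s : St n l m) (h : T (s.q - 1)) (i : Fin (2 ^ m)) (hi : i ≤ s.q - 1) : i ≤ s.q := by
    have := val_eq_of_dec hlm (hT _ h)
    rw [Fin.le_def] at hi ⊢
    omega
  have hb (s : St n l m) (h : T (s.q - 1)) (j : Fin (l + 2)) (hj : kept l (s.q - 1) j) :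
      keptRot l s.q j :=
    keptRot_of_kept (val_eq_of_dec hlm (hT _ h)) hj
  have hk (s : St n l m) (h : T (s.q - 1)) :
      (s.keep (keptRot l)).dec.keep (kept l) = s.dec.keep (kept l) :=
    (St.keep_eq_iff ..).2 ⟨rfl, rfl, fun i hi => if_pos (hle s h i hi),
      fun j hj => if_pos (hb s h j hj)⟩
  ext s s'
  rw [decrQ_conj]
  by_cases hd : s.drop (keptRot l) = s'.drop (keptRot l)
  · rw [forget_dual_of _ hd, decrQ_conj]
    have hd' : (s.keep (keptRot l)).dec.drop (kept l) = (s'.keep (keptRot l)).dec.drop (kept l) ↔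
        s.dec.drop (kept l) = s'.dec.drop (kept l) := by
      rw [St.drop_eq_iff, St.drop_eq_iff]
      exact and_congr_right fun _ => and_congr
        (forall_congr' fun i => imp_congr_right fun _ => St.keep_X_eq_iff hd i)
        (forall_congr' fun j => imp_congr_right fun _ => St.keep_b_eq_iff hd j)
    by_cases h : T s.dec.q ∧ s.dec.drop (kept l) = s'.dec.drop (kept l)
    · have h' : T (s'.q - 1) := by
        have h1 : s.q - 1 = s'.q - 1 := St.q_eq_of_drop_eq h.2
        rw [← h1]
        exact h.1
      rw [forgetOn_dual_of A h.1 h.2,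
        forgetOn_dual_of A (s := (s.keep (keptRot l)).dec) h.1 (hd'.2 h.2), hk s h.1, hk s' h']
    · rw [forgetOn_dual_of_not A h,
        forgetOn_dual_of_not A (s := (s.keep (keptRot l)).dec) (s' := (s'.keep (keptRot l)).dec)
          fun h1 => h ⟨h1.1, hd'.1 h1.2⟩]
  · rw [forget_dual_of_ne _ hd, forgetOn_dual_of_not]
    rintro ⟨h1, h2⟩
    obtain ⟨-, hX, hB⟩ := (St.drop_eq_iff ..).1 h2
    have hq := St.q_eq_of_drop_eq h2
    exact hd ((St.drop_eq_iff ..).2 ⟨sub_left_injective hq, fun i hi => hX i (mt (hle s h1 i) hi),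
      fun j hj => hB j (mt (hb s h1 j) hj)⟩)

/-- The assertion does not depend on the local registers of the next level. -/
theorem forgetOn_dec_indep (hlm : l < 2 ^ m) (hT : ∀ k, T k → k.val < l)
    (A : Matrix (St n l m) (St n l m) ℂ) (s s' : St n l m) :
    ((lensXB (ixY' l)).get s ≠ (lensXB (ixY' l)).get s' →
      ((decrQ n l m)ᴴ * (forgetOn T).dual A * decrQ n l m) s s' = 0) ∧
    ((lensXB (ixY' l)).get s = (lensXB (ixY' l)).get s' → ∀ a,
      ((decrQ n l m)ᴴ * (forgetOn T).dual A * decrQ n l m)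
        ((lensXB (ixY' l)).set s a) ((lensXB (ixY' l)).set s' a) =
      ((decrQ n l m)ᴴ * (forgetOn T).dual A * decrQ n l m) s s') := by
  have hlt {k : Fin (2 ^ m)} (h : T (k - 1)) : ¬k ≤ k - 1 := by
    have := val_eq_of_dec hlm (hT _ h)
    rw [Fin.le_def]
    omega
  rw [decrQ_conj]
  constructor
  · intro hne
    refine forgetOn_dual_of_not A fun h => hne ?_
    obtain ⟨hq, hX, hB⟩ := (St.drop_eq_iff ..).1 h.2
    have hq' : s.q = s'.q := sub_left_injective hq
    funext i
    cases i with
    | inl _ =>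
      have h1 : s.X s.q = s'.X s.q := hX s.q (hlt h.1)
      exact h1.trans (congrArg s'.X hq')
    | inr _ => exact hB _ (not_kept_ixY' (hT _ h.1))
  · intro hg a
    rw [decrQ_conj]
    have hX : s.X s.q = s'.X s'.q := congrFun hg (.inl ())
    have hB : s.b (ixY' l) = s'.b (ixY' l) := congrFun hg (.inr ())
    have hk (s : St n l m) (h : T (s.q - 1)) :
        ((lensXB (ixY' l)).set s a).dec.keep (kept l) = s.dec.keep (kept l) := by
      refine (St.keep_eq_iff ..).2 ⟨rfl, rfl, fun i hi => Function.update_of_ne ?_ _ s.X,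
        fun j hj => Function.update_of_ne ?_ _ s.b⟩
      · rintro rfl
        exact hlt h hi
      · rintro rfl
        exact not_kept_ixY' (hT _ h) hj
    have hd : ((lensXB (ixY' l)).set s a).dec.drop (kept l) =
        ((lensXB (ixY' l)).set s' a).dec.drop (kept l) ↔
        s.dec.drop (kept l) = s'.dec.drop (kept l) := by
      rw [St.drop_eq_iff, St.drop_eq_iff]
      refine and_congr_right fun hq => ?_
      have hq' : s.q = s'.q := sub_left_injective hq
      refine and_congr (forall_congr' fun i => imp_congr_right fun _ => ?_)
        (forall_congr' fun j => imp_congr_right fun _ => ?_)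
      · change Function.update s.X s.q _ i = Function.update s'.X s'.q _ i ↔ s.X i = s'.X i
        rw [← hq'] at hX ⊢
        exact update_eq_update_iff hX _ i
      · exact update_eq_update_iff hB _ j
    by_cases h : T s.dec.q ∧ s.dec.drop (kept l) = s'.dec.drop (kept l)
    · have h' : T (s'.q - 1) := by
        have h1 : s.q - 1 = s'.q - 1 := St.q_eq_of_drop_eq h.2
        rw [← h1]
        exact h.1
      rw [forgetOn_dual_of A h.1 h.2,
        forgetOn_dual_of A (s := ((lensXB (ixY' l)).set s a).dec) h.1 (hd.2 h.2), hk s h.1, hk s' h']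
    · rw [forgetOn_dual_of_not A h,
        forgetOn_dual_of_not A (s := ((lensXB (ixY' l)).set s a).dec)
          (s' := ((lensXB (ixY' l)).set s' a).dec) fun h1 => h ⟨h1.1, hd.1 h1.2⟩]

end BodyAssertions

/-! ## The body of the procedure -/

section Body

variable {n l m : ℕ} (g : (Fin n → ZMod 2) → ZMod 2)
  (sec : List (Fin n → ZMod 2) → (Fin n → ZMod 2))

/-- The levels at which the procedure terminates within recursion depth `j`. -/
abbrev lev (l : ℕ) {m : ℕ} (j : ℕ) (k : Fin (2 ^ m)) : Prop := k.val ≤ l ∧ l < k.val + j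

/-- The levels at which a recursive call terminates within recursion depth `j`. -/
abbrev levCall (l : ℕ) {m : ℕ} (j : ℕ) (k : Fin (2 ^ m)) : Prop := 1 ≤ k.val ∧ lev l j k

/-- The levels from which the recursive calls terminate within recursion depth `j`. -/
abbrev levBelow (l : ℕ) {m : ℕ} (j : ℕ) (k : Fin (2 ^ m)) : Prop :=
  k.val < l ∧ l < k.val + 1 + j

/-- `H^{⊗n} ⊗ HX` on `𝕏[q]`, `Y'`. -/
noncomputable def prepXY (n l m : ℕ) : Matrix (St n l m) (St n l m) ℂ :=
  (lensXB (ixY' l)).lift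
    (tens (on Ty.vec (Xq m) (hadamardPow n)) (on Ty.bit (Y' m) (hadamard * pauliX)))

/-- `H^{⊗n} ⊗ XH` on `𝕏[q]`, `Y'`. -/
noncomputable def unprepXY (n l m : ℕ) : Matrix (St n l m) (St n l m) ℂ :=
  (lensXB (ixY' l)).lift
    (tens (on Ty.vec (Xq m) (hadamardPow n)) (on Ty.bit (Y' m) (pauliX * hadamard)))

/-- `H^{⊗n}` on `𝕏[q]`. -/
noncomputable def hadX (n l m : ℕ) : Matrix (St n l m) (St n l m) ℂ :=
  lensX.lift (on Ty.vec (Xq m) (hadamardPow n))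

/-- The oracle for `g` on `𝕏[q]`, `Y`. -/
noncomputable def oracleG (l m : ℕ) : Matrix (St n l m) (St n l m) ℂ :=
  (lensXB 0).lift (oracle (Regs.one Ty.vec (Xq m)) (Y m) fun u => g (u ()))

theorem on_unitary {τ : Ty} {A : Matrix (Basis n m τ) (Basis n m τ) ℂ} (hA : Aᴴ * A = 1)
    (v : Ref m) : on τ v A * (on τ v A)ᴴ = 1 ∧ (on τ v A)ᴴ * on τ v A = 1 := by
  have h : (on τ v A)ᴴ * on τ v A = 1 := by
    rw [on_conjTranspose, on_mul, hA, on_one]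
  exact ⟨mul_eq_one_comm.1 h, h⟩

theorem tens_unitary {r s : Regs m} {A : Matrix (r.Cfg n) (r.Cfg n) ℂ}
    {B : Matrix (s.Cfg n) (s.Cfg n) ℂ} (hA : Aᴴ * A = 1) (hB : Bᴴ * B = 1) :
    tens A B * (tens A B)ᴴ = 1 ∧ (tens A B)ᴴ * tens A B = 1 := by
  have h : (tens A B)ᴴ * tens A B = 1 := by
    rw [tens_conjTranspose, tens_mul, hA, hB, tens_one]
  exact ⟨mul_eq_one_comm.1 h, h⟩

theorem prep_unitary : (hadamard * pauliX)ᴴ * (hadamard * pauliX) = 1 := by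
  rw [Matrix.conjTranspose_mul, hadamard_conjTranspose, pauliX_conjTranspose, Matrix.mul_assoc,
    ← Matrix.mul_assoc hadamard, hadamard_mul_self, Matrix.one_mul, pauliX_mul_self]

theorem unprep_unitary : (pauliX * hadamard)ᴴ * (pauliX * hadamard) = 1 := by
  rw [Matrix.conjTranspose_mul, hadamard_conjTranspose, pauliX_conjTranspose, Matrix.mul_assoc,
    ← Matrix.mul_assoc pauliX, pauliX_mul_self, Matrix.one_mul, hadamard_mul_self]

theorem hadamardPow_unitary : (hadamardPow n)ᴴ * hadamardPow n = 1 := by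
  rw [hadamardPow_conjTranspose, hadamardPow_mul_self]

theorem isDual_queryMatrix_conj (T : Fin (2 ^ m) → Prop) [DecidablePred T] (j : Fin (l + 2)) :
    IsDual fun A : Matrix (St n l m) (St n l m) ℂ =>
      (queryMatrix g sec T j)ᴴ * A * queryMatrix g sec T j := by
  refine ⟨Kraus.basisMap (fun s => T s.q) (St.query g sec j) fun _ => (), ?_, fun A => ?_⟩
  · exact Kraus.isQOp_basisMap _ _ _ fun _ _ _ _ _ h => St.query_injective g sec j h
  · ext s s'
    refine Eq.trans ?_ (queryMatrix_conj_apply g sec T j s s').symm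
    rw [Kraus.dual_basisMap]
    simp

/-- The operator of the block of the procedure. -/
noncomputable def levelMatrix (j : ℕ) : Matrix (St n l m) (St n l m) ℂ :=
  unprepXY n l m * (queryMatrix g sec (levCall l j) (ixY' l) * (hadX n l m * (oracleG g l m *
    (hadX n l m * (queryMatrix g sec (levCall l j) (ixY' l) * prepXY n l m)))))

theorem levelMatrix_mulVec {g sec}
    (hs : ∀ (path : List (Fin n → ZMod 2)) (x : Fin n → ZMod 2),
      path.length < l → g (sec (path ++ [x])) = sec path ⬝ᵥ x)
    {j : ℕ} {s : St n l m} {k : ℕ} (hk : s.q.val = k + 1) (hT : levCall l j s.q)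
    (hX : s.X s.q = 0) (hb : s.b (ixY' l) = 0) :
    levelMatrix g sec j *ᵥ Pi.single s 1 = Pi.single (St.addBit 0 (g (sec (s.path k))) s) 1 := by
  have hkl : k < l := by
    have := hT.2.1
    omega
  unfold levelMatrix
  simp only [← Matrix.mulVec_mulVec]
  exact level_mulVec g sec hs (levCall l j) hT hk hkl hX hb

theorem levelMatrix_mulVec_of_not {j : ℕ} {s : St n l m} (hT : ¬levCall l j s.q) :
    levelMatrix g sec j *ᵥ Pi.single s 1 = 0 := by
  have h : queryMatrix g sec (levCall l j) (ixY' l) *ᵥ (prepXY n l m *ᵥ Pi.single s 1) = 0 := by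
    unfold prepXY
    have h1 (x : Fin n → ZMod 2) (y : ZMod 2) : ¬levCall l j (s.put x y).q := hT
    rw [lift_tens_mulVec_single]
    simp only [Matrix.mulVec_sum, Matrix.mulVec_smul, queryMatrix_mulVec_single, h1, if_false,
      smul_zero, Finset.sum_const_zero]
  unfold levelMatrix
  simp only [← Matrix.mulVec_mulVec]
  rw [h]
  simp only [Matrix.mulVec_zero]

theorem Lens.reset_dual_of {r : Regs m} (L : Lens n l m r) (B : Matrix (St n l m) (St n l m) ℂ)
    {s s' : St n l m} (h : L.get s = L.get s') :
    L.reset.dual B s s' = B (L.set s 0) (L.set s' 0) :=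
  Kraus.dual_basisMap_of B trivial trivial h

theorem Lens.reset_dual_of_ne {r : Regs m} (L : Lens n l m r) (B : Matrix (St n l m) (St n l m) ℂ)
    {s s' : St n l m} (h : L.get s ≠ L.get s') : L.reset.dual B s s' = 0 :=
  Kraus.dual_basisMap_of_not B fun h' => h h'.2.2

theorem levCall_iff (hlm : l < 2 ^ m) {j : ℕ} (k : Fin (2 ^ m)) :
    levCall l j k ↔ levBelow l j (k - 1) := by
  constructor
  · rintro ⟨h1, h2, h3⟩
    have h4 : (k - 1).val = k.val - 1 := by
      have : k ≠ 0 := by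
        rintro rfl
        simp at h1
      exact Fin.val_sub_one_of_ne_zero this
    exact ⟨by omega, by omega⟩
  · intro h
    have h1 := val_eq_of_dec hlm h.1
    exact ⟨by omega, by have := h.1; omega, by have := h.2; omega⟩

theorem level_conj_apply {g sec} (hlm : l < 2 ^ m)
    (hs : ∀ (path : List (Fin n → ZMod 2)) (x : Fin n → ZMod 2),
      path.length < l → g (sec (path ++ [x])) = sec path ⬝ᵥ x)
    (j : ℕ) (A : Matrix (St n l m) (St n l m) ℂ) {s s' : St n l m} (hX : s.X s.q = 0)
    (hX' : s'.X s'.q = 0) (hb : s.b (ixY' l) = 0) (hb' : s'.b (ixY' l) = 0) :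
    ((levelMatrix (l := l) (m := m) g sec j)ᴴ *
      ((decrQ n l m)ᴴ * (forgetOn fun k => k.val < l).dual A * decrQ n l m) *
        levelMatrix (l := l) (m := m) g sec j) s s' =
      ((decrQ n l m)ᴴ * (forgetOn (levBelow l j)).dual
        (A.submatrix (St.query g sec 0) (St.query g sec 0)) * decrQ n l m) s s' := by
  have hN {s : St n l m} (hX : s.X s.q = 0) (hb : s.b (ixY' l) = 0) (h : levCall l j s.q) :=
    levelMatrix_mulVec hs (val_eq_of_dec hlm ((levCall_iff hlm s.q).1 h).1) h hX hb
  have hdec (s : St n l m) : (St.addBit 0 (g (sec (s.path (s.q - 1).val))) s).dec =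
      St.query g sec 0 s.dec := rfl
  have hlev (s : St n l m) := levCall_iff hlm (j := j) s.q
  rw [decrQ_conj]
  by_cases h : levCall l j s.q
  · by_cases h' : levCall l j s'.q
    · rw [conj_apply_of_single _ (hN hX hb h) (hN hX' hb' h'), decrQ_conj, hdec, hdec]
      have hd (s : St n l m) := St.drop_query g sec (κ := kept l) (j := 0) s.dec (.inl rfl)
      have hk (s : St n l m) := St.keep_query g sec (κ := kept l) (j := 0) s.dec (.inl rfl)
      by_cases hds : s.dec.drop (kept l) = s'.dec.drop (kept l)
      · rw [forgetOn_dual_of A (s := St.query g sec 0 s.dec) (s' := St.query g sec 0 s'.dec)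
          ((hlev s).1 h).1 (by rw [hd, hd, hds]), hk, hk, forgetOn_dual_of _ ((hlev s).1 h) hds]
        rfl
      · rw [forgetOn_dual_of_not _ fun h1 => hds h1.2, forgetOn_dual_of_not]
        rw [hd, hd]
        exact fun h1 => hds h1.2
    · rw [conj_apply, levelMatrix_mulVec_of_not _ _ h', Matrix.mulVec_zero, dotProduct_zero,
        forgetOn_dual_of_not]
      intro h1
      have h2 : s.q - 1 = s'.q - 1 := St.q_eq_of_drop_eq h1.2
      exact h' ((hlev s').2 (h2 ▸ h1.1))
  · rw [conj_apply, levelMatrix_mulVec_of_not _ _ h, star_zero, zero_dotProduct,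
      forgetOn_dual_of_not]
    exact fun h1 => h ((hlev s).2 h1.1)

/-- The weakest precondition of the block. -/
theorem reset_level {g sec} (hlm : l < 2 ^ m)
    (hs : ∀ (path : List (Fin n → ZMod 2)) (x : Fin n → ZMod 2),
      path.length < l → g (sec (path ++ [x])) = sec path ⬝ᵥ x)
    (j : ℕ) (A : Matrix (St n l m) (St n l m) ℂ) :
    (lensXB (ixY' l)).reset.dual ((levelMatrix (l := l) (m := m) g sec j)ᴴ *
      ((decrQ n l m)ᴴ * (forgetOn fun k => k.val < l).dual A * decrQ n l m) *
        levelMatrix (l := l) (m := m) g sec j) =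
      (decrQ n l m)ᴴ * (runForget g sec (levBelow l j)).dual A * decrQ n l m := by
  rw [runForget_dual_eq]
  ext s s'
  have hind := forgetOn_dec_indep (T := levBelow l j) hlm (fun _ h => h.1)
    (A.submatrix (St.query g sec 0) (St.query g sec 0)) s s'
  by_cases hg : (lensXB (ixY' l)).get s = (lensXB (ixY' l)).get s'
  · rw [Lens.reset_dual_of _ _ hg, ← hind.2 hg 0]
    have hX (s : St n l m) : ((lensXB (ixY' l)).set s 0).X ((lensXB (ixY' l)).set s 0).q = 0 :=
      Function.update_self (f := s.X) ..
    have hb (s : St n l m) : ((lensXB (ixY' l)).set s 0).b (ixY' l) = 0 := by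
      change Function.update s.b (ixY' l) 0 (ixY' l) = 0
      exact Function.update_self ..
    exact level_conj_apply hlm hs j A (hX s) (hX s') (hb s) (hb s')
  · rw [Lens.reset_dual_of_ne _ _ hg, hind.1 hg]

theorem derives_branch0 {g sec} (hlm : l < 2 ^ m)
    (hs : ∀ (path : List (Fin n → ZMod 2)) (x : Fin n → ZMod 2),
      path.length < l → g (sec (path ++ [x])) = sec path ⬝ᵥ x)
    {J : Triple n m sig → Prop} (hJ : Closed (rqfs l g sec) J) {j : ℕ}
    (h : Derives J true (runForget g sec (lev l j)).dual ((rqfs l g sec).callFormal ())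
      (forget (kept l)).dual) :
    Derives J true (runForget g sec (levBelow l j)).dual (branch0 g) (forget (kept l)).dual := by
  have hcall : Derives J true (runForget g sec (levCall l j)).dual
      ((rqfs l g sec).callFormal ()) (forget (kept l)).dual := by
    refine h.order hJ (isQOp_runForget ..).isDual (isQOp_forget _).isDual (fun A hA => ?_)
      fun A _ => by rw [sub_self]; exact .zero
    exact Kraus.basisMap_mono (fun s hs => hs.2) (fun s s' h => by
      rw [St.q_eq_of_drop_eq h]) hA
  have hincr := on_permMatrix_unitary (n := n) (q m) (f := (· + 1)) (add_left_injective 1)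
  have hdecr := on_permMatrix_unitary (n := n) (q m) (f := (· - 1)) sub_left_injective
  have hG := oracle_unitary (n := n) (Regs.one Ty.vec (Xq m)) (Y m) fun u => g (u ())
  have hH := on_unitary (τ := Ty.vec) (A := hadamardPow n) hadamardPow_unitary (Xq m)
  have hV := tens_unitary hH.2
    (on_unitary (n := n) (τ := Ty.bit) (A := hadamard * pauliX) prep_unitary (Y' m)).2
  have hV' := tens_unitary hH.2
    (on_unitary (n := n) (τ := Ty.bit) (A := pauliX * hadamard) unprep_unitary (Y' m)).2
  have dD := isDual_conj (lensQ.conjTranspose_lift_mul_lift (l := l) _ hdecr.2)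
  have dG := isDual_conj ((lensXB (l := l) 0).conjTranspose_lift_mul_lift _ hG.2)
  have dH := isDual_conj (lensX.conjTranspose_lift_mul_lift (l := l) _ hH.2)
  have dV := isDual_conj ((lensXB (ixY' l)).conjTranspose_lift_mul_lift _ hV.2)
  have dV' := isDual_conj ((lensXB (ixY' l)).conjTranspose_lift_mul_lift _ hV'.2)
  have dM := isDual_queryMatrix_conj (l := l) (m := m) g sec (levCall l j) (ixY' l)
  have d2 : IsDual fun A => (decrQ n l m)ᴴ * (forgetOn fun k => k.val < l).dual A * decrQ n l m :=
    (isQOp_forgetOn _).isDual.comp dD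
  have d1 : IsDual fun A => (decrQ n l m)ᴴ * (runForget g sec (levBelow l j)).dual A * decrQ n l m :=
    (isQOp_runForget ..).isDual.comp dD
  have d6 := d2.comp dV'
  have d5 := d6.comp dM
  have d4 := d5.comp dH
  have d3 := d4.comp dG
  have d2' := d3.comp dH
  have d1' := d2'.comp dM
  have d0 := d1'.comp dV
  have a2 := forget_forgetOn_dec (n := n) (T := fun k => k.val < l) hlm fun _ h => h
  have cV' := commForget_lensXB (l := l) keptRot_ixY'
    (tens (on Ty.vec (Xq m) (hadamardPow n)) (on Ty.bit (Y' m) (pauliX * hadamard)))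
  have cH := commForget_lensX (keptRot l) (on Ty.vec (Xq m) (hadamardPow n))
  have cG := commForget_lensXB (l := l) keptRot_zero
    (oracle (Regs.one Ty.vec (Xq m)) (Y m) fun u => g (u ()))
  have cM := commForget_queryMatrix (l := l) (m := m) g sec keptRot_ixY' (levCall l j)
  have hlast : Derives J true
      (fun A => (decrQ n l m)ᴴ * (forgetOn fun k => k.val < l).dual A * decrQ n l m)
      (.unit (Regs.one Ty.cnt (q m)) (on Ty.cnt (q m) (decr m))) (forget (kept l)).dual := by
    refine (derives_unit hJ lensQ hdecr.1 hdecr.2).order hJ d2 (isQOp_forgetOn _).isDual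
      (fun A _ => by rw [sub_self]; exact .zero) fun A hA => ?_
    exact Kraus.basisMap_mono (fun _ _ => trivial) (fun s s' h => by
      rw [St.q_eq_of_drop_eq h]) hA
  refine .seq hJ d1 ?_ (.seq hJ d2 (derives_locl hJ (lensXB (ixY' l)) ?_ ?_ ?_) hlast)
  · exact (derives_unit hJ lensQ hincr.1 hincr.2).of_pre_eq fun A => (incrQ_decrQ_conj _).symm
  · intro A
    rw [runForget_dual_eq]
    exact forgetOn_dec_indep hlm (fun _ h => h.1) _
  · exact fun A => forgetOn_dec_indep hlm (fun _ h => h) A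
  · refine .seq hJ d0 ((derives_init hJ (lensXB (ixY' l))).of_pre_eq fun A => ?_) <|
      .seq hJ d1' (derives_unit hJ (lensXB (ixY' l)) hV.1 hV.2) <|
      .seq hJ d2' (derives_call hJ hcall d2' fun A => ?_) <|
      .seq hJ d3 (derives_unit hJ lensX hH.1 hH.2) <|
      .seq hJ d4 (derives_unit hJ (lensXB 0) hG.1 hG.2) <|
      .seq hJ d5 (derives_unit hJ lensX hH.1 hH.2) <|
      .seq hJ d6 (derives_call hJ hcall d6 fun A => ?_) <|
      derives_unit hJ (lensXB (ixY' l)) hV'.1 hV'.2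
    · rw [← reset_level hlm hs]
      simp only [levelMatrix, Matrix.conjTranspose_mul, Matrix.mul_assoc]
      rfl
    · exact cH.dual_conj (cG.dual_conj (cH.dual_conj (cM.dual_conj (cV'.dual_conj (a2 A)))))
    · exact cV'.dual_conj (a2 A)

end Body

section BodyCase

variable {n l m : ℕ} (g : (Fin n → ZMod 2) → ZMod 2)
  (sec : List (Fin n → ZMod 2) → (Fin n → ZMod 2))

/-- The oracle on `𝕏[1], …, 𝕏[l]`, `Y`. -/
noncomputable def oracleO (hlm : l < 2 ^ m) : Matrix (St n l m) (St n l m) ℂ :=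
  (lensXsY hlm).lift
    (oracle (Xs m l) (Y m) fun x => g (sec (List.ofFn (n := l) fun j => x j)))

theorem oracleO_conj (hlm : l < 2 ^ m) (B : Matrix (St n l m) (St n l m) ℂ) (s s' : St n l m) :
    ((oracleO g sec hlm)ᴴ * B * oracleO g sec hlm) s s' =
      B (St.addBit 0 (g (sec (s.path l))) s) (St.addBit 0 (g (sec (s'.path l))) s') := by
  have h (s : St n l m) : (lensXsY hlm).set s (oracleFun (Xs m l) (Y m)
      (fun x => g (sec (List.ofFn (n := l) fun j => x j))) ((lensXsY hlm).get s)) =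
      St.addBit 0 (g (sec (s.path l))) s :=
    (lensXs hlm).set_get (St.addBit 0 (g (sec (s.path l))) s)
  unfold oracleO
  rw [oracle_eq]
  refine ((lensXsY hlm).lift_permMatrix_conj _ B s s').trans ?_
  rw [h, h]

/-- The measurement of the level. -/
noncomputable def measQ (n l m : ℕ) (k : Fin 3) : Matrix (St n l m) (St n l m) ℂ :=
  lensQ.lift (on Ty.cnt (q m) (meas m l k))

theorem measQ_conj (B : Matrix (St n l m) (St n l m) ℂ) (k : Fin 3) (s s' : St n l m) :
    ((measQ n l m k)ᴴ * B * measQ n l m k) s s' =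
    if (![decide (s.q.val < l), decide (s.q.val = l), decide (l < s.q.val)] : Fin 3 → Bool) k ∧
      (![decide (s'.q.val < l), decide (s'.q.val = l), decide (l < s'.q.val)] : Fin 3 → Bool) k
    then B s s' else 0 := by
  unfold measQ
  rw [on_meas, Lens.lift_diagonal_conj]
  change star (if (![decide (s.q.val < l), decide (s.q.val = l), decide (l < s.q.val)] :
    Fin 3 → Bool) k then (1 : ℂ) else 0) * B s s' * (if (![decide (s'.q.val < l),
      decide (s'.q.val = l), decide (l < s'.q.val)] : Fin 3 → Bool) k then (1 : ℂ) else 0) = _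
  by_cases h : (![decide (s.q.val < l), decide (s.q.val = l), decide (l < s.q.val)] :
      Fin 3 → Bool) k
  · simp [h]
  · simp [h]

theorem runForget_dual_congr {g sec} {T T' : Fin (2 ^ m) → Prop}
    (A : Matrix (St n l m) (St n l m) ℂ) {s s' : St n l m} (h : T s.q ↔ T' s.q) :
    (runForget g sec T).dual A s s' = (runForget g sec T').dual A s s' := by
  rw [runForget_dual_eq, runForget_dual_eq]
  by_cases h1 : T s.q ∧ s.drop (kept l) = s'.drop (kept l)
  · rw [forgetOn_dual_of _ h1.1 h1.2, forgetOn_dual_of _ (h.1 h1.1) h1.2]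
  · rw [forgetOn_dual_of_not _ h1, forgetOn_dual_of_not _ fun h2 => h1 ⟨h.2 h2.1, h2.2⟩]

theorem runForget_dual_of_q_ne {g sec} {T : Fin (2 ^ m) → Prop}
    (A : Matrix (St n l m) (St n l m) ℂ) {s s' : St n l m} (h : s.q ≠ s'.q) :
    (runForget g sec T).dual A s s' = 0 :=
  runForget_dual_of_not A fun h1 => h (St.q_eq_of_drop_eq h1.2.2)

/-- The preconditions of the three branches. -/
noncomputable def branchPre (hlm : l < 2 ^ m) (j : ℕ) :
    Fin 3 → Matrix (St n l m) (St n l m) ℂ → Matrix (St n l m) (St n l m) ℂ :=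
  ![(runForget g sec (levBelow l j)).dual,
    fun A => (oracleO g sec hlm)ᴴ * (forget (kept l)).dual A * oracleO g sec hlm, fun _ => 0]

theorem sum_branchPre (hlm : l < 2 ^ m) (j : ℕ) (A : Matrix (St n l m) (St n l m) ℂ) :
    ∑ k, (measQ n l m k)ᴴ * branchPre g sec hlm j k A *
      measQ n l m k = (runForget g sec (lev l (j + 1))).dual A := by
  ext s s'
  rw [Matrix.sum_apply]
  simp only [measQ_conj]
  rw [Fin.sum_univ_three]
  simp only [branchPre, Matrix.cons_val_zero, Matrix.cons_val_one, Matrix.cons_val,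
    decide_eq_true_eq, Matrix.zero_apply, ite_self, add_zero]
  by_cases hq : s.q = s'.q
  · rw [← hq]
    simp only [and_self]
    rcases lt_trichotomy s.q.val l with h | h | h
    · rw [if_pos h, if_neg h.ne, add_zero]
      exact runForget_dual_congr A ⟨fun h1 => ⟨h.le, by have := h1.2; omega⟩,
        fun h1 => ⟨h, by have := h1.2; omega⟩⟩
    · have hl : lev l (j + 1) s.q := ⟨h.le, by omega⟩
      rw [if_neg (by omega), if_pos h, zero_add, oracleO_conj, ← run_dual_forget_dual]
      refine Eq.trans ?_ (run_dual_of _ hl (hq ▸ hl) hq).symm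
      simp only [St.query, ← hq, h]
    · rw [if_neg (by omega), if_neg (by omega), add_zero, runForget_dual_of_not]
      exact fun h1 => absurd h1.1.1 (by omega)
  · have h1 : ¬(s.q.val = l ∧ s'.q.val = l) := fun h => hq (Fin.ext (h.1.trans h.2.symm))
    rw [if_neg h1, runForget_dual_of_q_ne A hq, runForget_dual_of_q_ne A hq, ite_self, add_zero]

/-- The premises of the recursion rule. -/
theorem derives_body {g sec} (hlm : l < 2 ^ m)
    (hs : ∀ (path : List (Fin n → ZMod 2)) (x : Fin n → ZMod 2),
      path.length < l → g (sec (path ++ [x])) = sec path ⬝ᵥ x)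
    {J : Triple n m sig → Prop} (hJ : Closed (rqfs l g sec) J) {j : ℕ}
    (h : Derives J true (runForget g sec (lev l j)).dual ((rqfs l g sec).callFormal ())
      (forget (kept l)).dual) :
    Derives J true (runForget g sec (lev l (j + 1))).dual ((rqfs l g sec).body ())
      (forget (kept l)).dual := by
  have hO := oracle_unitary (n := n) (Xs m l) (Y m)
    fun x => g (sec (List.ofFn (n := l) fun j => x j))
  have key : Derives J true (fun A => ∑ k, (measQ n l m k)ᴴ *
      branchPre g sec hlm j k A * measQ n l m k)
      ((rqfs l g sec).body ()) (forget (kept l)).dual := by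
    refine derives_ifm hJ lensQ sum_meas (fun k => ?_) fun k => ?_
    · fin_cases k
      · exact (isQOp_runForget ..).isDual
      · exact (isQOp_forget _).isDual.comp
          (isDual_conj ((lensXsY hlm).conjTranspose_lift_mul_lift _ hO.2))
      · refine ⟨Kraus.zero _, ?_, fun A => Kraus.dual_zero A⟩
        unfold Kraus.IsQOp
        rw [Kraus.dual_zero, sub_zero]
        exact .one
    · fin_cases k
      · exact derives_branch0 hlm hs hJ h
      · exact derives_unit hJ (lensXsY hlm) hO.1 hO.2
      · exact derives_bot hJ
  exact key.of_pre_eq fun A => (sum_branchPre g sec hlm j A).symm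

end BodyCase

/-! ## The recursion rule -/

section Recursion

variable {n l m : ℕ} (g : (Fin n → ZMod 2) → ZMod 2)
  (sec : List (Fin n → ZMod 2) → (Fin n → ZMod 2))

theorem lev_iff_of_lt {j : ℕ} (hj : l < j) (k : Fin (2 ^ m)) : lev l j k ↔ k.val ≤ l :=
  ⟨fun h => h.1, fun h => ⟨h, by omega⟩⟩

/-- The precondition of the procedure at the levels in `T`. -/
noncomputable def runAssn (l : ℕ) (T : Fin (2 ^ m) → Prop) : Assn n m :=
  assn true (runForget (l := l) g sec T) (isQOp_runForget g sec T)

theorem den_eq_run (T : Fin (2 ^ m) → Prop) (v : Assign n m) :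
    (runAssn g sec l T).den v =
      ext (vars l m) (((run g sec T).reindex (St.equivCfg n l m)).dual
        ((term true (forget (kept l)) (isQOp_forget _)).den v)) := by
  rw [runAssn, assn_den, term_den, Kraus.dual_reindex, ext_vars, run_dual_forget_dual]

theorem isIncreasing_runForget :
    IsIncreasing (fun j => runAssn g sec l (lev (m := m) l j))
      (runAssn g sec l fun k : Fin (2 ^ m) => k.val ≤ l) := by
  refine ⟨vars l m, term true (forget (kept l)) (isQOp_forget _),
    fun j => (run g sec (lev l j)).reindex (St.equivCfg n l m),
    (run g sec fun k => k.val ≤ l).reindex (St.equivCfg n l m),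
    fun j => (isQOp_run ..).reindex _, (isQOp_run ..).reindex _, fun j => ?_, fun A => ?_,
    fun j => ⟨rfl, den_eq_run g sec _⟩, rfl, den_eq_run g sec _⟩
  · refine ⟨(run g sec fun k => lev l (j + 1) k ∧ ¬lev l j k).reindex (St.equivCfg n l m),
      fun A => ?_⟩
    rw [← submatrix_symm_equiv (St.equivCfg n l m) A, Kraus.dual_reindex, Kraus.dual_reindex,
      Kraus.dual_reindex]
    have h := Kraus.dual_basisMap_sub (T := fun s : St n l m => lev l (j + 1) s.q)
      (T' := fun s => lev l j s.q) (f := St.query g sec 0) (r := St.q)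
      (fun s h => ⟨h.1, by have := h.2; omega⟩) (fun s s' h => by rw [h])
      (A.submatrix (St.equivCfg n l m).symm (St.equivCfg n l m).symm)
    exact congrArg (fun B => B.submatrix (St.equivCfg n l m) (St.equivCfg n l m))
      (add_comm _ _ |>.trans (eq_sub_iff_add_eq.1 h.symm))
  · refine tendsto_const_nhds.congr' ?_
    filter_upwards [Filter.eventually_gt_atTop l] with j hj
    have h : (lev l j : Fin (2 ^ m) → Prop) = fun k => k.val ≤ l :=
      funext fun k => propext (lev_iff_of_lt hj k)
    rw [h]

/-- The postcondition of the procedure. -/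
noncomputable def postAssn (n l m : ℕ) : Assn n m :=
  assn true (forget (kept l)) (isQOp_forget _)

theorem params_runAssn (T : Fin (2 ^ m) → Prop) :
    (runAssn g sec l T).params = (postAssn n l m).params :=
  (assn_params true _ (isQOp_runForget g sec T)).trans (assn_params true _ (isQOp_forget _)).symm

theorem den_runAssn_zero (v : Assign n m) : (runAssn g sec l (lev l 0)).den v = 0 := by
  have h0 : (runForget (l := l) (m := m) g sec (lev l 0)).dual (val true v) = 0 := by
    ext s s'
    exact runForget_dual_of_not _ fun h => absurd h.1.2 (by have := h.1.1; omega)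
  rw [runAssn, assn_den, h0, extSt_zero]

variable {g sec}

theorem qbe_body (hlm : l < 2 ^ m)
    (hs : ∀ (path : List (Fin n → ZMod 2)) (x : Fin n → ZMod 2),
      path.length < l → g (sec (path ++ [x])) = sec path ⬝ᵥ x) (j : ℕ)
    {H : Set (Triple n m sig)}
    (hH : ⟨runAssn g sec l (lev l j), (rqfs l g sec).callFormal (), postAssn n l m⟩ ∈ H) :
    QBE (trueOrder n m) (rqfs l g sec) H
      ⟨runAssn g sec l (lev l (j + 1)), (rqfs l g sec).body (), postAssn n l m⟩ :=
  derives_body hlm hs (closed_QBE H) (Derives.of_mem (closed_QBE H) (.hyp hH)) _ _ _ _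
    (fun _ => rfl) fun _ => rfl

theorem qtp_procedure (hlm : l < 2 ^ m)
    (hs : ∀ (path : List (Fin n → ZMod 2)) (x : Fin n → ZMod 2),
      path.length < l → g (sec (path ++ [x])) = sec path ⬝ᵥ x) :
    QTP (trueOrder n m) (rqfs l g sec)
      ⟨runAssn g sec l fun k => k.val ≤ l, (rqfs l g sec).callFormal (), postAssn n l m⟩ := by
  refine QTP.pRec (fun _ j => runAssn g sec l (lev l j))
    (fun _ => runAssn g sec l fun k => k.val ≤ l) (fun _ => runAssn g sec l fun k => k.val ≤ l)
    (fun _ => postAssn n l m) (fun _ => isIncreasing_runForget g sec)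
    (fun _ v => den_runAssn_zero g sec v) (fun _ _ => params_runAssn g sec _)
    (fun _ => params_runAssn g sec _) (fun j f => ?_) (fun _ => ?_) ()
  · exact qbe_body hlm hs j ⟨(), rfl⟩
  · refine mem_trueOrder rfl fun v => ?_
    rw [sub_self]
    exact .zero

/-- Total correctness of the procedure. -/
theorem derives_procedure (hlm : l < 2 ^ m)
    (hs : ∀ (path : List (Fin n → ZMod 2)) (x : Fin n → ZMod 2),
      path.length < l → g (sec (path ++ [x])) = sec path ⬝ᵥ x) :
    Derives (QTP (trueOrder n m) (rqfs l g sec)) true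
      (runForget g sec fun k => k.val ≤ l).dual ((rqfs l g sec).callFormal ())
      (forget (kept l)).dual :=
  Derives.of_mem closed_QTP (qtp_procedure hlm hs)

end Recursion

/-! ## The main program -/

section Main

variable {n l m : ℕ}

/-- The index of `Z`. -/
def ixZ (hl : 0 < l) : Fin (l + 2) := ⟨2, by omega⟩

/-- The renaming that exchanges `p`, `q` and `Y`, `Z`. -/
def exch : Ren
  | .bit => Equiv.swap 0 2
  | .cnt => Equiv.swap 0 1
  | .vec => 1

theorem swap_ixZ_val (hl : 0 < l) (j : Fin (l + 2)) :
    Equiv.swap 0 2 j.val = (Equiv.swap 0 (ixZ hl) j).val := by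
  rw [Equiv.swap_apply_def, Equiv.swap_apply_def]
  simp only [Fin.ext_iff, Fin.val_zero, ixZ]
  split_ifs <;> rfl

/-- The effect of `exch`. -/
def exchSt (hl : 0 < l) : St n l m ≃ St n l m where
  toFun s := ⟨s.q, s.p, s.X, fun j => s.b (Equiv.swap 0 (ixZ hl) j)⟩
  invFun s := ⟨s.q, s.p, s.X, fun j => s.b (Equiv.swap 0 (ixZ hl) j)⟩
  left_inv s := by simp
  right_inv s := by simp

theorem exch_mem_vars (hl : 0 < l) (x : QVar m) :
    QVar.ren exch x ∈ vars l m ↔ x ∈ vars l m := by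
  obtain ⟨τ, k | ⟨a, i⟩⟩ := x
  · cases τ with
    | bit =>
      have h (k : ℕ) : (Ty.bit, QName.var k) ∈ vars l m ↔ k < l + 2 := by
        rw [mem_vars]
        simp only [Prod.mk.injEq, reduceCtorEq, false_and, and_false, exists_false, false_or,
          QName.var.injEq, true_and]
        exact ⟨fun ⟨j, hj⟩ => hj ▸ j.isLt, fun hk => ⟨⟨k, hk⟩, rfl⟩⟩
      change (Ty.bit, QName.var (Equiv.swap 0 2 k)) ∈ vars l m ↔ _
      rw [h, h, Equiv.swap_apply_def]
      split_ifs <;> omega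
    | cnt =>
      have h (k : ℕ) : (Ty.cnt, QName.var k) ∈ vars l m ↔ k = 0 ∨ k = 1 := by
        simp [mem_vars]
      change (Ty.cnt, QName.var (Equiv.swap 0 1 k)) ∈ vars l m ↔ _
      rw [h, h, Equiv.swap_apply_def]
      split_ifs <;> omega
    | vec => rfl
  · rfl

theorem exch_exch (x : QVar m) : QVar.ren exch (QVar.ren exch x) = x := by
  obtain ⟨τ, k | ⟨a, i⟩⟩ := x
  · cases τ <;> simp [QVar.ren, QName.ren, exch]
  · rfl

theorem exch_actsBy (hl : 0 < l) : exch.ActsBy (exchSt (n := n) (m := m) hl) where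
  mem_vars := exch_mem_vars hl
  surj x hx := ⟨QVar.ren exch x, mt (exch_mem_vars hl x).1 hx, exch_exch x⟩
  read_pull σ := by
    ext : 1
    · rfl
    · rfl
    · rfl
    · funext j
      exact congrArg (fun k => σ (Ty.bit, QName.var k)) (swap_ixZ_val hl j)

end Main

section MainProgram

variable {n l m : ℕ}

theorem derives_skip {F : Type} {sig : F → List Ty} {D : Decl n m sig}
    {J : Triple n m sig → Prop} (hJ : Closed D J) {b : Bool}
    {f : Matrix (St n l m) (St n l m) ℂ → Matrix (St n l m) (St n l m) ℂ} (hf : IsDual f) :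
    Derives J b f .skip f := by
  obtain ⟨E, hE, h⟩ := hf
  obtain rfl : E.dual = f := funext h
  exact Derives.of_mem hJ (hJ _ _ (.skip (assn b E hE)) rfl (by simp))

/-- The state with contents zero. -/
def zeroSt (n l m : ℕ) : St n l m := ⟨0, 0, 0, 0⟩

open Classical in
/-- The projection onto the basis states with `G`, multiplied by an entry of the argument. -/
noncomputable def projOn (G : St n l m → Prop) (A : Matrix (St n l m) (St n l m) ℂ) :
    Matrix (St n l m) (St n l m) ℂ :=
  Matrix.of fun s s' => if G s ∧ s = s' then A (zeroSt n l m) (zeroSt n l m) else 0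

theorem projOn_apply_of {G : St n l m → Prop} (A : Matrix (St n l m) (St n l m) ℂ)
    {s s' : St n l m} (h : G s) (h' : s = s') :
    projOn G A s s' = A (zeroSt n l m) (zeroSt n l m) := if_pos ⟨h, h'⟩

theorem projOn_apply_of_not {G : St n l m → Prop} (A : Matrix (St n l m) (St n l m) ℂ)
    {s s' : St n l m} (h : ¬(G s ∧ s = s')) : projOn G A s s' = 0 := if_neg h

theorem isDual_projOn (G : St n l m → Prop) : IsDual (projOn G) := by
  refine ⟨Kraus.basisMap G (fun _ => zeroSt n l m) id,
    Kraus.isQOp_basisMap _ _ _ fun _ _ _ _ h _ => h, fun A => ?_⟩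
  ext s s'
  by_cases h : G s ∧ s = s'
  · rw [projOn_apply_of A h.1 h.2, Kraus.dual_basisMap_of A h.1 (h.2 ▸ h.1) h.2]
  · rw [projOn_apply_of_not A h]
    exact Kraus.dual_basisMap_of_not A fun h1 => h ⟨h1.1, h1.2.2⟩

theorem projOn_submatrix {G : St n l m → Prop} (A : Matrix (St n l m) (St n l m) ℂ)
    (e : St n l m ≃ St n l m) : (projOn G A).submatrix e e = projOn (fun s => G (e s)) A := by
  ext s s'
  rw [Matrix.submatrix_apply]
  by_cases h : G (e s) ∧ s = s'
  · rw [projOn_apply_of A h.1 (congrArg e h.2), projOn_apply_of (G := fun s => G (e s)) A h.1 h.2]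
  · rw [projOn_apply_of_not (G := fun s => G (e s)) A h, projOn_apply_of_not]
    exact fun h1 => h ⟨h1.1, e.injective h1.2⟩

theorem projOn_congr {G G' : St n l m → Prop} (h : ∀ s, G s ↔ G' s)
    (A : Matrix (St n l m) (St n l m) ℂ) : projOn G A = projOn G' A := by
  rw [show G = G' from funext fun s => propext (h s)]

theorem forget_projOn {κ : Fin (2 ^ m) → Fin (l + 2) → Prop} {G : St n l m → Prop}
    (hG : ∀ s, G (s.keep κ) ↔ G s) (A : Matrix (St n l m) (St n l m) ℂ) :
    (forget κ).dual (projOn G A) = projOn G A := by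
  ext s s'
  by_cases h : s.drop κ = s'.drop κ
  · rw [forget_dual_of _ h]
    by_cases h1 : G s ∧ s = s'
    · rw [projOn_apply_of A h1.1 h1.2, projOn_apply_of A ((hG s).2 h1.1) (congrArg _ h1.2)]
    · rw [projOn_apply_of_not A h1, projOn_apply_of_not]
      exact fun h2 => h1 ⟨(hG s).1 h2.1, St.keep_drop_injective κ h h2.2⟩
  · rw [forget_dual_of_ne _ h, projOn_apply_of_not]
    rintro ⟨-, rfl⟩
    exact h rfl

theorem run_projOn (g : (Fin n → ZMod 2) → ZMod 2)
    (sec : List (Fin n → ZMod 2) → (Fin n → ZMod 2)) {T : Fin (2 ^ m) → Prop}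
    {G : St n l m → Prop} (hT : ∀ s, G (St.query g sec 0 s) → T s.q)
    (A : Matrix (St n l m) (St n l m) ℂ) :
    (run g sec T).dual (projOn G A) = projOn (fun s => G (St.query g sec 0 s)) A := by
  ext s s'
  by_cases h : G (St.query g sec 0 s) ∧ s = s'
  · obtain ⟨h, rfl⟩ := h
    rw [run_dual_of _ (hT s h) (hT s h) rfl, projOn_apply_of A h rfl,
      projOn_apply_of (G := fun s => G (St.query g sec 0 s)) A h rfl]
  · rw [projOn_apply_of_not (G := fun s => G (St.query g sec 0 s)) A h]
    by_cases h1 : T s.q ∧ T s'.q ∧ s.q = s'.q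
    · rw [run_dual_of _ h1.1 h1.2.1 h1.2.2, projOn_apply_of_not]
      exact fun h2 => h ⟨h2.1, St.query_injective g sec 0 h2.2⟩
    · exact run_dual_of_not _ h1

theorem reset_projOn {r : Regs m} (L : Lens n l m r) {G : St n l m → Prop}
    (A : Matrix (St n l m) (St n l m) ℂ) :
    L.reset.dual (projOn G A) = projOn (fun s => G (L.set s 0)) A := by
  ext s s'
  by_cases h : L.get s = L.get s'
  · rw [L.reset_dual_of _ h]
    by_cases h1 : G (L.set s 0) ∧ s = s'
    · rw [projOn_apply_of A h1.1 (by rw [h1.2]),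
        projOn_apply_of (G := fun s => G (L.set s 0)) A h1.1 h1.2]
    · rw [projOn_apply_of_not (G := fun s => G (L.set s 0)) A h1, projOn_apply_of_not]
      refine fun h2 => h1 ⟨h2.1, ?_⟩
      rw [← L.set_get s, h, L.set_congr h2.2, L.set_get]
  · rw [L.reset_dual_of_ne _ h, projOn_apply_of_not]
    rintro ⟨-, rfl⟩
    exact h rfl

/-- The measurement of a qubit. -/
noncomputable def measB (n m : ℕ) (j : Fin (l + 2)) (b : ZMod 2) : Matrix (St n l m) (St n l m) ℂ :=
  (lensB j).lift (on Ty.bit (.var j.val) (Matrix.single b b 1))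

theorem on_single (v : Ref m) (b : ZMod 2) :
    on (n := n) Ty.bit v (Matrix.single b b 1) =
      Matrix.diagonal fun a => if (show ZMod 2 from a ()) = b then 1 else 0 := by
  have h : (Matrix.single b b 1 : Matrix (ZMod 2) (ZMod 2) ℂ) =
      Matrix.diagonal fun a => if a = b then 1 else 0 := by
    ext a c
    by_cases h1 : a = c <;> by_cases h2 : a = b <;> simp_all [eq_comm]
  exact (congrArg (on (n := n) Ty.bit v) h).trans
    (Matrix.submatrix_diagonal _ _ (Regs.oneEquiv Ty.bit v).injective)

theorem sum_on_single (v : Ref m) :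
    ∑ b : ZMod 2, (on (n := n) Ty.bit v (Matrix.single b b 1))ᴴ *
      on (n := n) Ty.bit v (Matrix.single b b 1) = 1 := by
  simp only [on_single, Matrix.diagonal_conjTranspose, Matrix.diagonal_mul_diagonal]
  rw [sum_zmod_two, ← Matrix.diagonal_one, Matrix.diagonal_add]
  congr 1
  funext a
  rcases zmod_two_cases (show ZMod 2 from a ()) with h | h <;> simp [h]

theorem measB_conj (j : Fin (l + 2)) (b : ZMod 2) (B : Matrix (St n l m) (St n l m) ℂ)
    (s s' : St n l m) : ((measB n m j b)ᴴ * B * measB n m j b) s s' =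
      if s.b j = b ∧ s'.b j = b then B s s' else 0 := by
  unfold measB
  rw [on_single, Lens.lift_diagonal_conj]
  change star (if s.b j = b then (1 : ℂ) else 0) * B s s' * (if s'.b j = b then (1 : ℂ) else 0) = _
  by_cases h : s.b j = b <;> by_cases h' : s'.b j = b <;> simp [h, h']

theorem sum_measB_projOn (j : Fin (l + 2)) (G : St n l m → Prop)
    (A : Matrix (St n l m) (St n l m) ℂ) :
    ∑ b, (measB n m j b)ᴴ * projOn G A * measB n m j b = projOn G A := by
  ext s s'
  rw [Matrix.sum_apply]
  simp only [measB_conj]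
  by_cases h : s = s'
  · subst h
    simp
  · have h1 : projOn G A s s' = 0 := projOn_apply_of_not A fun h1 => h h1.2
    simp [h1]

/-- The triple for the main program with assertions on all variables of the program. -/
theorem derives_main {g : (Fin n → ZMod 2) → ZMod 2}
    {sec : List (Fin n → ZMod 2) → (Fin n → ZMod 2)} (hl : 0 < l) (hlm : l < 2 ^ m)
    (hs : ∀ (path : List (Fin n → ZMod 2)) (x : Fin n → ZMod 2),
      path.length < l → g (sec (path ++ [x])) = sec path ⬝ᵥ x) :
    Derives (QTP (trueOrder n m) (rqfs l g sec)) false (projOn (l := l) fun _ => True)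
      (mainProg n m) (projOn fun s => s.p = 0 ∧ s.b (ixZ hl) = g (sec [])) := by
  have hJ : Closed (rqfs l g sec) (QTP (trueOrder n m) (rqfs l g sec)) := closed_QTP
  have hcall : Derives (QTP (trueOrder n m) (rqfs l g sec)) false
      (projOn fun s => s.p = 0 ∧ s.b (ixZ hl) = 0) (callRQFS (p m) (Z m))
      (projOn fun s => s.p = 0 ∧ s.b (ixZ hl) = g (sec [])) := by
    have h1 := derives_adap hJ (exch_actsBy hl) (by rw [globals_rqfs]; exact fun x hx => hx.elim)
      (isQOp_runForget ..).isDual (isQOp_forget _).isDual (derives_procedure hlm hs)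
    have h0 : ((rqfs (m := m) l g sec).callFormal ()).ren exch = callRQFS (p m) (Z m) :=
      callFormal_ren g sec exch
    rw [h0] at h1
    have h2 := derives_subst (b := false) hJ ((isQOp_runForget ..).isDual.reindex (exchSt hl))
      ((isQOp_forget _).isDual.reindex (exchSt hl))
      (isDual_projOn fun s => s.p = 0 ∧ s.b (ixZ hl) = g (sec [])) h1
    have hsub (A : Matrix (St n l m) (St n l m) ℂ) :
        (projOn (fun s : St n l m => s.p = 0 ∧ s.b (ixZ hl) = g (sec [])) A).submatrix
          (exchSt hl).symm (exchSt hl).symm =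
        projOn (fun s => s.q = 0 ∧ s.b 0 = g (sec [])) A := by
      rw [projOn_submatrix]
      refine projOn_congr (fun s => and_congr_right fun _ => ?_) A
      change s.b (Equiv.swap 0 (ixZ hl) (ixZ hl)) = _ ↔ _
      rw [Equiv.swap_apply_right]
    have hforget (A : Matrix (St n l m) (St n l m) ℂ) :
        (forget (kept l)).dual (projOn (fun s => s.q = 0 ∧ s.b 0 = g (sec [])) A) =
          projOn (fun s => s.q = 0 ∧ s.b 0 = g (sec [])) A :=
      forget_projOn (fun s => and_congr_right fun _ => by
        rw [show (s.keep (kept l)).b 0 = s.b 0 from if_pos (.inl rfl)]) A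
    refine (h2.of_pre_eq fun A => ?_).of_post_eq fun A => ?_
    · rw [hsub, ← run_dual_forget_dual, hforget, run_projOn, projOn_submatrix]
      · refine projOn_congr (fun s => and_congr_right fun hp => ?_) A
        change s.p = 0 at hp
        have h1 : St.query g sec 0 (exchSt hl s) =
            St.addBit 0 (g (sec ((exchSt hl s).path s.p))) (exchSt hl s) := rfl
        rw [h1, hp]
        change s.b (ixZ hl) = 0 ↔ Function.update (fun j => s.b (Equiv.swap 0 (ixZ hl) j)) 0
          (s.b (Equiv.swap 0 (ixZ hl) 0) + g (sec [])) 0 = _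
        rw [Function.update_self, Equiv.swap_apply_left, add_eq_right]
      · intro s h
        have h1 : s.q = 0 := h.1
        rw [h1]
        exact Nat.zero_le _
    · rw [hsub, hforget, ← hsub, submatrix_symm_equiv]
  refine .seq hJ (isDual_projOn _) ?_ (.seq hJ (isDual_projOn _) hcall ?_)
  · refine (derives_init hJ (lensPB (ixZ hl))).of_pre_eq fun A => ?_
    rw [reset_projOn]
    refine projOn_congr (fun s => iff_of_true trivial ⟨rfl, ?_⟩) A
    change Function.update s.b (ixZ hl) 0 (ixZ hl) = 0
    exact Function.update_self ..
  · refine (derives_ifm hJ (lensB (ixZ hl)) (sum_on_single _) (fun _ => isDual_projOn _)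
      fun _ => derives_skip hJ (isDual_projOn _)).of_pre_eq fun A => ?_
    exact (sum_measB_projOn (ixZ hl) _ A).symm

open Classical in
theorem ext_one (Γ : Finset (QVar m)) : ext Γ (1 : Matrix (Cfg n Γ) (Cfg n Γ) ℂ) = 1 := by
  ext σ σ'
  rw [Matrix.one_apply]
  simp only [ext, Matrix.of_apply, Matrix.one_apply]
  by_cases h : σ = σ'
  · simp [h]
  · rw [if_neg h]
    split_ifs with h1 h2
    · refine absurd (funext fun x => ?_) h
      by_cases hx : x ∈ Γ
      · exact congrFun h2 ⟨x, hx⟩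
      · exact h1 x hx
    · rfl
    · rfl

theorem dual_zero_add_dual_single {b : Type} [Fintype b] [DecidableEq b] (A K : Matrix b b ℂ) :
    (Kraus.zero b).dual A + (Kraus.single K).dual 1 = Kᴴ * K := by
  rw [Kraus.dual_zero, Kraus.dual_single, zero_add, mul_one]

theorem den_top (l : ℕ) (Γ : Finset (QVar m)) (v : Assign n m) :
    (Assn.top n Γ).den v = extSt (1 : Matrix (St n l m) (St n l m) ℂ) := by
  rw [extSt_one, ← ext_one Γ]
  refine (congrArg (ext Γ) (dual_zero_add_dual_single _ 1)).trans ?_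
  rw [Matrix.conjTranspose_one, mul_one]

theorem restrict_eq_outCfg_iff (σ : Mem n m) (y : ZMod 2) :
    σ.restrict (pZ m) = outCfg n (pZ m) y ↔
      σ (Ty.cnt, .var 0) = (0 : Fin (2 ^ m)) ∧ σ (Ty.bit, .var 2) = y := by
  constructor
  · intro h
    exact ⟨congrFun h ⟨(Ty.cnt, .var 0), by simp [pZ]⟩, congrFun h ⟨(Ty.bit, .var 2), by simp [pZ]⟩⟩
  · rintro ⟨h1, h2⟩
    funext ⟨x, hx⟩
    rcases Finset.mem_insert.1 hx with rfl | hx'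
    · exact h1
    · obtain rfl := Finset.mem_singleton.1 hx'
      exact h2

theorem den_ketbra (hl : 0 < l) (y : ZMod 2) (v : Assign n m) :
    (Assn.ketbra (pZ m) (outCfg n (pZ m) y)).den v =
      extSt (projOn (fun s : St n l m => s.p = 0 ∧ s.b (ixZ hl) = y) 1) := by
  refine (congrArg (ext (pZ m)) (dual_zero_add_dual_single _
    (Matrix.single (outCfg n (pZ m) y) (outCfg n (pZ m) y) 1))).trans ?_
  rw [Matrix.conjTranspose_single,
    Matrix.single_mul_single_same, star_one, mul_one]
  ext σ σ'
  simp only [ext, Matrix.of_apply]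
  by_cases h : σ = σ'
  · subst h
    rw [if_pos fun _ _ => rfl, extSt_of_agree _ fun _ _ => rfl]
    by_cases h1 : σ.restrict (pZ m) = outCfg n (pZ m) y
    · rw [h1, Matrix.single_apply_same, projOn_apply_of _ ((restrict_eq_outCfg_iff σ y).1 h1) rfl,
        Matrix.one_apply_eq]
    · rw [Matrix.single_apply_of_ne _ _ _ _ _ fun h2 => h1 h2.1.symm, projOn_apply_of_not]
      exact fun h2 => h1 ((restrict_eq_outCfg_iff σ y).2 h2.1)
  · trans 0
    · split_ifs with h1
      · refine Matrix.single_apply_of_ne _ _ _ _ _ fun h2 => h (funext fun x => ?_)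
        by_cases hx : x ∈ pZ m
        · exact congrFun (h2.1.symm.trans h2.2) ⟨x, hx⟩
        · exact h1 x hx
      · rfl
    · symm
      by_cases h1 : ∀ x, x ∉ vars l m → σ x = σ' x
      · rw [extSt_of_agree _ h1, projOn_apply_of_not]
        refine fun h2 => h (funext fun x => ?_)
        by_cases hx : x ∈ vars l m
        · exact (St.read_eq_iff σ σ').1 h2.2 x hx
        · exact h1 x hx
      · exact extSt_of_not_agree _ h1

theorem projOn_true_one : projOn (fun _ : St n l m => True) 1 = 1 := by
  ext s s'
  by_cases h : s = s'
  · rw [projOn_apply_of (G := fun _ => True) 1 trivial h, h, Matrix.one_apply_eq,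
      Matrix.one_apply_eq]
  · rw [projOn_apply_of_not 1 fun h1 => h h1.2, Matrix.one_apply_ne h]

end MainProgram

end RQFS

theorem mainTheorem10 (n l m : ℕ) (hn : 0 < n) (hl : 0 < l) (hlm : l < 2 ^ m)
    (g : (Fin n → ZMod 2) → ZMod 2)
    (s : List (Fin n → ZMod 2) → (Fin n → ZMod 2))
    (hs : ∀ (path : List (Fin n → ZMod 2)) (x : Fin n → ZMod 2), path.length < l →
      g (s (path ++ [x])) = s path ⬝ᵥ x) :
    RQFS.QTP (RQFS.trueOrder n m) (RQFS.rqfs l g s)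
      ⟨RQFS.Assn.top n (RQFS.pZ m), RQFS.mainProg n m,
        RQFS.Assn.ketbra (RQFS.pZ m) (RQFS.outCfg n (RQFS.pZ m) (g (s [])))⟩ := by
  obtain ⟨E, hE, h⟩ := RQFS.isDual_projOn (n := n) (l := l) (m := m) fun _ => True
  obtain ⟨E', hE', h'⟩ := RQFS.isDual_projOn (n := n) (l := l) (m := m)
    fun t => t.p = 0 ∧ t.b (RQFS.ixZ hl) = g (s [])
  refine RQFS.closed_QTP _ _
    (.order _ (RQFS.assn false E hE) (RQFS.assn false E' hE') _ _ ?_ ?_) rfl ?_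
  · refine RQFS.mem_trueOrder rfl fun v => ?_
    rw [RQFS.assn_den, h, RQFS.den_top l,
      show RQFS.val (l := l) false v = 1 from rfl, RQFS.projOn_true_one, sub_self]
    exact .zero
  · refine RQFS.mem_trueOrder rfl fun v => ?_
    rw [RQFS.assn_den, h', RQFS.den_ketbra hl,
      show RQFS.val (l := l) false v = 1 from rfl, sub_self]
    exact .zero
  · rintro _ rfl
    exact RQFS.derives_main hl hlm hs _ _ _ _ h h'
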